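/- Let $W\subset O(2)$ be a finite group generated by reflections of the Euclidean plane $\mathbb R^2$ without nonzero fixed vector, let $\mathcal A$ be the set of the lines $H$ fixed by the reflections in $W$, $h=|\mathcal A|$, and for $H\in\mathcal A$ fix a linear form $\alpha_H$ with $\ker\alpha_H=H$. Let $S=\mathbb R[x_1,x_2]$ (with $x_1,x_2$ orthonormal coordinates), let $F$ be its quotient field, and let $S^W=\mathbb R[P_1,P_2]$ with homogeneous algebraically independent $P_1,P_2$, $\deg P_1<\deg P_2$. Let $D=\partial_{P_2}$ be the primitive derivation, regarded as a derivation of $F$, let $\theta_E=x_1\partial_{x_1}+x_2\partial_{x_2}$, and let $\nabla_\theta\bigl(\sum_i f_i\partial_{x_i}\bigr)=\sum_i\theta(f_i)\partial_{x_i}$ for $\theta\in\mathrm{Der}(F)$. For $m:\mathcal A\to\mathbb Z_{\ge 0}$ put $D(\mathcal A,m)=\{\theta\in\mathrm{Der}(S)\mid \theta(\alpha_H)\in S\alpha_H^{m(H)}\ \forall H\in\mathcal A\}$. For $m:\mathcal A\to\mathbb Z_{\le 0}$ put $Q=\prod_H\alpha_H^{-m(H)}$ and let $D(\mathcal A,m)$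 be the image, under the isomorphism $dx_i\mapsto\partial_{x_i}$ given by the inner product, of the module of rational $1$-forms $\omega$ such that $Q\omega$ and $Q\,\alpha_H^{m(H)}\,d\alpha_H\wedge\omega$ $(H\in\mathcal A)$ have coefficients in $S$. Let $D(\mathcal A,-\infty)^W$ be the space of $W$-invariant elements of $\bigcup_{n\ge0}D(\mathcal A,-n)$, where an integer stands for the constant multiplicity. Then $\theta_E\in D(\mathcal A,-\infty)^W$, and $\nabla_D$ restricts to an $\mathbb R$-linear automorphism of $D(\mathcal A,-\infty)^W$, so that $E_k:=\nabla_D^{-k}\theta_E\in D(\mathcal A,-\infty)^W$ is defined for every $k\in\mathbb Z$. For every $k\in\mathbb Z$ the derivation $E_k$ is the $(\mathcal A,2k+1)$-Euler derivation. That is, $h>2$, and with $m_0$ the constant multiplicity $2k+1$ the following hold. 1. $|m_0(K)|\le\sum_{H\ne K}|m_0(H)|$ for all $K\in\mathcal A$, and the same for $m_0-1$ if $h=3$. 2. The $S$-module $D(\mathcal A,m_0)$ is free with a homogeneous basis of two elements whose degrees differ by exactly $h-2$, and $E_k$ is a lower degree basis element: there is $\varphi$ such that $\{E_k,\varphi\}$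 is a homogeneous $S$-basis of $D(\mathcal A,m_0)$ with $\deg E_k\le\deg\varphi$. 3. For every $m:\mathcal A\to\{0,1\}$ the map $\theta\mapsto\nabla_\theta E_k$ is an isomorphism of $S$-modules $D(\mathcal A,m)\to D(\mathcal A,2k+m)$. Here $\theta\in\mathrm{Der}(F)$ is homogeneous of degree $d\in\mathbb Z$ if each $\theta(x_i)$ is a quotient of homogeneous polynomials with degree difference $d$. -/

import Mathlib

noncomputable section

namespace PlaneArr

/-- The coordinate ring `S = ℝ[x₀, x₁]` of the plane. -/
abbrev Poly : Type := MvPolynomial (Fin 2) ℝ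

/-- The quotient field `F` of `S`. -/
abbrev Rat2 : Type := FractionRing Poly

/-- `Der(F) = Der(S) ⊗ F`, the `ℝ`-derivations of the field of rational functions. -/
abbrev DerF : Type := Derivation ℝ Rat2 Rat2

/-- The coordinate `xᵢ` as a rational function. -/
def coord (i : Fin 2) : Rat2 := algebraMap Poly Rat2 (MvPolynomial.X i)

/-! ### Derivations with prescribed coefficients -/

/-- The algebra homomorphism `p ↦ p + ε ∑ᵢ fᵢ ∂p/∂xᵢ` from `S` to the dual numbers over `F`. -/
def dualHom (f : Fin 2 → Rat2) : Poly →ₐ[ℝ] TrivSqZeroExt Rat2 Rat2 :=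
  MvPolynomial.aeval fun i => TrivSqZeroExt.inl (coord i) + TrivSqZeroExt.inr (f i)

theorem dualHom_fst (f : Fin 2 → Rat2) (p : Poly) :
    (dualHom f p).fst = algebraMap Poly Rat2 p := by
  have h : (TrivSqZeroExt.fstHom ℝ Rat2 Rat2).comp (dualHom f)
      = IsScalarTower.toAlgHom ℝ Poly Rat2 := by
    apply MvPolynomial.algHom_ext
    intro i
    simp [dualHom, coord]
  exact DFunLike.congr_fun h p

theorem dualHom_isUnit (f : Fin 2 → Rat2) (p : nonZeroDivisors Poly) :
    IsUnit (dualHom f p) := by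
  rw [TrivSqZeroExt.isUnit_iff_isUnit_fst, dualHom_fst]
  exact IsLocalization.map_units Rat2 p

/-- The extension of `dualHom f` to `F`. -/
def dualLift (f : Fin 2 → Rat2) : Rat2 →+* TrivSqZeroExt Rat2 Rat2 :=
  IsLocalization.lift (M := nonZeroDivisors Poly) (g := (dualHom f : Poly →+* _))
    (dualHom_isUnit f)

theorem dualLift_algebraMap (f : Fin 2 → Rat2) (p : Poly) :
    dualLift f (algebraMap Poly Rat2 p) = dualHom f p :=
  IsLocalization.lift_eq _ p

theorem dualLift_fst (f : Fin 2 → Rat2) (q : Rat2) : (dualLift f q).fst = q := by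
  have h : ((TrivSqZeroExt.fstHom ℝ Rat2 Rat2 : _ →+* Rat2)).comp (dualLift f)
      = RingHom.id Rat2 := by
    apply IsLocalization.ringHom_ext (nonZeroDivisors Poly)
    refine RingHom.ext fun p => ?_
    simp [dualLift_algebraMap, dualHom_fst]
  exact DFunLike.congr_fun h q

/-- The derivation `f₀ ∂/∂x₀ + f₁ ∂/∂x₁` of `F`, i.e. the one that sends `xᵢ` to `fᵢ`
(see `ofCoeff_coord`). -/
def ofCoeff (f : Fin 2 → Rat2) : DerF :=
  Derivation.mk'
    { toFun := fun q => (dualLift f q).snd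
      map_add' := fun a b => by simp
      map_smul' := fun r q => by
        have h : algebraMap ℝ Rat2 r = algebraMap Poly Rat2 (MvPolynomial.C r) := by
          rw [IsScalarTower.algebraMap_apply ℝ Poly Rat2]; rfl
        have h2 : dualHom f (MvPolynomial.C r) = TrivSqZeroExt.inl (algebraMap ℝ Rat2 r) := by
          rw [← MvPolynomial.algebraMap_eq, AlgHom.commutes]; rfl
        rw [Algebra.smul_def, map_mul, h, dualLift_algebraMap, h2, TrivSqZeroExt.snd_mul]
        simp [Algebra.smul_def] }
    fun a b => by
      simp [TrivSqZeroExt.snd_mul, dualLift_fst, mul_comm]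

theorem ofCoeff_algebraMap (f : Fin 2 → Rat2) (p : Poly) :
    ofCoeff f (algebraMap Poly Rat2 p) = (dualHom f p).snd := by
  change (dualLift f _).snd = _
  rw [dualLift_algebraMap]

@[simp] theorem ofCoeff_coord (f : Fin 2 → Rat2) (i : Fin 2) : ofCoeff f (coord i) = f i := by
  rw [coord, ofCoeff_algebraMap]
  simp [dualHom]

/-- The Euler derivation `θ_E = x₀ ∂/∂x₀ + x₁ ∂/∂x₁`. -/
def euler : DerF := ofCoeff coord

/-- The affine connection: `∇_θ (∑ᵢ fᵢ ∂/∂xᵢ) = ∑ᵢ θ(fᵢ) ∂/∂xᵢ`. -/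
def nabla (θ η : DerF) : DerF := ofCoeff fun i => θ (η (coord i))

/-! ### Homogeneous rational derivations -/

/-- A rational function is homogeneous of degree `d : ℤ` if it is a quotient of homogeneous
polynomials the degrees of which differ by `d`. -/
def IsHomogeneousRat (f : Rat2) (d : ℤ) : Prop :=
  ∃ (a b : ℕ) (p q : Poly), p.IsHomogeneous a ∧ q.IsHomogeneous b ∧ q ≠ 0 ∧
    f = algebraMap Poly Rat2 p / algebraMap Poly Rat2 q ∧ (a : ℤ) - b = d

/-- `θ` is homogeneous of degree `d` if all `θ(α)`, `α` a linear form, are. -/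
def IsHomogeneousDer (θ : DerF) (d : ℤ) : Prop := ∀ i, IsHomogeneousRat (θ (coord i)) d

/-! ### Central arrangements of lines in the plane -/

/-- A finite family of pairwise distinct lines through the origin of `ℝ²`, each with a chosen
linear form `normal H 0 * x₀ + normal H 1 * x₁` that defines it. -/
structure LineArrangement (ι : Type*) where
  normal : ι → Fin 2 → ℝ
  normal_ne_zero : ∀ H, normal H ≠ 0
  distinct : ∀ H K, H ≠ K → normal H 0 * normal K 1 - normal H 1 * normal K 0 ≠ 0

namespace LineArrangement

variable {ι : Type*} (A : LineArrangement ι)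

/-- The line `ker α_H`. -/
def line (H : ι) : Submodule ℝ (Fin 2 → ℝ) where
  carrier := {v | A.normal H 0 * v 0 + A.normal H 1 * v 1 = 0}
  add_mem' := by
    intro v w hv hw
    simp only [Set.mem_ofPred_eq, Pi.add_apply] at *
    linear_combination hv + hw
  zero_mem' := by simp
  smul_mem' := by
    intro c v hv
    simp only [Set.mem_ofPred_eq, Pi.smul_apply, smul_eq_mul] at *
    linear_combination c * hv

/-- The linear form `α_H`. -/
def form (H : ι) : Poly :=
  MvPolynomial.C (A.normal H 0) * MvPolynomial.X 0
    + MvPolynomial.C (A.normal H 1) * MvPolynomial.X 1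

/-- The linear form `β_H` orthogonal to `α_H`: the form `α_H` rotated by a right angle. With
`ω = θ(x₀) dx₀ + θ(x₁) dx₁`, the `1`-form that corresponds to `θ` under the inner product,
`dα_H ∧ ω = θ(β_H) dx₀ ∧ dx₁`. -/
def perpForm (H : ι) : Poly :=
  MvPolynomial.C (-A.normal H 1) * MvPolynomial.X 0
    + MvPolynomial.C (A.normal H 0) * MvPolynomial.X 1

variable [Fintype ι]

/-- `∏_H α_H ^ max(-m(H), 0)`. -/
def poleDenom (m : ι → ℤ) : Poly := ∏ H, A.form H ^ (-m H).toNat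

/-- The logarithmic module `D(A, m)` of a multiplicity `m : A → ℤ`, an `S`-submodule of
`Der(F)`.

If `m ≥ 0`, then `poleDenom m = 1` and this is
`{θ ∈ Der(S) | θ(α_H) ∈ S α_H ^ m(H) for all H}`.

If `m ≤ 0`, then it is the image under the isomorphism `Ω¹(F) ≃ Der(F)`, `dxᵢ ↦ ∂/∂xᵢ`, given by
the inner product, of the module `Ω¹(A, -m)` of logarithmic `1`-forms, i.e. of those rational `ω`
for which `Q ω` and `Q α_H ^ m(H) (dα_H ∧ ω)`, for all `H`, are regular, where
`Q = ∏_H α_H ^ (-m(H))`. -/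
def logDer (m : ι → ℤ) : Submodule Poly DerF where
  carrier := {θ |
    (∀ i, ∃ p : Poly, algebraMap Poly Rat2 (A.poleDenom m) * θ (coord i)
      = algebraMap Poly Rat2 p) ∧
    (∀ H, 0 ≤ m H → ∃ p : Poly,
      algebraMap Poly Rat2 (A.poleDenom m) * θ (algebraMap Poly Rat2 (A.form H))
        = algebraMap Poly Rat2 (A.form H ^ (m H).toNat * p)) ∧
    (∀ H, m H < 0 → ∃ p : Poly,
      algebraMap Poly Rat2 (A.poleDenom m) * θ (algebraMap Poly Rat2 (A.perpForm H))
        = algebraMap Poly Rat2 (A.form H ^ (-m H).toNat * p))}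
  add_mem' := by
    rintro θ η ⟨h1, h2, h3⟩ ⟨k1, k2, k3⟩
    refine ⟨fun i => ?_, fun H hH => ?_, fun H hH => ?_⟩
    · obtain ⟨p, hp⟩ := h1 i
      obtain ⟨q, hq⟩ := k1 i
      exact ⟨p + q, by rw [Derivation.add_apply, mul_add, hp, hq, map_add]⟩
    · obtain ⟨p, hp⟩ := h2 H hH
      obtain ⟨q, hq⟩ := k2 H hH
      exact ⟨p + q, by rw [Derivation.add_apply, mul_add, hp, hq, mul_add, map_add]⟩
    · obtain ⟨p, hp⟩ := h3 H hH
      obtain ⟨q, hq⟩ := k3 H hH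
      exact ⟨p + q, by rw [Derivation.add_apply, mul_add, hp, hq, mul_add, map_add]⟩
  zero_mem' :=
    ⟨fun i => ⟨0, by simp⟩, fun H _ => ⟨0, by simp⟩, fun H _ => ⟨0, by simp⟩⟩
  smul_mem' := by
    rintro c θ ⟨h1, h2, h3⟩
    refine ⟨fun i => ?_, fun H hH => ?_, fun H hH => ?_⟩
    · obtain ⟨p, hp⟩ := h1 i
      exact ⟨c * p, by
        rw [Derivation.smul_apply, Algebra.smul_def, mul_left_comm, hp, map_mul]⟩
    · obtain ⟨p, hp⟩ := h2 H hH
      exact ⟨c * p, by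
        rw [Derivation.smul_apply, Algebra.smul_def, mul_left_comm, hp, ← map_mul,
          mul_left_comm]⟩
    · obtain ⟨p, hp⟩ := h3 H hH
      exact ⟨c * p, by
        rw [Derivation.smul_apply, Algebra.smul_def, mul_left_comm, hp, ← map_mul,
          mul_left_comm]⟩

open Classical in
/-- `m` is balanced: `m(K) ≤ ∑_{H ≠ K} m(H)` for all `K`. For a nonpositive multiplicity this is
the condition that `-m` is balanced. -/
def Balanced (m : ι → ℤ) : Prop := ∀ K, |m K| ≤ ∑ H ∈ Finset.univ.erase K, |m H|

/-- `θ, φ` is a homogeneous `S`-basis of `D(A, m)`, of degrees `d, e`. -/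
def IsHomogeneousBasis (m : ι → ℤ) (θ φ : DerF) (d e : ℤ) : Prop :=
  (∃ b : Module.Basis (Fin 2) Poly (A.logDer m), (b 0 : DerF) = θ ∧ (b 1 : DerF) = φ) ∧
    IsHomogeneousDer θ d ∧ IsHomogeneousDer φ e

/-- `exp(A, m) = (d, e)`. -/
def HasExponents (m : ι → ℤ) (d e : ℤ) : Prop :=
  ∃ θ φ, A.IsHomogeneousBasis m θ φ d e

/-- `Δ(m) = n`, where `Δ(m) = |d - e|` if `exp(A, m) = (d, e)`. -/
def HasDelta (m : ι → ℤ) (n : ℤ) : Prop := ∃ d e, A.HasExponents m d e ∧ |d - e| = n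

/-- `θ` is the lower degree basis (element) of `D(A, m)`. -/
def IsLowerDegreeBasis (m : ι → ℤ) (θ : DerF) : Prop :=
  ∃ φ d e, A.IsHomogeneousBasis m θ φ d e ∧ d ≤ e

/-- `θ₀` is the `(A, m₀)`-Euler derivation: `A` has `h > 2` lines, `m₀` is balanced with
`Δ(m₀) = h - 2`, and `m₀ - 1` is balanced in case `h = 3`; the derivation `θ₀` is the lower
degree basis of `D(A, m₀)`, and `θ ↦ ∇_θ θ₀` is an isomorphism of `S`-modules
`D(A, m) → D(A, m₀ + m - 1)` for every `m : A → {0, 1}`. -/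
structure IsEulerDerivation (m₀ : ι → ℤ) (θ₀ : DerF) : Prop where
  two_lt_card : 2 < Fintype.card ι
  balanced : Balanced m₀
  balanced_sub_one : Fintype.card ι = 3 → Balanced fun H => m₀ H - 1
  delta : A.HasDelta m₀ ((Fintype.card ι : ℤ) - 2)
  lower : A.IsLowerDegreeBasis m₀ θ₀
  shift : ∀ m : ι → ℤ, (∀ H, m H = 0 ∨ m H = 1) →
    ∃ Φ : A.logDer m ≃ₗ[Poly] A.logDer fun H => m₀ H + m H - 1,
      ∀ θ : A.logDer m, (Φ θ : DerF) = nabla θ θ₀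

end LineArrangement

/-! ### Reflection groups in the plane -/

/-- The orthogonal group `O(2)`. -/
abbrev O2 : Type := Matrix.orthogonalGroup (Fin 2) ℝ

/-- The fixed space of `g`. -/
def fixedSpace (g : O2) : Submodule ℝ (Fin 2 → ℝ) :=
  LinearMap.ker (Matrix.toLin' (g : Matrix (Fin 2) (Fin 2) ℝ) - LinearMap.id)

/-- An orthogonal transformation of the plane is a reflection if it fixes exactly a line. -/
def IsReflection (g : O2) : Prop := Module.finrank ℝ (fixedSpace g) = 1

/-- A Coxeter group of rank `2`: a finite group generated by orthogonal reflections of `ℝ²`, with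
no nonzero fixed vector. -/
structure IsCoxeterGroup (W : Subgroup O2) : Prop where
  finite : Finite W
  generated : Subgroup.closure {g | g ∈ W ∧ IsReflection g} = W
  essential : ∀ v : Fin 2 → ℝ, (∀ g ∈ W, v ∈ fixedSpace g) → v = 0

/-- `A` is the Coxeter arrangement of `W`: its lines are the mirrors of the reflections
in `W`. -/
def IsCoxeterArrangement (W : Subgroup O2) {ι : Type*} (A : LineArrangement ι) : Prop :=
  Set.range A.line = {L | ∃ g ∈ W, IsReflection g ∧ L = fixedSpace g}

/-- The substitution `p ↦ p ∘ g⁻¹` on polynomial functions. -/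
def polyActHom (g : O2) : Poly →ₐ[ℝ] Poly :=
  MvPolynomial.aeval fun i => ∑ j, MvPolynomial.C ((g⁻¹ : O2).1 i j) * MvPolynomial.X j

theorem polyActHom_mul (g k : O2) :
    polyActHom (g * k) = (polyActHom g).comp (polyActHom k) := by
  apply MvPolynomial.algHom_ext
  intro i
  have h : ∀ j, (((g * k)⁻¹ : O2).1 i j)
      = ∑ l, (k⁻¹ : O2).1 i l * (g⁻¹ : O2).1 l j := by
    intro j
    rw [mul_inv_rev]
    rfl
  simp only [polyActHom, AlgHom.comp_apply, MvPolynomial.aeval_X, h, Fin.sum_univ_two,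
    map_add, map_mul, MvPolynomial.aeval_C, MvPolynomial.algebraMap_eq]
  ring

theorem polyActHom_one : polyActHom 1 = AlgHom.id ℝ Poly := by
  apply MvPolynomial.algHom_ext
  intro i
  fin_cases i <;> simp [polyActHom]

/-- The action of `g` on `S`. -/
def polyAct (g : O2) : Poly ≃ₐ[ℝ] Poly :=
  AlgEquiv.ofAlgHom (polyActHom g) (polyActHom g⁻¹)
    (by rw [← polyActHom_mul, mul_inv_cancel, polyActHom_one])
    (by rw [← polyActHom_mul, inv_mul_cancel, polyActHom_one])

/-- The action of `g` on `F`. -/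
def fieldAct (g : O2) : Rat2 ≃+* Rat2 :=
  IsFractionRing.ringEquivOfRingEquiv (polyAct g).toRingEquiv

/-- The invariant ring `R = S^W`. -/
def invariantRing (W : Subgroup O2) : Subalgebra ℝ Poly where
  carrier := {p | ∀ g ∈ W, polyAct g p = p}
  mul_mem' := by
    intro p q hp hq g hg
    rw [map_mul, hp g hg, hq g hg]
  add_mem' := by
    intro p q hp hq g hg
    rw [map_add, hp g hg, hq g hg]
  algebraMap_mem' := fun r g _ => AlgEquiv.commutes _ r

/-- `P 0, P 1` are basic invariants of `W`, i.e. homogeneous and algebraically independent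
generators of the invariant ring, numbered so that `deg (P 0) < deg (P 1)`. -/
structure IsBasicInvariants (W : Subgroup O2) (P : Fin 2 → Poly) : Prop where
  homogeneous : ∃ d : Fin 2 → ℕ, (∀ i, (P i).IsHomogeneous (d i)) ∧ d 0 < d 1
  independent : AlgebraicIndependent ℝ P
  generate : Algebra.adjoin ℝ (Set.range P) = invariantRing W

/-- The Jacobian matrix `(∂Pᵢ/∂xⱼ)`. -/
def jacobian (P : Fin 2 → Poly) : Matrix (Fin 2) (Fin 2) Rat2 :=
  Matrix.of fun i j => algebraMap Poly Rat2 (MvPolynomial.pderiv j (P i))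

/-- The primitive derivation `D = ∂/∂P₁`, where `P 1` is the basic invariant of the highest degree,
as a derivation of `F`: by the chain rule `D(xᵢ)` is the entry `(i, 1)` of the inverse of the
Jacobian matrix. See `primitive_apply`. -/
def primitive (P : Fin 2 → Poly) : DerF := ofCoeff fun i => (jacobian P)⁻¹ i 1

theorem ofCoeff_poly (f : Fin 2 → Rat2) (p : Poly) :
    ofCoeff f (algebraMap Poly Rat2 p)
      = ∑ j, algebraMap Poly Rat2 (MvPolynomial.pderiv j p) * f j := by
  induction p using MvPolynomial.induction_on with
  | C a =>
    have h : algebraMap Poly Rat2 (MvPolynomial.C a) = algebraMap ℝ Rat2 a := by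
      rw [IsScalarTower.algebraMap_apply ℝ Poly Rat2]; rfl
    rw [h, Derivation.map_algebraMap]
    simp
  | add p q hp hq =>
    rw [map_add, map_add, hp, hq, ← Finset.sum_add_distrib]
    exact Finset.sum_congr rfl fun j _ => by rw [map_add, map_add, add_mul]
  | mul_X p i hp =>
    have hX : ofCoeff f (algebraMap Poly Rat2 (MvPolynomial.X i)) = f i := ofCoeff_coord f i
    rw [map_mul, Derivation.leibniz, hp, hX]
    fin_cases i <;>
      simp [Fin.sum_univ_two, MvPolynomial.pderiv_X, Derivation.leibniz, Pi.single_apply] <;> ring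

theorem primitive_apply (P : Fin 2 → Poly) (hP : (jacobian P).det ≠ 0) (i : Fin 2) :
    primitive P (algebraMap Poly Rat2 (P i)) = if i = 1 then 1 else 0 := by
  have h := congrFun (congrFun (Matrix.mul_nonsing_inv (jacobian P) (Ne.isUnit hP)) i) 1
  rw [Matrix.one_apply] at h
  rw [primitive, ofCoeff_poly, ← h, Matrix.mul_apply]
  rfl

/-- The `W`-invariant rational derivations: `g (θ f) = θ (g f)`. -/
def invariantDer (W : Subgroup O2) : Submodule ℝ DerF where
  carrier := {θ | ∀ g ∈ W, ∀ f, fieldAct g (θ f) = θ (fieldAct g f)}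
  add_mem' := by
    intro θ η hθ hη g hg f
    rw [Derivation.add_apply, map_add, hθ g hg, hη g hg, Derivation.add_apply]
  zero_mem' := by
    intro g _ f
    simp
  smul_mem' := by
    intro c θ hθ g hg f
    have h : fieldAct g (algebraMap ℝ Rat2 c) = algebraMap ℝ Rat2 c := by
      rw [IsScalarTower.algebraMap_apply ℝ Poly Rat2, fieldAct,
        IsFractionRing.ringEquivOfRingEquiv_algebraMap]
      congr 1
      exact AlgEquiv.commutes (polyAct g) c
    rw [Derivation.smul_apply, Derivation.smul_apply, Algebra.smul_def, Algebra.smul_def, map_mul,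
      h, hθ g hg]

/-- `D(A, -∞)^W`: the `W`-invariant elements of `D(A, -∞) = ⋃ₙ D(A, -n)`. (The union of
this increasing sequence of submodules is written as their supremum.) -/
def invLogDer (W : Subgroup O2) {ι : Type*} [Fintype ι] (A : LineArrangement ι) :
    Submodule ℝ DerF :=
  (⨆ n : ℕ, A.logDer fun _ => -(n : ℤ)).restrictScalars ℝ ⊓ invariantDer W

theorem fieldAct_algebraMap (g : O2) (p : Poly) :
    fieldAct g (algebraMap Poly Rat2 p) = algebraMap Poly Rat2 (polyAct g p) :=
  IsFractionRing.ringEquivOfRingEquiv_algebraMap _ p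

theorem euler_mem_invariantDer (W : Subgroup O2) : euler ∈ invariantDer W := by
  intro g _ f
  have hC : ∀ a : ℝ, algebraMap Poly Rat2 (MvPolynomial.C a) = algebraMap ℝ Rat2 a := fun a => by
    rw [IsScalarTower.algebraMap_apply ℝ Poly Rat2]; rfl
  have hX : ∀ i, euler (algebraMap Poly Rat2 (MvPolynomial.X i))
      = algebraMap Poly Rat2 (MvPolynomial.X i) := fun i => ofCoeff_coord coord i
  have hlin : ∀ i, euler (algebraMap Poly Rat2 (polyAct g (MvPolynomial.X i)))
      = algebraMap Poly Rat2 (polyAct g (MvPolynomial.X i)) := by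
    intro i
    have h : polyAct g (MvPolynomial.X i)
        = ∑ j, MvPolynomial.C ((g⁻¹ : O2).1 i j) * MvPolynomial.X j := by
      change polyActHom g _ = _
      rw [polyActHom, MvPolynomial.aeval_X]
    simp only [h, Fin.sum_univ_two, map_add, map_mul, Derivation.leibniz, hX, hC,
      Derivation.map_algebraMap, smul_eq_mul, mul_zero, add_zero]
  have hp : ∀ p : Poly, fieldAct g (euler (algebraMap Poly Rat2 p))
      = euler (fieldAct g (algebraMap Poly Rat2 p)) := by
    intro p
    induction p using MvPolynomial.induction_on with
    | C a =>
      have h : polyAct g (MvPolynomial.C a) = MvPolynomial.C a := AlgEquiv.commutes _ a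
      rw [fieldAct_algebraMap, h, hC, Derivation.map_algebraMap, map_zero]
    | add p q hp hq => simp only [map_add, hp, hq]
    | mul_X p i hp =>
      simp only [map_mul, Derivation.leibniz, map_add, smul_eq_mul, hp, hX,
        fieldAct_algebraMap, hlin]
  obtain ⟨p, q, hq, rfl⟩ := IsFractionRing.div_surjective (A := Poly) f
  rw [Derivation.leibniz_div euler, map_div₀ (fieldAct g), Derivation.leibniz_div euler]
  simp only [smul_eq_mul, map_mul, map_sub, map_pow, map_inv₀, hp]

/-- The Euler derivation as an element of `D(A, -∞)^W`. -/
def eulerInv (W : Subgroup O2) {ι : Type*} [Fintype ι] (A : LineArrangement ι) :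
    invLogDer W A :=
  ⟨euler, by
    refine ⟨?_, euler_mem_invariantDer W⟩
    have h : euler ∈ A.logDer fun _ => -((0 : ℕ) : ℤ) := by
      refine ⟨fun i => ⟨MvPolynomial.X i, ?_⟩, fun H _ => ⟨A.form H, ?_⟩, fun H hH => ?_⟩
      · have h : euler (coord i) = algebraMap Poly Rat2 (MvPolynomial.X i) := ofCoeff_coord coord i
        simp [LineArrangement.poleDenom, h]
      · simp [LineArrangement.poleDenom, euler, ofCoeff_poly, LineArrangement.form,
          Fin.sum_univ_two, coord, MvPolynomial.pderiv_X, Derivation.leibniz]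
      · simp at hH
    exact Submodule.mem_iSup_of_mem (p := fun n : ℕ => A.logDer fun _ => -(n : ℤ)) 0 h⟩

end PlaneArr

end

noncomputable section

namespace PlaneArr

open MvPolynomial

local notation "toF" => algebraMap Poly Rat2
local notation "cst" => algebraMap ℝ Rat2

/-! The proof is governed by the infinitesimal rotation `rot`, with which every reflection
anticommutes. The product `Q` of the forms is odd under all reflections of `W`, and every such odd
polynomial is a multiple of `Q`. Hence `rot² Q` is a multiple of `Q`, and evaluation at the
isotropic point `(1, i)` gives the factor `-h²` (`IsCoxeterGroup.rotPoly_rotPoly_defPoly`). So `N =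
rot Q` is an invariant of degree `h`. Comparing degrees, `P 0` is a multiple of `x₀² + x₁²` and `rot
(P 1) = c Q`, so that `D = (c Q)⁻¹ rot`. Rotation invariant functions are constants for `D`, and `p
= -(c / h²) N` satisfies `D p = 1`.

The Euler derivation `E₀` and the gradient `G₀` of `N` satisfy `p ∇_D E₀ = (1/h) E₀ + a ∇_D G₀` and
`p ∇_D G₀ = ((h-1)/h) G₀ + b ∇_D E₀` with `D`-constants `a`, `b`. Applying `∇_D` or integrating
reproduces this system with the scalars `1/h`, `(h-1)/h` shifted by integers. The shifted scalars
never vanish, so `E₀` and `G₀` have iterated primitives `E k`, `G k` for all integers `k`, tied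
together by `p E_k = (k+1+1/h) E_{k+1} + a G_k` and its companion for `G`
(`exists_primitive_sequences`).

A parity argument at each mirror shows that `∇_D` lowers the multiplicity of an invariant derivation
by exactly two; hence `E k` and `G k` lie in `D(A, 2k+1)`. The transition from index `k` to `k+1`
has determinant `p² - ab`, a multiple of `Q²`, so the determinant of `E k`, `G k` is a nonzero
multiple of `Q^(2k+1)`. By Saito's criterion they form a basis, of degrees `kh+1` and `kh+h-1`. The
Jacobian of `E k` is found by differentiating `E k` along `θ_E` and `D`; it is a nonzero multiple of
`Q^(2k)`, and Cramer's rule together with local orders gives the isomorphisms `θ ↦ ∇_θ E_k`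
(`exists_shift_equiv`).

An invariant derivation killed by `∇_D` vanishes to infinite order on every line, so `∇_D` is
injective. For surjectivity let `T` be the ring of invariant `D`-constants. The invariant ring is
generated by `T` and `p`, and the relations above make the `T`-span of all `E k`, `G k` stable under
`p`. This span is therefore all of `D(A, -∞)^W`, and on it preimages are found by raising `k` by one
(`exists_nabla_eq`). -/

theorem toF_C (a : ℝ) : toF (C a) = cst a := by
  rw [IsScalarTower.algebraMap_apply ℝ Poly Rat2]; rfl

theorem toF_injective : Function.Injective toF := IsFractionRing.injective Poly Rat2

theorem toF_eq_zero {p : Poly} : toF p = 0 ↔ p = 0 :=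
  map_eq_zero_iff _ toF_injective

theorem cst_eq_zero {a : ℝ} : cst a = 0 ↔ a = 0 :=
  map_eq_zero_iff _ (algebraMap ℝ Rat2).injective

/-! ### Derivations of the function field in coordinates -/

theorem der_cst_mul (θ : DerF) (a : ℝ) (f : Rat2) : θ (cst a * f) = cst a * θ f := by
  simp [Derivation.leibniz]

theorem der_mul (θ : DerF) (f g : Rat2) : θ (f * g) = f * θ g + g * θ f := by
  simp [Derivation.leibniz]

theorem der_toF (θ : DerF) (p : Poly) :
    θ (toF p) = toF (pderiv 0 p) * θ (coord 0) + toF (pderiv 1 p) * θ (coord 1) := by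
  induction p using MvPolynomial.induction_on with
  | C a => rw [toF_C, Derivation.map_algebraMap]; simp
  | add p q hp hq => simp only [map_add, hp, hq]; ring
  | mul_X p i hp =>
    rw [map_mul, der_mul, hp]
    fin_cases i <;>
      simp [coord, pderiv_X, Derivation.leibniz] <;> ring

theorem der_div (θ : DerF) (f g : Rat2) (hg : g ≠ 0) :
    θ (f / g) = (θ f * g - f * θ g) / g ^ 2 := by
  rw [Derivation.leibniz_div]
  simp only [smul_eq_mul]
  field_simp

theorem derF_ext {θ η : DerF} (h0 : θ (coord 0) = η (coord 0)) (h1 : θ (coord 1) = η (coord 1)) :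
    θ = η := by
  ext f
  obtain ⟨p, q, hq, rfl⟩ := IsFractionRing.div_surjective (A := Poly) f
  have hq0 : toF q ≠ 0 := fun h => nonZeroDivisors.ne_zero hq (toF_eq_zero.1 h)
  rw [der_div _ _ _ hq0, der_div _ _ _ hq0]
  simp only [der_toF, h0, h1]

theorem der_expand (θ : DerF) (f : Rat2) :
    θ f = ofCoeff ![1, 0] f * θ (coord 0) + ofCoeff ![0, 1] f * θ (coord 1) := by
  have : θ = θ (coord 0) • ofCoeff ![1, 0] + θ (coord 1) • ofCoeff ![0, 1] := by
    apply derF_ext <;> simp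
  conv_lhs => rw [this]
  simp [mul_comm]

@[simp] theorem nabla_coord (θ η : DerF) (i : Fin 2) :
    nabla θ η (coord i) = θ (η (coord i)) := by
  simp [nabla]

@[simp] theorem euler_coord (i : Fin 2) : euler (coord i) = coord i := ofCoeff_coord _ _

/-- The linear form with coefficient vector `n`. -/
def lin (n : Fin 2 → ℝ) : Poly := C (n 0) * X 0 + C (n 1) * X 1

theorem toF_lin (n : Fin 2 → ℝ) : toF (lin n) = cst (n 0) * coord 0 + cst (n 1) * coord 1 := by
  simp [lin, coord, toF_C]

theorem der_lin (θ : DerF) (n : Fin 2 → ℝ) :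
    θ (toF (lin n)) = cst (n 0) * θ (coord 0) + cst (n 1) * θ (coord 1) := by
  rw [toF_lin, map_add, der_cst_mul, der_cst_mul]

/-- Linear forms have constant coefficients, so the connection may be computed in any linear
coordinates, in particular in those adapted to a mirror. -/
theorem nabla_lin (θ η : DerF) (n : Fin 2 → ℝ) :
    nabla θ η (toF (lin n)) = θ (η (toF (lin n))) := by
  simp only [der_lin, nabla_coord, map_add, der_cst_mul]

/-- The vector `n` rotated by a right angle. -/
def perp (n : Fin 2 → ℝ) : Fin 2 → ℝ := ![-n 1, n 0]

namespace LineArrangement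

variable {ι : Type*} (A : LineArrangement ι)

theorem form_eq_lin (H : ι) : A.form H = lin (A.normal H) := rfl

theorem perpForm_eq_lin (H : ι) : A.perpForm H = lin (perp (A.normal H)) := by
  simp [perpForm, lin, perp]

end LineArrangement

/-- The infinitesimal rotation `x₀ ∂/∂x₁ - x₁ ∂/∂x₀`. -/
def rot : DerF := ofCoeff ![-coord 1, coord 0]

@[simp] theorem rot_coord_zero : rot (coord 0) = -coord 1 := by simp [rot]

@[simp] theorem rot_coord_one : rot (coord 1) = coord 0 := by simp [rot]

theorem rot_lin (n : Fin 2 → ℝ) : rot (toF (lin n)) = -toF (lin (perp n)) := by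
  rw [der_lin, toF_lin]; simp [perp]

theorem rot_lin_perp (n : Fin 2 → ℝ) : rot (toF (lin (perp n))) = toF (lin n) := by
  rw [der_lin, toF_lin]; simp [perp]; ring

/-- The infinitesimal rotation on polynomials. -/
def rotPoly (p : Poly) : Poly := X 0 * pderiv 1 p - X 1 * pderiv 0 p

theorem rot_toF (p : Poly) : rot (toF p) = toF (rotPoly p) := by
  rw [der_toF, rot_coord_zero, rot_coord_one]; simp only [rotPoly, coord, map_sub, map_mul]; ring

/-- The squared length of a vector. -/
def sqLen (n : Fin 2 → ℝ) : ℝ := n 0 ^ 2 + n 1 ^ 2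

theorem sqLen_ne_zero {n : Fin 2 → ℝ} (hn : n ≠ 0) : sqLen n ≠ 0 := by
  intro h
  apply hn
  have h0 : n 0 = 0 := by unfold sqLen at h; nlinarith [sq_nonneg (n 0), sq_nonneg (n 1)]
  have h1 : n 1 = 0 := by unfold sqLen at h; nlinarith [sq_nonneg (n 0), sq_nonneg (n 1)]
  funext i; fin_cases i <;> simp [h0, h1]

/-- A derivation is determined in the orthogonal coordinates given by `n`. -/
theorem sqLen_mul_coord_zero (θ : DerF) (n : Fin 2 → ℝ) :
    cst (sqLen n) * θ (coord 0)
      = cst (n 0) * θ (toF (lin n)) - cst (n 1) * θ (toF (lin (perp n))) := by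
  simp only [der_lin, perp, sqLen]; simp; ring

theorem sqLen_mul_coord_one (θ : DerF) (n : Fin 2 → ℝ) :
    cst (sqLen n) * θ (coord 1)
      = cst (n 1) * θ (toF (lin n)) + cst (n 0) * θ (toF (lin (perp n))) := by
  simp only [der_lin, perp, sqLen]; simp; ring

/-- The determinant of the coefficients of two derivations. -/
def wedge (θ φ : DerF) : Rat2 := θ (coord 0) * φ (coord 1) - θ (coord 1) * φ (coord 0)

theorem sqLen_mul_wedge (θ φ : DerF) (n : Fin 2 → ℝ) :
    cst (sqLen n) * wedge θ φ
      = θ (toF (lin n)) * φ (toF (lin (perp n))) - θ (toF (lin (perp n))) * φ (toF (lin n)) := by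
  simp only [der_lin, perp, sqLen, wedge]; simp; ring

/-! ### Linear forms are prime -/

theorem lin_ne_zero {n : Fin 2 → ℝ} (hn : n ≠ 0) : lin n ≠ 0 := by
  intro h
  have h1 : ∀ v : Fin 2 → ℝ, n 0 * v 0 + n 1 * v 1 = 0 := fun v => by
    have := congrArg (MvPolynomial.eval v) h
    simpa [lin] using this
  have := h1 n
  exact sqLen_ne_zero hn (by unfold sqLen; linarith)

theorem lin_isHomogeneous (n : Fin 2 → ℝ) : (lin n).IsHomogeneous 1 := by
  unfold lin
  apply IsHomogeneous.add
  · simpa using (isHomogeneous_C _ (n 0)).mul (isHomogeneous_X _ 0)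
  · simpa using (isHomogeneous_C _ (n 1)).mul (isHomogeneous_X _ 1)

theorem lin_prime {n : Fin 2 → ℝ} (hn : n ≠ 0) : Prime (lin n) := by
  rw [← UniqueFactorizationMonoid.irreducible_iff_prime]
  apply irreducible_of_totalDegree_eq_one ((lin_isHomogeneous n).totalDegree (lin_ne_zero hn))
  intro x hx
  rw [isUnit_iff_ne_zero]
  rintro rfl
  apply lin_ne_zero hn
  ext m
  simpa using hx m

theorem sqLen_perp (n : Fin 2 → ℝ) : sqLen (perp n) = sqLen n := by
  simp [sqLen, perp]; ring

/-- A linear form divides another one only if they are proportional. -/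
theorem det_eq_zero_of_lin_dvd {n k : Fin 2 → ℝ} (h : lin n ∣ lin k) :
    n 0 * k 1 - n 1 * k 0 = 0 := by
  obtain ⟨p, hp⟩ := h
  -- The point is a zero of `lin n`, hence also of `lin k`.
  have := congrArg (MvPolynomial.eval ![-n 1, n 0]) hp
  simp [lin] at this
  linear_combination this

theorem lin_not_dvd_perp {n : Fin 2 → ℝ} (hn : n ≠ 0) : ¬ lin n ∣ lin (perp n) := by
  intro h
  apply sqLen_ne_zero hn
  have := det_eq_zero_of_lin_dvd h
  simp [perp] at this
  unfold sqLen
  linear_combination this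

/-! ### Orders of rational functions along a prime -/

/-- The rational function `f` has order at least `j` along `a`. -/
def OrdGe (a : Poly) (j : ℤ) (f : Rat2) : Prop :=
  ∃ p q : Poly, ¬ a ∣ q ∧ toF q * f = toF a ^ j * toF p

section Ord

variable {a : Poly} (ha : Prime a) {i j : ℤ} {f g : Rat2}

include ha

theorem toF_prime_ne_zero : toF a ≠ 0 := fun h => ha.ne_zero (toF_eq_zero.1 h)

theorem ordGe_toF (p : Poly) : OrdGe a 0 (toF p) :=
  ⟨p, 1, fun h => ha.not_isUnit (isUnit_of_dvd_one h), by simp⟩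

theorem ordGe_zero (j : ℤ) : OrdGe a j 0 :=
  ⟨0, 1, fun h => ha.not_isUnit (isUnit_of_dvd_one h), by simp⟩

theorem OrdGe.add (hf : OrdGe a j f) (hg : OrdGe a j g) : OrdGe a j (f + g) := by
  obtain ⟨p, q, hq, h⟩ := hf
  obtain ⟨p', q', hq', h'⟩ := hg
  refine ⟨p * q' + p' * q, q * q', fun hd => (ha.dvd_or_dvd hd).elim hq hq', ?_⟩
  simp only [map_mul, map_add]
  linear_combination toF q' * h + toF q * h'

theorem OrdGe.mul (hf : OrdGe a i f) (hg : OrdGe a j g) : OrdGe a (i + j) (f * g) := by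
  obtain ⟨p, q, hq, h⟩ := hf
  obtain ⟨p', q', hq', h'⟩ := hg
  refine ⟨p * p', q * q', fun hd => (ha.dvd_or_dvd hd).elim hq hq', ?_⟩
  rw [zpow_add₀ (toF_prime_ne_zero ha)]
  simp only [map_mul]
  linear_combination toF q' * g * h + toF a ^ i * toF p * h'

theorem OrdGe.mul_eq {k : ℤ} (hf : OrdGe a i f) (hg : OrdGe a j g) (hk : i + j = k) :
    OrdGe a k (f * g) := hk ▸ hf.mul ha hg

theorem ordGe_cst (c : ℝ) : OrdGe a 0 (cst c) := by
  rw [← toF_C]; exact ordGe_toF ha _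

omit ha in
theorem OrdGe.neg (hf : OrdGe a j f) : OrdGe a j (-f) := by
  obtain ⟨p, q, hq, h⟩ := hf
  exact ⟨-p, q, hq, by rw [map_neg]; linear_combination -h⟩

theorem OrdGe.sub (hf : OrdGe a j f) (hg : OrdGe a j g) : OrdGe a j (f - g) := by
  rw [sub_eq_add_neg]; exact hf.add ha hg.neg

theorem OrdGe.cst_mul (c : ℝ) (hf : OrdGe a j f) : OrdGe a j (cst c * f) :=
  (ordGe_cst ha c).mul_eq ha hf (zero_add _)

theorem OrdGe.toF_mul (p : Poly) (hf : OrdGe a j f) : OrdGe a j (toF p * f) :=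
  (ordGe_toF ha p).mul_eq ha hf (zero_add _)

theorem ordGe_zpow (j : ℤ) : OrdGe a j (toF a ^ j) :=
  ⟨1, 1, fun h => ha.not_isUnit (isUnit_of_dvd_one h), by simp⟩

theorem ordGe_self : OrdGe a 1 (toF a) := by
  simpa using ordGe_zpow ha 1

theorem OrdGe.mono (hf : OrdGe a j f) (hij : i ≤ j) : OrdGe a i f := by
  obtain ⟨p, q, hq, h⟩ := hf
  obtain ⟨n, rfl⟩ := Int.le.dest hij
  refine ⟨a ^ n * p, q, hq, ?_⟩
  rw [h, zpow_add₀ (toF_prime_ne_zero ha), zpow_natCast, map_mul, map_pow, mul_assoc]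

omit ha in
theorem ordGe_inv {q : Poly} (hq : ¬ a ∣ q) : OrdGe a 0 (toF q)⁻¹ := by
  have : toF q ≠ 0 := fun h => hq (by rw [toF_eq_zero.1 h]; exact dvd_zero _)
  exact ⟨1, q, hq, by simp [this]⟩

theorem ordGe_zpow_of_not_dvd {q : Poly} (hq : ¬ a ∣ q) (n : ℤ) : OrdGe a 0 (toF q ^ n) := by
  obtain ⟨n, rfl | rfl⟩ := n.eq_nat_or_neg
  · rw [zpow_natCast, ← map_pow]; exact ordGe_toF ha _
  · rw [zpow_neg, zpow_natCast, ← map_pow]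
    exact ordGe_inv fun h => hq (ha.dvd_of_dvd_pow h)

theorem OrdGe.of_mul_unit {q : Poly} (hq : ¬ a ∣ q) (h : OrdGe a j (toF q * f)) :
    OrdGe a j f := by
  have h0 : toF q ≠ 0 := fun h => hq (by rw [toF_eq_zero.1 h]; exact dvd_zero _)
  have := (ordGe_inv hq).mul_eq ha h (zero_add j)
  rwa [inv_mul_cancel_left₀ h0] at this

theorem OrdGe.of_cst_mul {c : ℝ} (hc : c ≠ 0) (h : OrdGe a j (cst c * f)) : OrdGe a j f := by
  have := h.cst_mul ha c⁻¹
  rwa [← mul_assoc, ← map_mul, inv_mul_cancel₀ hc, map_one, one_mul] at this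

theorem OrdGe.dvd_of_pos {p : Poly} {n : ℕ} (h : OrdGe a n (toF p)) : a ^ n ∣ p := by
  obtain ⟨r, q, hq, h⟩ := h
  rw [zpow_natCast, ← map_pow, ← map_mul, ← map_mul] at h
  exact ha.pow_dvd_of_dvd_mul_left n hq ⟨r, toF_injective h⟩

theorem eq_zero_of_forall_ordGe (h : ∀ n : ℕ, OrdGe a n f) : f = 0 := by
  obtain ⟨p, q, hq, rfl⟩ := IsFractionRing.div_surjective (A := Poly) f
  have hq0 : toF q ≠ 0 := fun h => nonZeroDivisors.ne_zero hq (toF_eq_zero.1 h)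
  have hp : ∀ n : ℕ, a ^ n ∣ p := fun n => by
    apply OrdGe.dvd_of_pos ha
    have := (h n).toF_mul ha q
    rwa [mul_div_cancel₀ _ hq0] at this
  have : p = 0 := by
    by_contra hp0
    exact (FiniteMultiplicity.of_not_isUnit ha.not_isUnit hp0).elim fun n hn => hn (hp _)
  simp [this]

/-- The order along `a` in explicit form. -/
theorem OrdGe.exists_eq (h : OrdGe a j f) : ∃ u, OrdGe a 0 u ∧ f = toF a ^ j * u := by
  obtain ⟨p, q, hq, h⟩ := h
  have hq0 : toF q ≠ 0 := fun h => hq (by rw [toF_eq_zero.1 h]; exact dvd_zero _)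
  refine ⟨toF p * (toF q)⁻¹, (ordGe_toF ha p).mul_eq ha (ordGe_inv hq) (by simp), ?_⟩
  rw [← mul_assoc, ← h]; field_simp

variable {θ : DerF} (hθ : ∀ l, OrdGe a 0 (θ (coord l)))

include hθ

theorem ordGe_der_toF (p : Poly) : OrdGe a 0 (θ (toF p)) := by
  rw [der_toF]
  exact ((hθ 0).toF_mul ha _).add ha ((hθ 1).toF_mul ha _)

theorem OrdGe.der_zero (hf : OrdGe a 0 f) : OrdGe a 0 (θ f) := by
  obtain ⟨p, q, hq, h⟩ := hf
  rw [zpow_zero, one_mul] at h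
  have h2 := congrArg θ h
  rw [der_mul] at h2
  apply OrdGe.of_mul_unit ha hq
  have : toF q * θ f = θ (toF p) - f * θ (toF q) := by linear_combination h2
  rw [this]
  exact (ordGe_der_toF ha hθ p).sub ha
    (OrdGe.mul_eq ha ⟨p, q, hq, by simpa using h⟩ (ordGe_der_toF ha hθ q) (zero_add _))

omit ha hθ in
theorem der_zpow_mul (θ : DerF) (b : Rat2) (j : ℤ) (u : Rat2) :
    θ (b ^ j * u) = b ^ (j - 1) * (j * θ b * u) + b ^ j * θ u := by
  rw [der_mul, Derivation.leibniz_zpow]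
  simp only [zsmul_eq_mul, smul_eq_mul]
  ring

/-- With `f = a^j u`, the derivative is `j a^(j-1) θ(a) u + a^j θ(u)`. The first term has order at
least `j - 1 + m`; `m ≤ 1` ensures that the second does too. The case `m = 1` is a derivation
tangent to `a = 0`, which loses no order. -/
theorem OrdGe.der {m : ℤ} (hm : m ≤ 1) (hθa : OrdGe a m (θ (toF a))) (hf : OrdGe a j f) :
    OrdGe a (j - 1 + m) (θ f) := by
  obtain ⟨u, hu, rfl⟩ := hf.exists_eq ha
  rw [der_zpow_mul]
  refine ((ordGe_zpow ha (j - 1)).mul ha ?_).add ha ?_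
  · refine OrdGe.mul_eq ha (OrdGe.mul_eq ha (i := 0) ?_ hθa (zero_add m)) hu (add_zero _)
    have : ((j : ℤ) : Rat2) = cst (j : ℝ) := by simp
    rw [this]; exact ordGe_cst ha _
  · exact ((ordGe_zpow ha j).mul_eq ha (hu.der_zero ha hθ) (add_zero j)).mono ha (by lia)

/-- A derivation transversal to `a` lowers nonzero orders by exactly one. -/
theorem OrdGe.succ_of_der (hj : j ≠ 0) (hθa : OrdGe a 0 (θ (toF a))⁻¹) (hθ0 : θ (toF a) ≠ 0)
    (hf : OrdGe a j f) (hd : OrdGe a j (θ f)) : OrdGe a (j + 1) f := by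
  obtain ⟨u, hu, rfl⟩ := hf.exists_eq ha
  have h0 := toF_prime_ne_zero ha
  rw [der_zpow_mul] at hd
  have hd2 : OrdGe a j (toF a ^ (j - 1) * (j * θ (toF a) * u)) := by
    have := hd.sub ha ((ordGe_zpow ha j).mul_eq ha (hu.der_zero ha hθ) (add_zero j))
    rwa [add_sub_cancel_right] at this
  -- Dividing the leading term by `j θ(a)`, whose inverse has no pole along `a`, and multiplying by
  -- `a = a⁻¹ a²` recovers `f` with one more order.
  have hd3 := ((ordGe_zpow ha (2 : ℤ)).mul ha
    ((hθa.cst_mul ha ((j : ℝ)⁻¹)).mul_eq ha hd2 (zero_add j)))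
  rw [add_comm j 1]
  have hj' : (j : Rat2) ≠ 0 := by exact_mod_cast hj
  have e : toF a ^ j * u = toF a ^ (-1 : ℤ) * (toF a ^ (2 : ℤ) * (cst (j : ℝ)⁻¹ *
      (θ (toF a))⁻¹ * (toF a ^ (j - 1) * (j * θ (toF a) * u)))) := by
    have : toF a ^ j = toF a ^ (-1 : ℤ) * toF a ^ (2 : ℤ) * toF a ^ (j - 1) := by
      rw [← zpow_add₀ h0, ← zpow_add₀ h0]; congr 1; ring
    rw [this, map_inv₀]
    simp only [map_intCast]
    field_simp
  rw [e]
  exact (ordGe_zpow ha (-1)).mul_eq ha hd3 (by ring)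

end Ord

theorem OrdGe.of_associated {a b : Poly} (hab : Associated a b) {f : Rat2} (h : OrdGe a 0 f) :
    OrdGe b 0 f := by
  obtain ⟨p, q, hq, h⟩ := h
  exact ⟨p, q, fun hd => hq (hab.dvd.trans hd), by simpa using h⟩

/-- A rational function without poles is a polynomial. -/
theorem exists_eq_toF {f : Rat2} (h : ∀ a, Prime a → OrdGe a 0 f) : ∃ p, f = toF p := by
  have hc := IsFractionRing.num_den_reduced Poly f
  -- A prime factor of the reduced denominator would be a pole of `f`.
  have hu : IsUnit ((IsFractionRing.den Poly f : Poly)) := by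
    by_contra hu
    obtain ⟨a, ha, had⟩ := WfDvdMonoid.exists_irreducible_factor hu
      (nonZeroDivisors.ne_zero (IsFractionRing.den Poly f).2)
    rw [UniqueFactorizationMonoid.irreducible_iff_prime] at ha
    obtain ⟨p, q, hq, hf⟩ := h a ha
    have hden : toF (IsFractionRing.den Poly f) ≠ 0 := fun h0 =>
      nonZeroDivisors.ne_zero (IsFractionRing.den Poly f).2 (toF_eq_zero.1 h0)
    have e : toF (q * IsFractionRing.num Poly f) = toF (p * IsFractionRing.den Poly f) := by
      have h1 : f * toF (IsFractionRing.den Poly f) = toF (IsFractionRing.num Poly f) := by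
        exact IsFractionRing.num_mul_den_eq_num_iff_eq.2 rfl
      rw [zpow_zero] at hf
      rw [map_mul, map_mul, ← h1]
      linear_combination toF (IsFractionRing.den Poly f) * hf
    have hd : a ∣ q * IsFractionRing.num Poly f := by
      rw [toF_injective e]; exact had.mul_left _
    exact ha.not_isUnit (hc ((ha.dvd_or_dvd hd).resolve_left hq) had)
  obtain ⟨u, hu⟩ := hu
  refine ⟨IsFractionRing.num Poly f * (u⁻¹ : Polyˣ), ?_⟩
  have h1 : f * toF (IsFractionRing.den Poly f) = toF (IsFractionRing.num Poly f) :=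
    IsFractionRing.num_mul_den_eq_num_iff_eq.2 rfl
  rw [map_mul, ← h1, ← hu, mul_assoc, ← map_mul, Units.mul_inv, map_one, mul_one]

theorem ordGe_der_lin {a : Poly} (ha : Prime a) {j : ℤ} {θ : DerF}
    (hθ : ∀ i, OrdGe a j (θ (coord i))) (n : Fin 2 → ℝ) : OrdGe a j (θ (toF (lin n))) := by
  rw [der_lin]
  exact ((hθ 0).cst_mul ha _).add ha ((hθ 1).cst_mul ha _)

theorem ordGe_der_coord {a : Poly} (ha : Prime a) {j : ℤ} {θ : DerF} {n : Fin 2 → ℝ} (hn : n ≠ 0)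
    (h : OrdGe a j (θ (toF (lin n)))) (h' : OrdGe a j (θ (toF (lin (perp n))))) (i : Fin 2) :
    OrdGe a j (θ (coord i)) := by
  apply OrdGe.of_cst_mul ha (sqLen_ne_zero hn)
  fin_cases i
  · simp only [Fin.zero_eta, sqLen_mul_coord_zero]
    exact (h.cst_mul ha _).sub ha (h'.cst_mul ha _)
  · simp only [Fin.mk_one, sqLen_mul_coord_one]
    exact (h.cst_mul ha _).add ha (h'.cst_mul ha _)

/-! ### Logarithmic modules through orders along the lines, and Saito's criterion -/

namespace LineArrangement

variable {ι : Type*} (A : LineArrangement ι)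

theorem form_prime (H : ι) : Prime (A.form H) := lin_prime (A.normal_ne_zero H)

theorem form_not_dvd_perpForm (H : ι) : ¬ A.form H ∣ A.perpForm H := by
  rw [perpForm_eq_lin]; exact lin_not_dvd_perp (A.normal_ne_zero H)

theorem form_not_dvd_form {H K : ι} (h : H ≠ K) : ¬ A.form H ∣ A.form K := fun hd =>
  A.distinct H K h (det_eq_zero_of_lin_dvd hd)

variable [Fintype ι]

/-- The product `∏_H α_H`. -/
def defPoly : Poly := ∏ H, A.form H

theorem defPoly_isHomogeneous : A.defPoly.IsHomogeneous (Fintype.card ι) := by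
  have := IsHomogeneous.prod Finset.univ A.form (fun _ => 1) fun H _ => lin_isHomogeneous _
  simpa [defPoly] using this

theorem defPoly_ne_zero : A.defPoly ≠ 0 :=
  Finset.prod_ne_zero_iff.2 fun H _ => (A.form_prime H).ne_zero

theorem not_dvd_defPoly {a : Poly} (ha : Prime a) (h : ∀ H, ¬ a ∣ A.form H) :
    ¬ a ∣ A.defPoly := fun hd => by
  obtain ⟨H, -, hH⟩ := (ha.dvd_finsetProd_iff _).1 hd
  exact h H hH

theorem exists_defPoly_eq (H : ι) : ∃ r, A.defPoly = A.form H * r ∧ ¬ A.form H ∣ r := by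
  classical
  refine ⟨∏ K ∈ Finset.univ.erase H, A.form K,
    (Finset.mul_prod_erase _ _ (Finset.mem_univ H)).symm, fun hd => ?_⟩
  obtain ⟨K, hK, hd⟩ := ((A.form_prime H).dvd_finsetProd_iff _).1 hd
  exact A.form_not_dvd_form (Finset.ne_of_mem_erase hK).symm hd

theorem not_dvd_poleDenom (m : ι → ℤ) {a : Poly} (ha : Prime a) (h : ∀ H, ¬ a ∣ A.form H) :
    ¬ a ∣ A.poleDenom m := fun hd => by
  obtain ⟨H, -, hH⟩ := (ha.dvd_finsetProd_iff _).1 hd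
  exact h H (ha.dvd_of_dvd_pow hH)

theorem exists_poleDenom_eq (m : ι → ℤ) (H : ι) :
    ∃ r, A.poleDenom m = A.form H ^ (-m H).toNat * r ∧ ¬ A.form H ∣ r := by
  classical
  refine ⟨∏ K ∈ Finset.univ.erase H, A.form K ^ (-m K).toNat,
    (Finset.mul_prod_erase _ (fun K => A.form K ^ (-m K).toNat) (Finset.mem_univ H)).symm,
    fun hd => ?_⟩
  obtain ⟨K, hK, hd⟩ := ((A.form_prime H).dvd_finsetProd_iff _).1 hd
  exact A.form_not_dvd_form (Finset.ne_of_mem_erase hK).symm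
    ((A.form_prime H).dvd_of_dvd_pow hd)

/-- A local description of `D(A, m)` that does not depend on the sign of `m`. -/
theorem mem_logDer_iff (m : ι → ℤ) (θ : DerF) :
    θ ∈ A.logDer m ↔
      (∀ a, Prime a → (∀ H, ¬ a ∣ A.form H) → ∀ i, OrdGe a 0 (θ (coord i))) ∧
      (∀ H, OrdGe (A.form H) 0 (θ (toF (A.perpForm H)))) ∧
      ∀ H, OrdGe (A.form H) (m H) (θ (toF (A.form H))) := by
  constructor
  · rintro ⟨h1, h2, h3⟩
    refine ⟨fun a ha hA i => ?_, fun H => ?_, fun H => ?_⟩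
    · obtain ⟨p, hp⟩ := h1 i
      exact ⟨p, _, A.not_dvd_poleDenom m ha hA, by simpa using hp⟩
    all_goals
      have hα := A.form_prime H
      obtain ⟨r, hr, hHr⟩ := A.exists_poleDenom_eq m H
      have h0 := toF_prime_ne_zero hα
    -- For `m H < 0` the power of the form in `poleDenom` cancels the one required by the
    -- definition; for `m H ≥ 0` the form does not occur in `poleDenom`, which is then a local unit.
    · rcases lt_or_ge (m H) 0 with hm | hm
      · obtain ⟨p, hp⟩ := h3 H hm
        rw [hr, map_mul, map_mul, mul_assoc] at hp
        refine ⟨p, r, hHr, ?_⟩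
        rw [zpow_zero, one_mul]
        exact mul_left_cancel₀ (by rw [map_pow]; exact pow_ne_zero _ h0) hp
      · have : (-m H).toNat = 0 := by lia
        rw [this, pow_zero, one_mul] at hr
        rw [perpForm_eq_lin]
        refine ordGe_der_lin hα (fun i => ?_) _
        obtain ⟨p, hp⟩ := h1 i
        exact ⟨p, r, hHr, by rw [← hr]; simpa using hp⟩
    · rcases lt_or_ge (m H) 0 with hm | hm
      · refine ordGe_der_lin hα (fun i => ?_) _
        obtain ⟨p, hp⟩ := h1 i
        refine ⟨p, r, hHr, ?_⟩
        have e : m H = -((-m H).toNat : ℤ) := by lia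
        rw [hr, map_mul, map_pow] at hp
        rw [e, zpow_neg, zpow_natCast, ← hp]
        field_simp
      · have : (-m H).toNat = 0 := by lia
        rw [this, pow_zero, one_mul] at hr
        obtain ⟨p, hp⟩ := h2 H hm
        refine ⟨p, r, hHr, ?_⟩
        have e : m H = ((m H).toNat : ℤ) := by lia
        rw [e, zpow_natCast, ← hr, hp, map_mul, map_pow]
  · rintro ⟨h1, h2, h3⟩
    -- Regularity is checked prime by prime: only the forms can be poles, of order at most the
    -- exponent in `poleDenom`.
    have reg : ∀ (f : Rat2) (p : Poly), p = A.poleDenom m →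
        (∀ a, Prime a → (∀ H, ¬ a ∣ A.form H) → OrdGe a 0 f) →
        (∀ H, OrdGe (A.form H) (-((-m H).toNat : ℤ)) f) → ∃ q, toF p * f = toF q := by
      rintro f _ rfl hf1 hf2
      apply exists_eq_toF
      intro a ha
      by_cases hA : ∀ H, ¬ a ∣ A.form H
      · exact (hf1 a ha hA).toF_mul ha _
      · push Not at hA
        obtain ⟨H, hH⟩ := hA
        have hα := A.form_prime H
        refine OrdGe.of_associated (ha.associated_of_dvd hα hH).symm ?_
        obtain ⟨r, hr, hHr⟩ := A.exists_poleDenom_eq m H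
        rw [hr, map_mul, map_pow, ← zpow_natCast]
        exact OrdGe.mul_eq hα (OrdGe.mul_eq hα (ordGe_zpow hα _) (ordGe_toF hα r) (add_zero _))
          (hf2 H) (by simp)
    have hco : ∀ H i, OrdGe (A.form H) (-((-m H).toNat : ℤ)) (θ (coord i)) := fun H i => by
      have hα := A.form_prime H
      refine ordGe_der_coord hα (A.normal_ne_zero H) ((h3 H).mono hα (by lia)) ?_ i
      rw [← perpForm_eq_lin]
      exact (h2 H).mono hα (by lia)
    have hreg : ∀ n : Fin 2 → ℝ, ∃ q, toF (A.poleDenom m) * θ (toF (lin n)) = toF q := fun n =>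
      reg _ _ rfl (fun a ha hA => ordGe_der_lin ha (h1 a ha hA) n)
        fun H => ordGe_der_lin (A.form_prime H) (hco H) n
    refine ⟨fun i => reg _ _ rfl (fun a ha hA => h1 a ha hA i) fun H => hco H i,
      fun H hm => ?_, fun H hm => ?_⟩
    all_goals
      have hα := A.form_prime H
    · obtain ⟨q, hq⟩ := hreg (A.normal H)
      have := (h3 H).toF_mul hα (A.poleDenom m)
      rw [form_eq_lin, hq, ← form_eq_lin, show m H = ((m H).toNat : ℤ) by lia] at this
      obtain ⟨p, rfl⟩ := this.dvd_of_pos hα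
      exact ⟨p, by rw [form_eq_lin, hq, form_eq_lin]⟩
    · obtain ⟨q, hq⟩ := hreg (perp (A.normal H))
      obtain ⟨r, hr, hHr⟩ := A.exists_poleDenom_eq m H
      have : OrdGe (A.form H) ((-m H).toNat : ℤ)
          (toF (A.poleDenom m) * θ (toF (A.perpForm H))) := by
        rw [hr, map_mul, map_pow, ← zpow_natCast]
        exact OrdGe.mul_eq hα (OrdGe.mul_eq hα (ordGe_zpow hα _) (ordGe_toF hα r) (add_zero _))
          (h2 H) (by simp)
      rw [perpForm_eq_lin, hq] at this
      obtain ⟨p, rfl⟩ := this.dvd_of_pos hα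
      exact ⟨p, by rw [perpForm_eq_lin, hq]⟩

theorem logDer_mono {m m' : ι → ℤ} (h : ∀ H, m H ≤ m' H) : A.logDer m' ≤ A.logDer m := by
  intro θ hθ
  rw [mem_logDer_iff] at hθ ⊢
  exact ⟨hθ.1, hθ.2.1, fun H => (hθ.2.2 H).mono (A.form_prime H) (h H)⟩

/-- The power `Q ^ n` has order exactly `n` along each line, and `0` elsewhere. -/
theorem ordGe_defPoly_zpow (H : ι) (n : ℤ) : OrdGe (A.form H) n (toF A.defPoly ^ n) := by
  obtain ⟨r, hr, hHr⟩ := A.exists_defPoly_eq H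
  have hα := A.form_prime H
  rw [hr, map_mul, mul_zpow]
  exact OrdGe.mul_eq hα (ordGe_zpow hα n) (ordGe_zpow_of_not_dvd hα hHr n) (add_zero n)

theorem toF_defPoly_ne_zero : toF A.defPoly ≠ 0 := fun h => A.defPoly_ne_zero (toF_eq_zero.1 h)

theorem exists_eq_toF_of_form {f : Rat2}
    (h1 : ∀ a, Prime a → (∀ H, ¬ a ∣ A.form H) → OrdGe a 0 f)
    (h2 : ∀ H, OrdGe (A.form H) 0 f) : ∃ p, f = toF p := by
  apply exists_eq_toF
  intro a ha
  by_cases hA : ∀ H, ¬ a ∣ A.form H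
  · exact h1 a ha hA
  · push Not at hA
    obtain ⟨H, hH⟩ := hA
    exact (h2 H).of_associated (ha.associated_of_dvd (A.form_prime H) hH).symm

/-- The determinant of two elements of `D(A, n)`, `n` constant, is a multiple of `Q ^ n`. -/
theorem exists_wedge_eq {n : ℤ} {θ φ : DerF} (hθ : θ ∈ A.logDer fun _ => n)
    (hφ : φ ∈ A.logDer fun _ => n) : ∃ p, wedge θ φ = toF p * toF A.defPoly ^ n := by
  rw [mem_logDer_iff] at hθ hφ
  have h0 := A.toF_defPoly_ne_zero
  have : ∃ p, toF A.defPoly ^ (-n) * wedge θ φ = toF p := by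
    apply A.exists_eq_toF_of_form
    · intro a ha hA
      refine OrdGe.mul_eq ha (ordGe_zpow_of_not_dvd ha (A.not_dvd_defPoly ha hA) _) ?_ (zero_add 0)
      exact (((hθ.1 a ha hA 0).mul_eq ha (hφ.1 a ha hA 1)) (zero_add 0)).sub ha
        (((hθ.1 a ha hA 1).mul_eq ha (hφ.1 a ha hA 0)) (zero_add 0))
    · intro H
      have hα := A.form_prime H
      refine OrdGe.mul_eq hα (A.ordGe_defPoly_zpow H (-n)) ?_ (neg_add_cancel n)
      apply OrdGe.of_cst_mul hα (sqLen_ne_zero (A.normal_ne_zero H))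
      -- In the coordinates `α_H`, `β_H` each product pairs one `α`-component, of order at least
      -- `n`, with one `β`-component without pole.
      rw [sqLen_mul_wedge, ← perpForm_eq_lin, ← form_eq_lin]
      exact ((hθ.2.2 H).mul_eq hα (hφ.2.1 H) (add_zero n)).sub hα
        ((hθ.2.1 H).mul_eq hα (hφ.2.2 H) (zero_add n))
  obtain ⟨p, hp⟩ := this
  refine ⟨p, ?_⟩
  rw [← hp, zpow_neg]
  field_simp

/-- Saito's criterion: spanning. -/
theorem exists_eq_add_of_wedge {n : ℤ} {θ φ : DerF} (hθ : θ ∈ A.logDer fun _ => n)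
    (hφ : φ ∈ A.logDer fun _ => n) {c : ℝ} (hc : c ≠ 0)
    (hw : wedge θ φ = cst c * toF A.defPoly ^ n) {ψ : DerF} (hψ : ψ ∈ A.logDer fun _ => n) :
    ∃ p q : Poly, ψ = p • θ + q • φ := by
  obtain ⟨p, hp⟩ := A.exists_wedge_eq hψ hφ
  obtain ⟨q, hq⟩ := A.exists_wedge_eq hθ hψ
  have h0 : toF A.defPoly ^ n ≠ 0 := zpow_ne_zero _ A.toF_defPoly_ne_zero
  have hc' : cst c ≠ 0 := fun h => hc (cst_eq_zero.1 h)
  have hcc : cst c * cst c⁻¹ = 1 := by rw [← map_mul, mul_inv_cancel₀ hc, map_one]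
  -- Cramer's rule.
  have key : ∀ i, ψ (coord i) * wedge θ φ
      = θ (coord i) * wedge ψ φ + φ (coord i) * wedge θ ψ := by
    intro i; fin_cases i <;> simp [wedge] <;> ring
  have fin : ∀ i, ψ (coord i)
      = toF (C c⁻¹ * p) * θ (coord i) + toF (C c⁻¹ * q) * φ (coord i) := by
    intro i
    have := key i
    rw [hw, hp, hq] at this
    apply mul_left_cancel₀ (mul_ne_zero hc' h0)
    rw [map_mul, map_mul, toF_C]
    linear_combination this - toF A.defPoly ^ n *
      (toF p * θ (coord i) + toF q * φ (coord i)) * hcc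
  refine ⟨C c⁻¹ * p, C c⁻¹ * q, derF_ext ?_ ?_⟩
  all_goals
    simp only [Derivation.add_apply, Derivation.smul_apply, Algebra.smul_def]
    exact fin _

/-- Saito's criterion. -/
theorem exists_basis_of_wedge {n : ℤ} {θ φ : DerF} (hθ : θ ∈ A.logDer fun _ => n)
    (hφ : φ ∈ A.logDer fun _ => n) {c : ℝ} (hc : c ≠ 0)
    (hw : wedge θ φ = cst c * toF A.defPoly ^ n) :
    ∃ b : Module.Basis (Fin 2) Poly (A.logDer fun _ => n),
      (b 0 : DerF) = θ ∧ (b 1 : DerF) = φ := by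
  have hw0 : wedge θ φ ≠ 0 := by
    rw [hw]
    exact mul_ne_zero (fun h => hc (cst_eq_zero.1 h)) (zpow_ne_zero _ A.toF_defPoly_ne_zero)
  let v : Fin 2 → A.logDer fun _ => n := ![⟨θ, hθ⟩, ⟨φ, hφ⟩]
  have hli : LinearIndependent Poly v := by
    refine LinearIndependent.pair_iffₛ.2 fun s t s' t' hst => ?_
    have hst' : s • θ + t • φ = s' • θ + t' • φ := congrArg Subtype.val hst
    have e : ∀ i, toF s * θ (coord i) + toF t * φ (coord i)
        = toF s' * θ (coord i) + toF t' * φ (coord i) := fun i => by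
      have := congrArg (fun D : DerF => D (coord i)) hst'
      simpa [Algebra.smul_def] using this
    constructor
    · apply toF_injective
      apply mul_right_cancel₀ hw0
      unfold wedge
      linear_combination φ (coord 1) * e 0 - φ (coord 0) * e 1
    · apply toF_injective
      apply mul_right_cancel₀ hw0
      unfold wedge
      linear_combination θ (coord 0) * e 1 - θ (coord 1) * e 0
  have hsp : ⊤ ≤ Submodule.span Poly (Set.range v) := by
    rintro ⟨ψ, hψ⟩ -
    obtain ⟨p, q, e⟩ := A.exists_eq_add_of_wedge hθ hφ hc hw hψ
    have : (⟨ψ, hψ⟩ : A.logDer fun _ => n) = p • v 0 + q • v 1 := Subtype.ext e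
    rw [this]
    exact add_mem (Submodule.smul_mem _ _ (Submodule.subset_span ⟨0, rfl⟩))
      (Submodule.smul_mem _ _ (Submodule.subset_span ⟨1, rfl⟩))
  exact ⟨Module.Basis.mk hli hsp, by simp [v], by simp [v]⟩

end LineArrangement

/-! ### Orthogonal maps and reflections acting on polynomials and rational functions -/

theorem mem_fixedSpace {g : O2} {v : Fin 2 → ℝ} : v ∈ fixedSpace g ↔ g.1.mulVec v = v := by
  rw [fixedSpace, LinearMap.mem_ker, LinearMap.sub_apply, sub_eq_zero, Matrix.toLin'_apply,
    LinearMap.id_apply]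

theorem dotProduct_mulVec_mulVec (g : O2) (v w : Fin 2 → ℝ) :
    g.1.mulVec v ⬝ᵥ g.1.mulVec w = v ⬝ᵥ w := by
  have h : g.1.transpose * g.1 = 1 := (Matrix.mem_orthogonalGroup_iff' _ _).1 g.2
  rw [Matrix.dotProduct_mulVec, Matrix.vecMul_mulVec, h]
  simp

theorem mulVec_inv_mulVec (g : O2) (v : Fin 2 → ℝ) : g.1.mulVec ((g⁻¹ : O2).1.mulVec v) = v := by
  have : g.1 * (g⁻¹ : O2).1 = 1 := congrArg Subtype.val (mul_inv_cancel g)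
  rw [Matrix.mulVec_mulVec, this, Matrix.one_mulVec]

theorem inv_mulVec_mulVec (g : O2) (v : Fin 2 → ℝ) : (g⁻¹ : O2).1.mulVec (g.1.mulVec v) = v := by
  have : (g⁻¹ : O2).1 * g.1 = 1 := congrArg Subtype.val (inv_mul_cancel g)
  rw [Matrix.mulVec_mulVec, this, Matrix.one_mulVec]

theorem polyAct_C (g : O2) (a : ℝ) : polyAct g (C a) = C a := AlgEquiv.commutes _ _

theorem polyAct_lin (g : O2) (n : Fin 2 → ℝ) : polyAct g (lin n) = lin (g.1.mulVec n) := by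
  have h : ∀ i, polyAct g (X i) = ∑ j, C ((g⁻¹ : O2).1 i j) * X j := fun i => by
    change polyActHom g _ = _
    rw [polyActHom, aeval_X]
  have h2 : ∀ i j, (g⁻¹ : O2).1 i j = g.1 j i := fun i j => rfl
  simp only [lin, map_add, map_mul, polyAct_C, h, h2, Fin.sum_univ_two, Matrix.mulVec,
    dotProduct]
  ring

theorem polyAct_mul (g k : O2) (p : Poly) : polyAct (g * k) p = polyAct g (polyAct k p) :=
  congrArg (fun φ : Poly →ₐ[ℝ] Poly => φ p) (polyActHom_mul g k)

theorem fieldAct_cst (g : O2) (a : ℝ) : fieldAct g (cst a) = cst a := by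
  rw [← toF_C, fieldAct_algebraMap, polyAct_C]

theorem fieldAct_mul (g k : O2) (f : Rat2) : fieldAct (g * k) f = fieldAct g (fieldAct k f) := by
  obtain ⟨p, q, hq, rfl⟩ := IsFractionRing.div_surjective (A := Poly) f
  simp only [map_div₀, fieldAct_algebraMap, polyAct_mul]

/-- An automorphism intertwines two derivations if it does so on the coordinates. -/
theorem fieldAct_der_of_coord {g : O2} {θ η : DerF}
    (h : ∀ i, fieldAct g (θ (coord i)) = η (fieldAct g (coord i))) (f : Rat2) :
    fieldAct g (θ f) = η (fieldAct g f) := by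
  have hp : ∀ p : Poly, fieldAct g (θ (toF p)) = η (fieldAct g (toF p)) := by
    intro p
    induction p using MvPolynomial.induction_on with
    | C a => rw [toF_C, fieldAct_cst, Derivation.map_algebraMap, Derivation.map_algebraMap, map_zero]
    | add p q hp hq => simp only [map_add, hp, hq]
    | mul_X p i hp =>
      have := h i
      unfold coord at this
      simp only [map_mul, der_mul, map_add, hp, this]
  obtain ⟨p, q, hq, rfl⟩ := IsFractionRing.div_surjective (A := Poly) f
  have hq0 : toF q ≠ 0 := fun h => nonZeroDivisors.ne_zero hq (toF_eq_zero.1 h)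
  have hq1 : fieldAct g (toF q) ≠ 0 := fun h => hq0 ((map_eq_zero _).1 h)
  rw [der_div _ _ _ hq0, map_div₀ (fieldAct g), map_div₀ (fieldAct g), der_div _ _ _ hq1]
  simp only [map_mul, map_sub, map_pow, hp]

theorem fieldAct_der_of_lin {g : O2} {θ η : DerF} {n : Fin 2 → ℝ} (hn : n ≠ 0)
    (h : fieldAct g (θ (toF (lin n))) = η (fieldAct g (toF (lin n))))
    (h' : fieldAct g (θ (toF (lin (perp n)))) = η (fieldAct g (toF (lin (perp n)))))
    (f : Rat2) : fieldAct g (θ f) = η (fieldAct g f) := by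
  apply fieldAct_der_of_coord
  have key : ∀ i, fieldAct g (cst (sqLen n) * θ (coord i))
      = η (fieldAct g (cst (sqLen n) * coord i)) := by
    have e0 : cst (sqLen n) * coord 0
        = cst (n 0) * toF (lin n) - cst (n 1) * toF (lin (perp n)) := by
      simpa [euler, der_lin, ← toF_lin] using sqLen_mul_coord_zero euler n
    have e1 : cst (sqLen n) * coord 1
        = cst (n 1) * toF (lin n) + cst (n 0) * toF (lin (perp n)) := by
      simpa [euler, der_lin, ← toF_lin] using sqLen_mul_coord_one euler n
    intro i
    fin_cases i
    · simp only [Fin.zero_eta, sqLen_mul_coord_zero, e0, map_sub, map_mul, fieldAct_cst, h, h',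
        der_cst_mul]
    · simp only [Fin.mk_one, sqLen_mul_coord_one, e1, map_add, map_mul, fieldAct_cst, h, h',
        der_cst_mul]
  intro i
  have := key i
  rw [map_mul, map_mul, fieldAct_cst, der_cst_mul] at this
  exact mul_left_cancel₀ (fun h => sqLen_ne_zero hn (cst_eq_zero.1 h)) this

/-- `g` acts as the orthogonal reflection along `n`. -/
def Reflects (g : O2) (n : Fin 2 → ℝ) : Prop :=
  polyAct g (lin n) = -lin n ∧ polyAct g (lin (perp n)) = lin (perp n)

namespace Reflects

variable {g : O2} {n : Fin 2 → ℝ}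

theorem fieldAct_lin (h : Reflects g n) : fieldAct g (toF (lin n)) = -toF (lin n) := by
  rw [fieldAct_algebraMap, h.1, map_neg]

theorem fieldAct_perp (h : Reflects g n) :
    fieldAct g (toF (lin (perp n))) = toF (lin (perp n)) := by
  rw [fieldAct_algebraMap, h.2]

/-- A reflection is the identity on its mirror, so it acts trivially modulo `lin n`; it suffices to
check this on the coordinates. -/
theorem dvd_polyAct_sub (h : Reflects g n) (hn : n ≠ 0) (p : Poly) :
    lin n ∣ polyAct g p - p := by
  have e0 : C (sqLen n) * X 0 = C (n 0) * lin n - C (n 1) * lin (perp n) := by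
    simp only [lin, perp, sqLen, map_add, map_pow, Matrix.cons_val_zero, Matrix.cons_val_one, map_neg]
    ring
  have e1 : C (sqLen n) * X 1 = C (n 1) * lin n + C (n 0) * lin (perp n) := by
    simp only [lin, perp, sqLen, map_add, map_pow, Matrix.cons_val_zero, Matrix.cons_val_one, map_neg]
    ring
  have hc : (C (sqLen n)⁻¹ * C (sqLen n) : Poly) = 1 := by
    rw [← map_mul, inv_mul_cancel₀ (sqLen_ne_zero hn), map_one]
  have hX : ∀ i, lin n ∣ polyAct g (X i) - X i := by
    have key : ∀ i, lin n ∣ C (sqLen n) * (polyAct g (X i) - X i) := by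
      have e : ∀ i, C (sqLen n) * (polyAct g (X i) - X i)
          = polyAct g (C (sqLen n) * X i) - C (sqLen n) * X i := fun i => by
        rw [map_mul, polyAct_C]; ring
      intro i
      rw [e]
      fin_cases i
      · refine ⟨-2 * C (n 0), ?_⟩
        simp only [Fin.zero_eta, e0, map_sub, map_mul, polyAct_C, h.1, h.2]
        ring
      · refine ⟨-2 * C (n 1), ?_⟩
        simp only [Fin.mk_one, e1, map_add, map_mul, polyAct_C, h.1, h.2]
        ring
    intro i
    have := (key i).mul_left (C (sqLen n)⁻¹)
    rwa [← mul_assoc, hc, one_mul] at this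
  induction p using MvPolynomial.induction_on with
  | C a => rw [polyAct_C]; simp
  | add p q hp hq =>
    have : polyAct g (p + q) - (p + q) = (polyAct g p - p) + (polyAct g q - q) := by
      rw [map_add]; ring
    rw [this]; exact dvd_add hp hq
  | mul_X p i hp =>
    have : polyAct g (p * X i) - p * X i
        = (polyAct g p - p) * polyAct g (X i) + p * (polyAct g (X i) - X i) := by
      rw [map_mul]; ring
    rw [this]; exact dvd_add (hp.mul_right _) ((hX i).mul_left _)

/-- The order of an odd function is odd. -/
theorem ordGe_succ_of_odd (h : Reflects g n) (hn : n ≠ 0) {f : Rat2} (hf : fieldAct g f = -f)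
    {j : ℤ} (hj : Even j) (ho : OrdGe (lin n) j f) : OrdGe (lin n) (j + 1) f := by
  have ha := lin_prime hn
  have h0 := toF_prime_ne_zero ha
  obtain ⟨p, q, hq, e⟩ := ho
  have hgz : fieldAct g (toF (lin n) ^ j) = toF (lin n) ^ j := by
    rw [map_zpow₀, h.fieldAct_lin, hj.neg_zpow]
  have e2 := congrArg (fieldAct g) e
  rw [map_mul, map_mul, hgz, hf, fieldAct_algebraMap, fieldAct_algebraMap] at e2
  have e3 : toF (p * polyAct g q + q * polyAct g p) = 0 := by
    apply mul_left_cancel₀ (zpow_ne_zero j h0)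
    simp only [map_add, map_mul]
    linear_combination -toF (polyAct g q) * e - toF q * e2
  obtain ⟨r, hr⟩ := h.dvd_polyAct_sub hn p
  obtain ⟨s, hs⟩ := h.dvd_polyAct_sub hn q
  have e4 := toF_eq_zero.1 e3
  -- Modulo `lin n` the reflection is trivial, so the relation `e4` reads `2 p q ≡ 0`.
  have hd : lin n ∣ p * q := by
    refine ⟨-C (1 / 2) * (p * s + q * r), ?_⟩
    have h2 : (C (1 / 2) * 2 : Poly) = 1 := by
      rw [← map_ofNat (C : ℝ →+* Poly) 2, ← map_mul]; norm_num
    linear_combination C (1 / 2) * e4 - C (1 / 2) * p * hs - C (1 / 2) * q * hr - p * q * h2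
  obtain ⟨t, rfl⟩ := (ha.dvd_or_dvd hd).resolve_right hq
  refine ⟨t, q, hq, ?_⟩
  rw [e, zpow_add₀ h0, zpow_one, map_mul]; ring

theorem dvd_of_odd (h : Reflects g n) (hn : n ≠ 0) {p : Poly} (hp : polyAct g p = -p) :
    lin n ∣ p := by
  have : OrdGe (lin n) ((1 : ℕ) : ℤ) (toF p) := by
    refine h.ordGe_succ_of_odd hn ?_ (j := 0) (by simp) (ordGe_toF (lin_prime hn) p)
    rw [fieldAct_algebraMap, hp, map_neg]
  simpa using this.dvd_of_pos (lin_prime hn)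

/-- Reflections reverse the orientation, hence the sense of rotation. -/
theorem fieldAct_rot (h : Reflects g n) (hn : n ≠ 0) (f : Rat2) :
    fieldAct g (rot f) = -rot (fieldAct g f) := by
  have := fieldAct_der_of_lin (g := g) (θ := rot) (η := -rot) hn
    (by rw [h.fieldAct_lin, rot_lin, map_neg, h.fieldAct_perp, Derivation.neg_apply, map_neg, rot_lin]
        ring)
    (by rw [h.fieldAct_perp, rot_lin_perp, h.fieldAct_lin, Derivation.neg_apply, rot_lin_perp]) f
  simpa using this

end Reflects

theorem dotProduct_perp_sq (y n : Fin 2 → ℝ) :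
    (y ⬝ᵥ n) ^ 2 + (y ⬝ᵥ perp n) ^ 2 = (y ⬝ᵥ y) * (n ⬝ᵥ n) := by
  simp [dotProduct, Fin.sum_univ_two, perp]; ring

theorem dotProduct_self_eq_sqLen (n : Fin 2 → ℝ) : n ⬝ᵥ n = sqLen n := by
  simp [dotProduct, Fin.sum_univ_two, sqLen]; ring

theorem eq_of_sqLen_sub {y n : Fin 2 → ℝ} (h : sqLen (y - n) = 0) : y = n := by
  by_contra hne
  exact sqLen_ne_zero (sub_ne_zero.2 hne) h

/-- An orthogonal reflection that fixes the line orthogonal to `n` reflects along `n`. -/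
theorem IsReflection.reflects {g : O2} (hg : IsReflection g) {n : Fin 2 → ℝ} (hn : n ≠ 0)
    (hfix : perp n ∈ fixedSpace g) : Reflects g n := by
  have hv := mem_fixedSpace.1 hfix
  have h1 : g.1.mulVec n ⬝ᵥ perp n = 0 := by
    have := dotProduct_mulVec_mulVec g n (perp n)
    rw [hv] at this
    rw [this]; simp [dotProduct, Fin.sum_univ_two, perp]; ring
  have h2 := dotProduct_mulVec_mulVec g n n
  have h3 := dotProduct_perp_sq (g.1.mulVec n) n
  rw [h1, h2] at h3
  set y := g.1.mulVec n with hy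
  -- The image `y` of `n` is orthogonal to the fixed vector `perp n` and has the length of `n`, so
  -- `y = ±n`. The sign `+` would make `g` the identity, whose fixed space is two-dimensional.
  have h4 : (y ⬝ᵥ n - n ⬝ᵥ n) * (y ⬝ᵥ n + n ⬝ᵥ n) = 0 := by linear_combination h3
  have h5 : y = -n := by
    rcases mul_eq_zero.1 h4 with h | h
    · exfalso
      have hyn : y = n := by
        apply eq_of_sqLen_sub
        rw [← dotProduct_self_eq_sqLen, sub_dotProduct, dotProduct_sub, dotProduct_sub,
          dotProduct_comm n y]
        linear_combination h2 - 2 * h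
      have htop : fixedSpace g = ⊤ := by
        rw [eq_top_iff]
        intro v _
        have hL := sqLen_ne_zero hn
        have hv' : v = ((v ⬝ᵥ n) / sqLen n) • n + ((v ⬝ᵥ perp n) / sqLen n) • perp n := by
          funext i
          fin_cases i <;> simp [dotProduct, Fin.sum_univ_two, perp] <;> field_simp <;>
            simp only [sqLen] <;> ring
        rw [hv']
        exact add_mem (Submodule.smul_mem _ _ (mem_fixedSpace.2 hyn))
          (Submodule.smul_mem _ _ hfix)
      unfold IsReflection at hg
      rw [htop, finrank_top] at hg
      simp at hg
    · rw [← sub_neg_eq_add, sub_eq_zero] at h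
      apply eq_of_sqLen_sub
      rw [← dotProduct_self_eq_sqLen, sub_neg_eq_add, add_dotProduct, dotProduct_add,
        dotProduct_add, dotProduct_comm n y]
      linear_combination h2 + 2 * h
  constructor
  · rw [polyAct_lin, ← hy, h5]
    simp [lin]; ring
  · rw [polyAct_lin, hv]

/-! ### The infinitesimal rotation on polynomials -/

theorem rotPoly_add (p q : Poly) : rotPoly (p + q) = rotPoly p + rotPoly q := by
  simp only [rotPoly, map_add]; ring

theorem rotPoly_mul (p q : Poly) : rotPoly (p * q) = p * rotPoly q + q * rotPoly p := by
  simp only [rotPoly, Derivation.leibniz, smul_eq_mul]; ring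

theorem rotPoly_C (a : ℝ) : rotPoly (C a) = 0 := by simp [rotPoly]

theorem rotPoly_C_mul (a : ℝ) (p : Poly) : rotPoly (C a * p) = C a * rotPoly p := by
  rw [rotPoly_mul, rotPoly_C]; ring

/-- The rotation invariant polynomials. -/
def rotKer : Subalgebra ℝ Poly where
  carrier := {p | rotPoly p = 0}
  mul_mem' := by
    intro p q hp hq
    simp only [Set.mem_ofPred_eq] at *
    rw [rotPoly_mul, hp, hq]; ring
  add_mem' := by
    intro p q hp hq
    simp only [Set.mem_ofPred_eq] at *
    rw [rotPoly_add, hp, hq, add_zero]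
  algebraMap_mem' := fun r => rotPoly_C r

theorem mem_rotKer {p : Poly} : p ∈ rotKer ↔ rotPoly p = 0 := Iff.rfl

theorem rotPoly_isHomogeneous {p : Poly} {n : ℕ} (hp : p.IsHomogeneous n) :
    (rotPoly p).IsHomogeneous n := by
  -- Constants are treated apart because the degree `n - 1` of a partial derivative is a truncated
  -- subtraction.
  rcases eq_or_ne n 0 with rfl | hn
  · rw [totalDegree_eq_zero_iff_eq_C.1 (Nat.le_zero.1 hp.totalDegree_le), rotPoly_C]
    exact isHomogeneous_zero _ _ _
  have h : ∀ i j, (X i * pderiv j p : Poly).IsHomogeneous n := fun i j => by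
    have := (isHomogeneous_X ℝ i).mul (hp.pderiv (i := j))
    rwa [show 1 + (n - 1) = n by lia] at this
  exact (h 0 1).sub (h 1 0)

theorem euler_identity {p : Poly} {n : ℕ} (hp : p.IsHomogeneous n) :
    X 0 * pderiv 0 p + X 1 * pderiv 1 p = (n : Poly) * p := by
  have := hp.sum_X_mul_pderiv
  rwa [Fin.sum_univ_two, nsmul_eq_mul] at this

/-- The square of the distance to the origin. -/
def radial : Poly := X 0 ^ 2 + X 1 ^ 2

theorem radial_mem_rotKer : radial ∈ rotKer := by
  rw [mem_rotKer]
  simp [radial, rotPoly, pderiv_X, Derivation.leibniz_pow]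
  ring

theorem radial_isHomogeneous : radial.IsHomogeneous 2 :=
  (isHomogeneous_X_pow 0 2).add (isHomogeneous_X_pow 1 2)

theorem radial_ne_zero : radial ≠ 0 := by
  intro h
  have := congrArg (MvPolynomial.eval ![1, 0]) h
  simp [radial] at this

/-- Evaluation at the isotropic point `(1, i)`. -/
def isoEval : Poly →ₐ[ℝ] ℂ := aeval ![1, Complex.I]

/-- At `(1, i)` the rotation field equals `-i` times the Euler field, so Euler's identity applies.
-/
theorem isoEval_rotPoly {p : Poly} {n : ℕ} (hp : p.IsHomogeneous n) :
    isoEval (rotPoly p) = -Complex.I * n * isoEval p := by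
  have h := congrArg isoEval (euler_identity hp)
  simp only [map_add, map_mul, map_natCast] at h
  have h0 : isoEval (X 0) = 1 := by simp [isoEval]
  have h1 : isoEval (X 1) = Complex.I := by simp [isoEval]
  rw [h0, h1] at h
  simp only [rotPoly, map_sub, map_mul, h0, h1]
  linear_combination -Complex.I * h + isoEval (pderiv 1 p) * Complex.I_mul_I

/-- The value is `n 0 + i n 1` with real `n 0`, `n 1`. Consequently `Q` does not vanish at the
isotropic point, where eigenvalues of `rot` can then be read off. -/
theorem isoEval_lin_ne_zero {n : Fin 2 → ℝ} (hn : n ≠ 0) : isoEval (lin n) ≠ 0 := by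
  intro h
  have e : isoEval (lin n) = (n 0 : ℂ) + n 1 * Complex.I := by
    simp [isoEval, lin]
  rw [e] at h
  have hr := congrArg Complex.re h
  have hi := congrArg Complex.im h
  simp at hr hi
  exact sqLen_ne_zero hn (by simp [sqLen, hr, hi])

/-- A homogeneous polynomial that divides a nonzero one of the same degree. -/
theorem exists_eq_C_mul_of_dvd {p q : Poly} {n m : ℕ} (hq : q.IsHomogeneous n)
    (hp : p.IsHomogeneous m) (hp0 : p ≠ 0) (hmn : m ≤ n) (h : q ∣ p) :
    m = n ∧ ∃ c : ℝ, c ≠ 0 ∧ p = C c * q := by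
  obtain ⟨t, rfl⟩ := h
  have hq0 : q ≠ 0 := left_ne_zero_of_mul hp0
  have ht0 : t ≠ 0 := right_ne_zero_of_mul hp0
  have := hp.totalDegree hp0
  rw [totalDegree_mul_of_isDomain hq0 ht0, hq.totalDegree hq0] at this
  have ht : t.totalDegree = 0 := by lia
  have hC := totalDegree_eq_zero_iff_eq_C.1 ht
  refine ⟨by lia, coeff 0 t, fun h0 => ht0 ?_, ?_⟩
  · rw [hC, h0, C_0]
  · rw [← hC, mul_comm]

theorem exists_eq_lin {p : Poly} (hp : p.IsHomogeneous 1) : ∃ n, p = lin n := by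
  have hc : ∀ i, ∃ c : ℝ, pderiv i p = C c := fun i => by
    have h := hp.pderiv (i := i)
    exact ⟨_, totalDegree_eq_zero_iff_eq_C.1 (Nat.le_zero.1 h.totalDegree_le)⟩
  obtain ⟨a, ha⟩ := hc 0
  obtain ⟨b, hb⟩ := hc 1
  refine ⟨![a, b], ?_⟩
  have := euler_identity hp
  rw [ha, hb, Nat.cast_one, one_mul] at this
  rw [← this]
  simp [lin]; ring

theorem lin_injective : Function.Injective lin := by
  intro n k h
  by_contra hne
  apply lin_ne_zero (sub_ne_zero.2 hne)
  have : lin (n - k) = lin n - lin k := by simp [lin]; ring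
  rw [this, h, sub_self]

theorem Reflects.polyAct_rotPoly {g : O2} {n : Fin 2 → ℝ} (h : Reflects g n) (hn : n ≠ 0)
    (p : Poly) : polyAct g (rotPoly p) = -rotPoly (polyAct g p) := by
  apply toF_injective
  rw [← fieldAct_algebraMap, ← rot_toF, h.fieldAct_rot hn, fieldAct_algebraMap, rot_toF, map_neg]

/-- The forms are pairwise non-associated primes, so `p / Q` has no pole. -/
theorem LineArrangement.defPoly_dvd {ι : Type*} [Fintype ι] (A : LineArrangement ι) {p : Poly}
    (h : ∀ H, A.form H ∣ p) : A.defPoly ∣ p := by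
  have h0 := A.toF_defPoly_ne_zero
  have : ∃ q, toF A.defPoly ^ (-1 : ℤ) * toF p = toF q := by
    apply A.exists_eq_toF_of_form
    · intro a ha hA
      exact (ordGe_zpow_of_not_dvd ha (A.not_dvd_defPoly ha hA) _).mul_eq ha (ordGe_toF ha p)
        (zero_add 0)
    · intro H
      obtain ⟨r, rfl⟩ := h H
      have hα := A.form_prime H
      rw [map_mul]
      exact (A.ordGe_defPoly_zpow H (-1)).mul_eq hα
        ((ordGe_self hα).mul_eq hα (ordGe_toF hα r) (add_zero 1)) (neg_add_cancel 1)
  obtain ⟨q, hq⟩ := this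
  refine ⟨q, toF_injective ?_⟩
  rw [map_mul, ← hq, zpow_neg_one, mul_inv_cancel_left₀ h0]

/-! ### Coxeter arrangements -/

section Coxeter

variable {W : Subgroup O2} {ι : Type*} {A : LineArrangement ι}

theorem perp_mem_line (A : LineArrangement ι) (H : ι) : perp (A.normal H) ∈ A.line H := by
  change A.normal H 0 * perp (A.normal H) 0 + A.normal H 1 * perp (A.normal H) 1 = 0
  simp [perp]; ring

theorem IsCoxeterArrangement.exists_reflects (hA : IsCoxeterArrangement W A) (H : ι) :
    ∃ g ∈ W, IsReflection g ∧ A.line H = fixedSpace g ∧ Reflects g (A.normal H) := by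
  have : A.line H ∈ Set.range A.line := ⟨H, rfl⟩
  rw [hA] at this
  obtain ⟨g, hg, hr, e⟩ := this
  exact ⟨g, hg, hr, e, hr.reflects (A.normal_ne_zero H) (e ▸ perp_mem_line A H)⟩

theorem IsCoxeterArrangement.exists_line_eq (hA : IsCoxeterArrangement W A) {g : O2} (hg : g ∈ W)
    (hr : IsReflection g) : ∃ H, A.line H = fixedSpace g := by
  have : fixedSpace g ∈ Set.range A.line := by
    rw [hA]; exact ⟨g, hg, hr, rfl⟩
  exact this

/-- Every generator of `W` reflects along the normal of some line of the arrangement, so properties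
stable under the group operations need only be checked on such reflections. -/
theorem IsCoxeterGroup.induction (hW : IsCoxeterGroup W) (hA : IsCoxeterArrangement W A)
    {p : O2 → Prop} (hrefl : ∀ g ∈ W, ∀ H, Reflects g (A.normal H) → p g) (hone : p 1)
    (hmul : ∀ g k, p g → p k → p (g * k)) (hinv : ∀ g, p g → p g⁻¹) : ∀ g ∈ W, p g := by
  intro g hg
  rw [← hW.generated] at hg
  induction hg using Subgroup.closure_induction with
  | mem x hx =>
    obtain ⟨H, hH⟩ := hA.exists_line_eq hx.1 hx.2
    exact hrefl x hx.1 H (hx.2.reflects (A.normal_ne_zero H) (hH ▸ perp_mem_line A H))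
  | one => exact hone
  | mul x y _ _ hx hy => exact hmul x y hx hy
  | inv x _ hx => exact hinv x hx

/-- Without mirrors there would be no generators, and `W` would fix `(1, 0)`. -/
theorem IsCoxeterGroup.nonempty (hW : IsCoxeterGroup W) (hA : IsCoxeterArrangement W A) :
    Nonempty ι := by
  by_contra hne
  rw [not_nonempty_iff] at hne
  have := hW.essential ![1, 0] (hW.induction hA (fun g _ H => hne.elim H) ?_ ?_ ?_)
  · simpa using congrFun this 0
  · rw [mem_fixedSpace]; simp
  · intro g k hg hk
    rw [mem_fixedSpace] at *
    rw [show (g * k).1 = g.1 * k.1 from rfl, ← Matrix.mulVec_mulVec, hk, hg]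
  · intro g hg
    rw [mem_fixedSpace] at *
    have := inv_mulVec_mulVec g ![1, 0]
    rwa [hg] at this

theorem mem_invariantRing_of_reflects (hW : IsCoxeterGroup W) (hA : IsCoxeterArrangement W A)
    {p : Poly} (h : ∀ g ∈ W, ∀ H, Reflects g (A.normal H) → polyAct g p = p) :
    p ∈ invariantRing W := by
  refine hW.induction hA h ?_ ?_ ?_
  · exact congrArg (fun φ : Poly →ₐ[ℝ] Poly => φ p) polyActHom_one
  · intro g k hg hk
    rw [polyAct_mul, hk, hg]
  · intro g hg
    have e := congrArg (fun φ : Poly →ₐ[ℝ] Poly => φ p) polyActHom_one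
    have : polyAct g⁻¹ (polyAct g p) = p := by
      rw [← polyAct_mul, inv_mul_cancel]; exact e
    rwa [hg] at this

theorem fieldAct_one (f : Rat2) : fieldAct 1 f = f := by
  obtain ⟨p, q, hq, rfl⟩ := IsFractionRing.div_surjective (A := Poly) f
  have e : ∀ p, polyAct 1 p = p := fun p =>
    congrArg (fun φ : Poly →ₐ[ℝ] Poly => φ p) polyActHom_one
  simp only [map_div₀, fieldAct_algebraMap, e]

theorem mem_invariantDer_of_reflects (hW : IsCoxeterGroup W) (hA : IsCoxeterArrangement W A)
    {θ : DerF} (h : ∀ g ∈ W, ∀ H, Reflects g (A.normal H) → ∀ f, fieldAct g (θ f)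
      = θ (fieldAct g f)) : θ ∈ invariantDer W := by
  refine hW.induction hA h ?_ ?_ ?_
  · intro f; rw [fieldAct_one, fieldAct_one]
  · intro g k hg hk f
    rw [fieldAct_mul, hk, hg, fieldAct_mul]
  · intro g hg f
    have e : ∀ f, fieldAct g (fieldAct g⁻¹ f) = f := fun f => by
      rw [← fieldAct_mul, mul_inv_cancel, fieldAct_one]
    apply (fieldAct g).injective
    rw [e, hg, e]

/-- The forms of the arrangement are permuted up to scalars. -/
theorem IsCoxeterArrangement.exists_polyAct_form (hA : IsCoxeterArrangement W A) {g : O2}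
    (hg : g ∈ W) (K : ι) : ∃ K' : ι, ∃ c : ℝ, polyAct g (A.form K) = C c * A.form K' := by
  obtain ⟨s, hs, hr, hline, -⟩ := hA.exists_reflects K
  -- The conjugate `g s g⁻¹` is the reflection whose mirror is the image under `g` of the mirror of
  -- `s`.
  have hmap : fixedSpace (g * s * g⁻¹)
      = (fixedSpace s).map (Matrix.toLin' g.1) := by
    ext v
    rw [mem_fixedSpace, Submodule.mem_map]
    have hm : (g * s * g⁻¹).1.mulVec v = g.1.mulVec (s.1.mulVec ((g⁻¹ : O2).1.mulVec v)) := by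
      rw [Matrix.mulVec_mulVec, Matrix.mulVec_mulVec]; rfl
    rw [hm]
    constructor
    · intro h
      refine ⟨(g⁻¹ : O2).1.mulVec v, ?_, ?_⟩
      · rw [mem_fixedSpace]
        have := congrArg (g⁻¹ : O2).1.mulVec h
        rwa [inv_mulVec_mulVec] at this
      · rw [Matrix.toLin'_apply, mulVec_inv_mulVec]
    · rintro ⟨w, hw, rfl⟩
      rw [mem_fixedSpace] at hw
      rw [Matrix.toLin'_apply, inv_mulVec_mulVec, hw]
  have hinj : Function.Injective (Matrix.toLin' g.1) := fun v w h => by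
    rw [Matrix.toLin'_apply, Matrix.toLin'_apply] at h
    rw [← inv_mulVec_mulVec g v, h, inv_mulVec_mulVec]
  have hr' : IsReflection (g * s * g⁻¹) := by
    unfold IsReflection at hr ⊢
    rw [hmap, ← (Submodule.equivMapOfInjective _ hinj _).finrank_eq]
    exact hr
  obtain ⟨K', hK'⟩ := hA.exists_line_eq (W.mul_mem (W.mul_mem hg hs) (W.inv_mem hg)) hr'
  have hmem : g.1.mulVec (perp (A.normal K)) ∈ A.line K' := by
    rw [hK', hmap, ← hline]
    exact ⟨_, perp_mem_line A K, by rw [Matrix.toLin'_apply]⟩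
  have hdot : A.normal K' ⬝ᵥ g.1.mulVec (perp (A.normal K)) = 0 := by
    have : A.normal K' 0 * g.1.mulVec (perp (A.normal K)) 0
      + A.normal K' 1 * g.1.mulVec (perp (A.normal K)) 1 = 0 := hmem
    rw [dotProduct, Fin.sum_univ_two, this]
  set n := A.normal K with hn
  set k := A.normal K' with hk
  set y := g.1.mulVec n with hy
  have h1 : y ⬝ᵥ g.1.mulVec (perp n) = 0 := by
    rw [hy, dotProduct_mulVec_mulVec]; simp [dotProduct, Fin.sum_univ_two, perp]; ring
  set z := g.1.mulVec (perp n) with hz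
  have hz0 : sqLen z ≠ 0 := by
    rw [← dotProduct_self_eq_sqLen, hz, dotProduct_mulVec_mulVec, dotProduct_self_eq_sqLen,
      sqLen_perp]
    exact sqLen_ne_zero (A.normal_ne_zero K)
  have hk0 : sqLen k ≠ 0 := sqLen_ne_zero (A.normal_ne_zero K')
  simp only [dotProduct, Fin.sum_univ_two] at hdot h1
  -- Both `y` and `k` are orthogonal to the nonzero vector `z`, hence proportional.
  have hdet : y 0 * k 1 - y 1 * k 0 = 0 := by
    apply mul_left_cancel₀ hz0
    unfold sqLen
    linear_combination (k 1 * z 0 - k 0 * z 1) * h1 + (y 0 * z 1 - y 1 * z 0) * hdot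
  refine ⟨K', (y ⬝ᵥ k) / sqLen k, ?_⟩
  rw [A.form_eq_lin, A.form_eq_lin, polyAct_lin, ← hn, ← hy, ← hk]
  have hsm : ∀ (c : ℝ) (v : Fin 2 → ℝ), C c * lin v = lin (c • v) := fun c v => by
    simp [lin]; ring
  rw [hsm]
  congr 1
  funext i
  fin_cases i <;> simp [dotProduct, Fin.sum_univ_two] <;> field_simp <;> simp only [sqLen]
  · linear_combination k 1 * hdet
  · linear_combination -k 0 * hdet

/-- Since `g` permutes the lines, `Q` is multiplied by a scalar `t`. Write `Q = α_H r`. As `g`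
negates `α_H`, it takes `r` to `-t r`; it also fixes `r` modulo `α_H`, and `α_H` does not divide
`r`. Hence `t = -1`. -/
theorem IsCoxeterArrangement.polyAct_defPoly [Fintype ι] (hA : IsCoxeterArrangement W A)
    {g : O2} (hg : g ∈ W) {H : ι} (h : Reflects g (A.normal H)) :
    polyAct g A.defPoly = -A.defPoly := by
  have hn := A.normal_ne_zero H
  choose σ c hσ using fun K => hA.exists_polyAct_form hg K
  have hc0 : ∀ K, c K ≠ 0 := fun K h0 => by
    have := hσ K
    rw [h0, C_0, zero_mul, map_eq_zero_iff _ (polyAct g).injective] at this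
    exact (A.form_prime K).ne_zero this
  have hinj : Function.Injective σ := by
    intro K L hKL
    by_contra hne
    apply A.form_not_dvd_form hne
    have h1 : polyAct g (C (c L) * A.form K) = polyAct g (C (c K) * A.form L) := by
      rw [map_mul, map_mul, hσ K, hσ L, polyAct_C, polyAct_C, hKL]; ring
    have h2 := (polyAct g).injective h1
    refine ⟨C (c K)⁻¹ * C (c L), ?_⟩
    have h3 : (C (c K)⁻¹ * C (c K) : Poly) = 1 := by
      rw [← map_mul, inv_mul_cancel₀ (hc0 K), map_one]
    linear_combination -A.form L * h3 - C (c K)⁻¹ * h2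
  have hbij := Finite.injective_iff_bijective.1 hinj
  have hQ : polyAct g A.defPoly = C (∏ K, c K) * A.defPoly := by
    rw [LineArrangement.defPoly, map_prod, Finset.prod_congr rfl fun K _ => hσ K,
      Finset.prod_mul_distrib, map_prod, hbij.prod_comp A.form]
  set t := ∏ K, c K
  obtain ⟨r, hr, hHr⟩ := A.exists_defPoly_eq H
  obtain ⟨u, hu⟩ := h.dvd_polyAct_sub hn r
  have hα := A.form_prime H
  rw [hr, map_mul, A.form_eq_lin, h.1, ← A.form_eq_lin] at hQ
  have h1 : (C t + 1) * r = A.form H * -u := by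
    apply mul_left_cancel₀ hα.ne_zero
    rw [← A.form_eq_lin] at hu
    linear_combination -hQ - A.form H * hu
  have ht : t + 1 = 0 := by
    by_contra hne
    apply hHr
    refine ⟨C (t + 1)⁻¹ * -u, ?_⟩
    have h3 : (C (t + 1)⁻¹ * (C t + 1) : Poly) = 1 := by
      rw [← C_1, ← map_add, ← map_mul, inv_mul_cancel₀ hne, map_one]
    linear_combination -r * h3 + C (t + 1)⁻¹ * h1
  have ht' : t = -1 := by linarith
  rw [hr, map_mul, A.form_eq_lin, h.1, ← A.form_eq_lin, hQ, ht']
  simp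

/-- An odd polynomial vanishes on every mirror. -/
theorem IsCoxeterArrangement.defPoly_dvd_of_odd [Fintype ι] (hA : IsCoxeterArrangement W A)
    {p : Poly} (h : ∀ g ∈ W, ∀ H, Reflects g (A.normal H) → polyAct g p = -p) :
    A.defPoly ∣ p := by
  apply A.defPoly_dvd
  intro H
  obtain ⟨g, hg, -, -, hr⟩ := hA.exists_reflects H
  exact hr.dvd_of_odd (A.normal_ne_zero H) (h g hg H hr)

/-- `Q` is an eigenvector of the square of the infinitesimal rotation: it is the imaginary part
of `(x₀ + i x₁) ^ h` up to a rotation and a scalar. -/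
theorem IsCoxeterGroup.rotPoly_rotPoly_defPoly [Fintype ι] (hW : IsCoxeterGroup W)
    (hA : IsCoxeterArrangement W A) :
    rotPoly (rotPoly A.defPoly) = -C ((Fintype.card ι : ℝ) ^ 2) * A.defPoly := by
  have := hW.nonempty hA
  have hh : Fintype.card ι ≠ 0 := Fintype.card_ne_zero
  have hQ := A.defPoly_isHomogeneous
  have hN := rotPoly_isHomogeneous hQ
  have hNN := rotPoly_isHomogeneous hN
  have hev : isoEval A.defPoly ≠ 0 := by
    rw [LineArrangement.defPoly, map_prod]
    exact Finset.prod_ne_zero_iff.2 fun H _ => isoEval_lin_ne_zero (A.normal_ne_zero H)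
  -- This value fixes the proportionality factor: `(-i h)² = -h²`.
  have e : isoEval (rotPoly (rotPoly A.defPoly))
      = -(Fintype.card ι : ℂ) ^ 2 * isoEval A.defPoly := by
    rw [isoEval_rotPoly hN, isoEval_rotPoly hQ]
    linear_combination (Fintype.card ι : ℂ) ^ 2 * isoEval A.defPoly * Complex.I_mul_I
  have hne : rotPoly (rotPoly A.defPoly) ≠ 0 := by
    intro h0
    rw [h0, map_zero] at e
    exact mul_ne_zero (neg_ne_zero.2 (pow_ne_zero 2 (Nat.cast_ne_zero.2 hh))) hev e.symm
  -- Two sign changes cancel, so `rot² Q` is odd like `Q`; having the same degree, it is a constant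
  -- multiple of `Q`.
  have hd : A.defPoly ∣ rotPoly (rotPoly A.defPoly) := by
    apply hA.defPoly_dvd_of_odd
    intro g hg H hr
    have hn := A.normal_ne_zero H
    have hneg : ∀ p, rotPoly (-p) = -rotPoly p := fun p => by
      have := rotPoly_C_mul (-1) p
      simpa using this
    rw [hr.polyAct_rotPoly hn, hr.polyAct_rotPoly hn, hA.polyAct_defPoly hg hr]
    simp only [hneg, neg_neg]
  obtain ⟨-, c, -, hc⟩ := exists_eq_C_mul_of_dvd hQ hNN hne le_rfl hd
  rw [hc, map_mul] at e
  have hcc := mul_right_cancel₀ hev e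
  have : isoEval (C c) = (c : ℂ) := by simp [isoEval]
  rw [this] at hcc
  have hc' : c = -(Fintype.card ι : ℝ) ^ 2 := by exact_mod_cast hcc
  rw [hc, hc', map_neg]

end Coxeter

/-! ### Degrees of the basic invariants and the shape of the primitive derivation -/

section BasicInvariants

variable {W : Subgroup O2} {P : Fin 2 → Poly}

theorem mem_invariantRing_iff_adjoin (hP : IsBasicInvariants W P) {p : Poly} :
    p ∈ invariantRing W ↔ p ∈ Algebra.adjoin ℝ (Set.range P) := by
  rw [hP.generate]

theorem radial_mem_invariantRing : radial ∈ invariantRing W := by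
  intro g _
  have h : g.1 * g.1.transpose = 1 := (Matrix.mem_orthogonalGroup_iff _ _).1 g.2
  have e : ∀ i j, (g.1 * g.1.transpose) i j = (1 : Matrix (Fin 2) (Fin 2) ℝ) i j := by
    intro i j; rw [h]
  have h00 := e 0 0
  have h01 := e 0 1
  have h11 := e 1 1
  simp only [Matrix.mul_apply, Fin.sum_univ_two, Matrix.transpose_apply, Matrix.one_apply]
    at h00 h01 h11
  have hX0 : (X 0 : Poly) = lin ![1, 0] := by simp [lin]
  have hX1 : (X 1 : Poly) = lin ![0, 1] := by simp [lin]
  simp only [radial, map_add, map_pow]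
  rw [hX0, hX1, polyAct_lin, polyAct_lin]
  simp only [lin, Matrix.mulVec, dotProduct, Fin.sum_univ_two, Matrix.cons_val_zero,
    Matrix.cons_val_one, mul_one, mul_zero, add_zero, zero_add, C_1, C_0, one_mul, zero_mul]
  norm_num at h00 h01 h11
  have c00 := congrArg (C : ℝ → Poly) h00
  have c01 := congrArg (C : ℝ → Poly) h01
  have c11 := congrArg (C : ℝ → Poly) h11
  simp only [map_add, map_mul, C_1, C_0] at c00 c01 c11
  linear_combination X 0 ^ 2 * c00 + X 1 ^ 2 * c11 + 2 * X 0 * X 1 * c01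

/-- A homogeneous invariant is a combination of monomials in the basic invariants of its degree. -/
theorem mem_span_of_isHomogeneous (hP : IsBasicInvariants W P) {d : Fin 2 → ℕ}
    (hd : ∀ i, (P i).IsHomogeneous (d i)) {p : Poly} (hp : p ∈ invariantRing W) {n : ℕ}
    (hn : p.IsHomogeneous n) :
    p ∈ Submodule.span ℝ {r | ∃ a b : ℕ, d 0 * a + d 1 * b = n ∧ r = P 0 ^ a * P 1 ^ b} := by
  rw [mem_invariantRing_iff_adjoin hP, Algebra.adjoin_range_eq_range_aeval] at hp
  obtain ⟨f, rfl⟩ := hp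
  change IsHomogeneous (aeval P f) n at hn
  have e : aeval P f = homogeneousComponent n (aeval P f) := by
    rw [homogeneousComponent_of_mem hn, if_pos rfl]
  change aeval P f ∈ _
  rw [e, aeval_def, eval₂_eq', map_sum]
  refine Submodule.sum_mem _ fun m _ => ?_
  rw [← Algebra.smul_def, map_smul, Fin.prod_univ_two]
  refine Submodule.smul_mem _ _ ?_
  have hm : (P 0 ^ m 0 * P 1 ^ m 1).IsHomogeneous (d 0 * m 0 + d 1 * m 1) :=
    ((hd 0).pow _).mul ((hd 1).pow _)
  rw [homogeneousComponent_of_mem hm]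
  split_ifs with h
  · exact Submodule.subset_span ⟨m 0, m 1, h.symm, rfl⟩
  · exact zero_mem _

variable {ι : Type*} [Fintype ι] {A : LineArrangement ι}

/-- The basic invariants of a Coxeter group of the plane: the first one is a multiple of the
square of the distance, the second one has degree `h`. -/
theorem IsBasicInvariants.exists_rotPoly_eq (hP : IsBasicInvariants W P) (hW : IsCoxeterGroup W)
    (hA : IsCoxeterArrangement W A) :
    2 < Fintype.card ι ∧ (∃ t : ℝ, t ≠ 0 ∧ radial = C t * P 0) ∧
      ∃ c : ℝ, c ≠ 0 ∧ rotPoly (P 1) = C c * A.defPoly := by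
  obtain ⟨d, hd, hlt⟩ := hP.homogeneous
  have hinv : ∀ i, P i ∈ invariantRing W := fun i => by
    rw [mem_invariantRing_iff_adjoin hP]
    exact Algebra.subset_adjoin ⟨i, rfl⟩
  have := hW.nonempty hA
  have hh : Fintype.card ι ≠ 0 := Fintype.card_ne_zero
  have hP0 : P 0 ≠ 0 := hP.independent.ne_zero 0
  have hd0 : d 0 ≠ 0 := by
    intro h0
    have h1 := hd 0
    rw [h0] at h1
    have h2 := totalDegree_eq_zero_iff_eq_C.1 (Nat.le_zero.1 h1.totalDegree_le)
    apply hP.independent.transcendental 0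
    rw [h2]
    exact isAlgebraic_algebraMap _
  -- An invariant linear form would give a fixed vector.
  have hd1 : d 0 ≠ 1 := by
    intro h0
    have h1 := hd 0
    rw [h0] at h1
    obtain ⟨n, hn⟩ := exists_eq_lin h1
    apply hP0
    have hn0 : n = 0 := by
      apply hW.essential
      intro g hg
      rw [mem_fixedSpace]
      apply lin_injective
      rw [← polyAct_lin, ← hn, hinv 0 g hg]
    rw [hn, hn0]; simp [lin]
  have hrad : d 0 = 2 ∧ ∃ t : ℝ, t ≠ 0 ∧ radial = C t * P 0 := by
    have hmem := mem_span_of_isHomogeneous hP hd radial_mem_invariantRing radial_isHomogeneous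
    -- As `2 ≤ d 0 < d 1`, the only possible monomial of degree two is `P 0`.
    have hsub : ∀ r ∈ {r | ∃ a b : ℕ, d 0 * a + d 1 * b = 2 ∧ r = P 0 ^ a * P 1 ^ b},
        d 0 = 2 ∧ r = P 0 := by
      rintro r ⟨a, b, hab, rfl⟩
      have hb : b = 0 := by
        by_contra hb
        have : d 1 ≤ d 1 * b := Nat.le_mul_of_pos_right _ (Nat.pos_of_ne_zero hb)
        lia
      subst hb
      have ha : a = 1 := by
        have ha0 : a ≠ 0 := by rintro rfl; simp at hab
        by_contra ha
        have : d 0 * 2 ≤ d 0 * a := Nat.mul_le_mul_left _ (by lia)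
        lia
      subst ha
      simp at hab
      simp [hab]
    have h2 : d 0 = 2 := by
      by_contra h2
      have : {r | ∃ a b : ℕ, d 0 * a + d 1 * b = 2 ∧ r = P 0 ^ a * P 1 ^ b} = ∅ := by
        ext r
        constructor
        · intro hr; exact h2 (hsub r hr).1
        · intro hr; exact hr.elim
      rw [this, Submodule.span_empty, Submodule.mem_bot] at hmem
      exact radial_ne_zero hmem
    refine ⟨h2, ?_⟩
    have h3 := Submodule.span_mono (R := ℝ) (fun r hr => Set.mem_singleton_iff.2 (hsub r hr).2) hmem
    obtain ⟨t, ht⟩ := Submodule.mem_span_singleton.1 h3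
    rw [MvPolynomial.smul_eq_C_mul] at ht
    refine ⟨t, fun h0 => radial_ne_zero ?_, ht.symm⟩
    rw [← ht, h0, C_0, zero_mul]
  obtain ⟨hd2, t, ht, hrt⟩ := hrad
  have hrot0 : rotPoly (P 0) = 0 := by
    have h1 := mem_rotKer.1 radial_mem_rotKer
    rw [hrt, rotPoly_C_mul] at h1
    exact (mul_eq_zero.1 h1).resolve_left fun h => ht (C_eq_zero.1 h)
  have hQ := A.defPoly_isHomogeneous
  have hN := rotPoly_isHomogeneous hQ
  have hNN : rotPoly (rotPoly A.defPoly) ≠ 0 := by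
    rw [hW.rotPoly_rotPoly_defPoly hA]
    refine mul_ne_zero (neg_ne_zero.2 fun h => ?_) A.defPoly_ne_zero
    rw [C_eq_zero] at h
    exact hh (by exact_mod_cast pow_eq_zero_iff (two_ne_zero) |>.1 h)
  have hNinv : rotPoly A.defPoly ∈ invariantRing W := by
    apply mem_invariantRing_of_reflects hW hA
    intro g hg H hr
    rw [hr.polyAct_rotPoly (A.normal_ne_zero H), hA.polyAct_defPoly hg hr]
    have := rotPoly_C_mul (-1) A.defPoly
    simp at this
    rw [this, neg_neg]
  -- Otherwise `rot` would kill all invariants, among them `rot Q`.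
  have hrot1 : rotPoly (P 1) ≠ 0 := by
    intro h1
    apply hNN
    rw [← mem_rotKer]
    rw [mem_invariantRing_iff_adjoin hP] at hNinv
    refine Algebra.adjoin_le ?_ hNinv
    rintro _ ⟨i, rfl⟩
    fin_cases i
    · exact hrot0
    · exact h1
  -- If `d 1 > h`, the invariant `rot Q` of degree `h` would be a polynomial in `P 0` alone, and
  -- killed by `rot`.
  have hle : d 1 ≤ Fintype.card ι := by
    by_contra hgt
    apply hNN
    rw [← mem_rotKer]
    have hmem := mem_span_of_isHomogeneous hP hd hNinv hN
    have hsub : Submodule.span ℝ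
        {r | ∃ a b : ℕ, d 0 * a + d 1 * b = Fintype.card ι ∧ r = P 0 ^ a * P 1 ^ b}
        ≤ Subalgebra.toSubmodule rotKer := by
      rw [Submodule.span_le]
      rintro r ⟨a, b, hab, rfl⟩
      have hb : b = 0 := by
        by_contra hb
        have : d 1 ≤ d 1 * b := Nat.le_mul_of_pos_right _ (Nat.pos_of_ne_zero hb)
        lia
      subst hb
      exact rotKer.mul_mem (rotKer.pow_mem hrot0 a) (by rw [pow_zero]; exact rotKer.one_mem)
    exact hsub hmem
  have hJ := rotPoly_isHomogeneous (hd 1)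
  have hdvd : A.defPoly ∣ rotPoly (P 1) := by
    apply hA.defPoly_dvd_of_odd
    intro g hg H hr
    rw [hr.polyAct_rotPoly (A.normal_ne_zero H), hinv 1 g hg]
  obtain ⟨heq, c, hc, hcc⟩ := exists_eq_C_mul_of_dvd hQ hJ hrot1 hle hdvd
  -- Here `h = d 1 > d 0 = 2`.
  exact ⟨by lia, ⟨t, ht, hrt⟩, c, hc, hcc⟩

/-- The primitive derivation is proportional to the infinitesimal rotation. -/
theorem primitive_eq_smul_rot {t c : ℝ} (ht : t ≠ 0) (hrad : radial = C t * P 0)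
    (hc : c ≠ 0) (hrot : rotPoly (P 1) = C c * A.defPoly) :
    primitive P = (cst c * toF A.defPoly)⁻¹ • rot := by
  have hpd : ∀ i, C t * pderiv i (P 0) = 2 * X i := fun i => by
    have := congrArg (pderiv i) hrad
    rw [pderiv_C_mul] at this
    rw [← this]
    fin_cases i <;> simp [radial, Derivation.leibniz_pow, pderiv_X]
  have h0 := congrArg toF (hpd 0)
  have h1 := congrArg toF (hpd 1)
  have hr := congrArg toF hrot
  simp only [map_mul, toF_C, map_ofNat, rotPoly, map_sub] at h0 h1 hr
  have ht' : cst t ≠ 0 := fun h => ht (cst_eq_zero.1 h)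
  have hc' : cst c ≠ 0 := fun h => hc (cst_eq_zero.1 h)
  have hQ := A.toF_defPoly_ne_zero
  set x := toF (X 0) with hx
  set y := toF (X 1) with hy
  -- The gradient of `P 0` is `(2 / t)(x₀, x₁)`, so the determinant is `2 / t` times `rot (P 1)`.
  have hdet : (jacobian P).det = 2 * (cst t)⁻¹ * (cst c * toF A.defPoly) := by
    rw [Matrix.det_fin_two]
    simp only [jacobian, Matrix.of_apply]
    apply mul_left_cancel₀ ht'
    field_simp
    linear_combination toF (pderiv 1 (P 1)) * h0 - toF (pderiv 0 (P 1)) * h1 + 2 * hr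
  have e0 : toF (pderiv 0 (P 0)) = 2 * (cst t)⁻¹ * x := by
    field_simp; linear_combination h0
  have e1 : toF (pderiv 1 (P 0)) = 2 * (cst t)⁻¹ * y := by
    field_simp; linear_combination h1
  have two : (2 : Rat2) ≠ 0 := two_ne_zero
  apply derF_ext
  · rw [primitive, ofCoeff_coord, Matrix.inv_def, Ring.inverse_eq_inv', hdet,
      Matrix.adjugate_fin_two, Derivation.smul_apply, rot_coord_zero]
    simp [jacobian, e1, coord, ← hy]
    field_simp
  · rw [primitive, ofCoeff_coord, Matrix.inv_def, Ring.inverse_eq_inv', hdet,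
      Matrix.adjugate_fin_two, Derivation.smul_apply, rot_coord_one]
    simp [jacobian, e0, coord, ← hx]
    field_simp

end BasicInvariants

/-! ### Iterated primitives of the Euler derivation and of a gradient -/

/-- Two sequences of iterated primitives of a pair that satisfies a first order system. -/
theorem exists_primitive_sequences {K V : Type*} [Field K] [AddCommGroup V] [Module K V]
    (nab : V →+ V) (p a b u w : K) (hp : ∀ v, nab (p • v) = v + p • nab v)
    (ha : ∀ v, nab (a • v) = a • nab v) (hb : ∀ v, nab (b • v) = b • nab v)
    (hu : ∀ (k : ℤ) v, nab ((k + u) • v) = (k + u) • nab v)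
    (hw : ∀ (k : ℤ) v, nab ((k + w) • v) = (k + w) • nab v)
    (hu0 : ∀ k : ℤ, (k : K) + u ≠ 0) (hw0 : ∀ k : ℤ, (k : K) + w ≠ 0) (E₀ G₀ : V)
    (hE : p • nab E₀ = u • E₀ + a • nab G₀) (hG : p • nab G₀ = w • G₀ + b • nab E₀) :
    ∃ E G : ℤ → V, E 0 = E₀ ∧ G 0 = G₀ ∧ (∀ k, nab (E (k + 1)) = E k) ∧
      (∀ k, nab (G (k + 1)) = G k) ∧
      (∀ k : ℤ, p • E k = ((k + 1 : ℤ) + u) • E (k + 1) + a • G k) ∧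
      ∀ k : ℤ, p • G k = ((k + 1 : ℤ) + w) • G (k + 1) + b • E k := by
  -- Upwards the relations are solved for the terms of index `n + 1`; that `nab` takes these back to
  -- index `n` is `posd`, by differentiating the relations and using them once more.
  let pos : ℕ → V × V := fun n => Nat.rec (E₀, G₀) (fun n q =>
    ((((n + 1 : ℤ) : K) + u)⁻¹ • (p • q.1 - a • q.2),
      (((n + 1 : ℤ) : K) + w)⁻¹ • (p • q.2 - b • q.1))) n
  have pos1 : ∀ n : ℕ, p • (pos n).1 = ((n + 1 : ℤ) + u) • (pos (n + 1)).1 + a • (pos n).2 := by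
    intro n
    change _ = _ • ((((n + 1 : ℤ) : K) + u)⁻¹ • (p • (pos n).1 - a • (pos n).2)) + _
    rw [smul_inv_smul₀ (hu0 _)]; abel
  have pos2 : ∀ n : ℕ, p • (pos n).2 = ((n + 1 : ℤ) + w) • (pos (n + 1)).2 + b • (pos n).1 := by
    intro n
    change _ = _ • ((((n + 1 : ℤ) : K) + w)⁻¹ • (p • (pos n).2 - b • (pos n).1)) + _
    rw [smul_inv_smul₀ (hw0 _)]; abel
  have posd : ∀ n : ℕ, nab (pos (n + 1)).1 = (pos n).1 ∧ nab (pos (n + 1)).2 = (pos n).2 := by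
    intro n
    induction n with
    | zero =>
      have e1 := congrArg nab (pos1 0)
      have e2 := congrArg nab (pos2 0)
      rw [hp, map_add, hu, ha] at e1
      rw [hp, map_add, hw, hb] at e2
      change E₀ + p • nab E₀ = _ + a • nab G₀ at e1
      change G₀ + p • nab G₀ = _ + b • nab E₀ at e2
      constructor
      · apply smul_right_injective V (hu0 ((0 : ℕ) + 1 : ℤ))
        change _ = _ • E₀
        rw [hE] at e1
        push_cast at e1 ⊢
        linear_combination (norm := module) -(1 : K) • e1
      · apply smul_right_injective V (hw0 ((0 : ℕ) + 1 : ℤ))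
        change _ = _ • G₀
        rw [hG] at e2
        push_cast at e2 ⊢
        linear_combination (norm := module) -(1 : K) • e2
    | succ n ih =>
      have e1 := congrArg nab (pos1 (n + 1))
      have e2 := congrArg nab (pos2 (n + 1))
      rw [hp, map_add, hu, ha, ih.1, ih.2, pos1] at e1
      rw [hp, map_add, hw, hb, ih.1, ih.2, pos2] at e2
      constructor
      · apply smul_right_injective V (hu0 ((n + 1 : ℕ) + 1 : ℤ))
        push_cast at e1 ⊢
        linear_combination (norm := module) -(1 : K) • e1
      · apply smul_right_injective V (hw0 ((n + 1 : ℕ) + 1 : ℤ))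
        push_cast at e2 ⊢
        linear_combination (norm := module) -(1 : K) • e2
  -- Downwards the terms are iterates of `nab`. Since `nab (p v) = v + p nab v`, each
  -- differentiation lowers the scalar by one.
  have neg : ∀ n : ℕ, p • nab^[n + 1] E₀ = ((-n : ℤ) + u) • nab^[n] E₀ + a • nab^[n + 1] G₀ ∧
      p • nab^[n + 1] G₀ = ((-n : ℤ) + w) • nab^[n] G₀ + b • nab^[n + 1] E₀ := by
    intro n
    induction n with
    | zero => simpa using ⟨hE, hG⟩
    | succ n ih =>
      have e1 := congrArg nab ih.1
      have e2 := congrArg nab ih.2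
      rw [hp, map_add, hu, ha] at e1
      rw [hp, map_add, hw, hb] at e2
      simp only [← Function.iterate_succ_apply' nab] at e1 e2
      push_cast at e1 e2 ⊢
      constructor
      · linear_combination (norm := module) (1 : K) • e1
      · linear_combination (norm := module) (1 : K) • e2
  let E : ℤ → V := fun k => match k with
    | Int.ofNat n => (pos n).1
    | Int.negSucc n => nab^[n + 1] E₀
  let G : ℤ → V := fun k => match k with
    | Int.ofNat n => (pos n).2
    | Int.negSucc n => nab^[n + 1] G₀
  have En : ∀ n : ℕ, E (-n) = nab^[n] E₀ := fun n => by cases n <;> rfl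
  have Gn : ∀ n : ℕ, G (-n) = nab^[n] G₀ := fun n => by cases n <;> rfl
  have split : ∀ k : ℤ, (∃ n : ℕ, k = n ∧ k + 1 = (n + 1 : ℕ)) ∨
      ∃ n : ℕ, k = -((n + 1 : ℕ) : ℤ) ∧ k + 1 = -(n : ℤ) := fun k => by
    rcases le_or_gt 0 k with h | h
    · exact Or.inl ⟨k.toNat, by lia, by lia⟩
    · exact Or.inr ⟨(-k - 1).toNat, by lia, by lia⟩
  refine ⟨E, G, rfl, rfl, fun k => ?_, fun k => ?_, fun k => ?_, fun k => ?_⟩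
  all_goals
    rcases split k with ⟨n, h, h'⟩ | ⟨n, h, h'⟩
    all_goals rw [h', h]
  · exact (posd n).1
  · rw [En, En, Function.iterate_succ_apply']
  · exact (posd n).2
  · rw [Gn, Gn, Function.iterate_succ_apply']
  · exact pos1 n
  · rw [En, En, Gn]; exact (neg n).1
  · exact pos2 n
  · rw [Gn, Gn, En]; exact (neg n).2

theorem pderiv_comm (i j : Fin 2) (p : Poly) :
    pderiv i (pderiv j p) = pderiv j (pderiv i p) := by
  induction p using MvPolynomial.induction_on with
  | C a => simp
  | add p q hp hq => simp only [map_add, hp, hq]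
  | mul_X p k hp =>
    simp only [Derivation.leibniz, map_add, smul_eq_mul, hp, pderiv_X]
    have h : ∀ l m, pderiv l (Pi.single (M := fun _ => Poly) m 1 k) = 0 := fun l m => by
      rcases eq_or_ne m k with rfl | h
      · simp
      · simp [Pi.single_eq_of_ne h.symm]
    rw [h, h]; ring

theorem rotPoly_pderiv_zero (p : Poly) :
    rotPoly (pderiv 0 p) = pderiv 0 (rotPoly p) - pderiv 1 p := by
  simp only [rotPoly, map_sub, Derivation.leibniz, smul_eq_mul, pderiv_comm 1 0 p]
  simp [pderiv_X]
  ring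

theorem rotPoly_pderiv_one (p : Poly) :
    rotPoly (pderiv 1 p) = pderiv 1 (rotPoly p) + pderiv 0 p := by
  simp only [rotPoly, map_sub, Derivation.leibniz, smul_eq_mul, pderiv_comm 0 1 p]
  simp [pderiv_X]
  ring

/-- `∇_θ` as an `ℝ`-linear map. -/
def nablaLin (θ : DerF) : DerF →ₗ[ℝ] DerF where
  toFun := nabla θ
  map_add' η φ := by apply derF_ext <;> simp
  map_smul' r η := by apply derF_ext <;> simp

theorem nabla_add (θ η φ : DerF) : nabla θ (η + φ) = nabla θ η + nabla θ φ :=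
  (nablaLin θ).map_add η φ

theorem nabla_smul (θ η : DerF) (f : Rat2) : nabla θ (f • η) = θ f • η + f • nabla θ η := by
  apply derF_ext <;> simp <;> ring

namespace LineArrangement

variable {ι : Type*} [Fintype ι] (A : LineArrangement ι)

/-- The invariant of degree `h` obtained by rotating `Q` infinitesimally. -/
def rotDefPoly : Poly := rotPoly A.defPoly

/-- The gradient of the invariant of degree `h`. -/
def gradDer : DerF :=
  ofCoeff ![toF (pderiv 0 A.rotDefPoly), toF (pderiv 1 A.rotDefPoly)]

/-- The squared length of the gradient of the invariant of degree `h`. -/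
def gradSq : Poly := pderiv 0 A.rotDefPoly ^ 2 + pderiv 1 A.rotDefPoly ^ 2

/-- The invariant of degree `h` on which `primDer c` takes the value one. -/
def potential (c : ℝ) : Poly := C (-(c / (Fintype.card ι : ℝ) ^ 2)) * A.rotDefPoly

/-- The derivation `(c Q)⁻¹ (x₀ ∂/∂x₁ - x₁ ∂/∂x₀)`. -/
def primDer (c : ℝ) : DerF := (cst c * toF A.defPoly)⁻¹ • rot

/-- The arrangement consists of the `h > 2` lines spanned by the zeros of a binary form of
degree `h` that is an eigenvector for infinitesimal rotations, i.e. of the mirrors of a dihedral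
group. -/
structure IsDihedral : Prop where
  two_lt_card : 2 < Fintype.card ι
  rotPoly_rotDefPoly :
    rotPoly A.rotDefPoly = -C ((Fintype.card ι : ℝ) ^ 2) * A.defPoly

@[simp] theorem gradDer_coord_zero :
    A.gradDer (coord 0) = toF (pderiv 0 A.rotDefPoly) := by simp [gradDer]

@[simp] theorem gradDer_coord_one :
    A.gradDer (coord 1) = toF (pderiv 1 A.rotDefPoly) := by simp [gradDer]

theorem primDer_apply (c : ℝ) (f : Rat2) :
    A.primDer c f = (cst c * toF A.defPoly)⁻¹ * rot f := rfl

/-- The iterated primitives of the Euler derivation and of the gradient of the invariant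
of degree `h`. -/
structure IsPrimitiveSystem (c : ℝ) (E G : ℤ → DerF) : Prop where
  E_zero : E 0 = euler
  G_zero : G 0 = A.gradDer
  nabla_E : ∀ k, nabla (A.primDer c) (E (k + 1)) = E k
  nabla_G : ∀ k, nabla (A.primDer c) (G (k + 1)) = G k
  rel_E : ∀ k : ℤ, toF (A.potential c) • E k
    = cst (k + 1 + 1 / Fintype.card ι) • E (k + 1)
      + (cst (c / ((Fintype.card ι : ℝ) ^ 3 * (Fintype.card ι - 1))) * toF radial) • G k
  rel_G : ∀ k : ℤ, toF (A.potential c) • G k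
    = cst (k + 1 + (Fintype.card ι - 1) / Fintype.card ι) • G (k + 1)
      + (cst (c * (Fintype.card ι - 1) / (Fintype.card ι : ℝ) ^ 3) * toF A.gradSq) • E k

theorem rotDefPoly_isHomogeneous : A.rotDefPoly.IsHomogeneous (Fintype.card ι) :=
  rotPoly_isHomogeneous A.defPoly_isHomogeneous

theorem euler_rotDefPoly : X 0 * pderiv 0 A.rotDefPoly + X 1 * pderiv 1 A.rotDefPoly
    = C (Fintype.card ι : ℝ) * A.rotDefPoly := by
  rw [euler_identity A.rotDefPoly_isHomogeneous, map_natCast]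

variable {A}

namespace IsDihedral

variable (hD : A.IsDihedral)
include hD

theorem card_pos : (0 : ℝ) < Fintype.card ι := by
  have := hD.two_lt_card
  exact_mod_cast (by lia : 0 < Fintype.card ι)

theorem card_sub_one_pos : (0 : ℝ) < Fintype.card ι - 1 := by
  have : (2 : ℝ) < Fintype.card ι := by exact_mod_cast hD.two_lt_card
  linarith

theorem rot_rotDefPoly : X 0 * pderiv 1 A.rotDefPoly - X 1 * pderiv 0 A.rotDefPoly
    = -C (Fintype.card ι : ℝ) ^ 2 * A.defPoly := by
  have := hD.rotPoly_rotDefPoly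
  rw [map_pow] at this
  exact this

/-- A Cauchy–Riemann equation: `Q` and `N / h` are conjugate harmonic functions. The Euler and
rotation equations of `Q` and `N` determine both gradients after multiplication by `x₀² + x₁²`. -/
theorem pderiv_zero_rotDefPoly :
    pderiv 0 A.rotDefPoly = C (Fintype.card ι : ℝ) * pderiv 1 A.defPoly := by
  apply mul_left_cancel₀ radial_ne_zero
  have h1 := euler_identity A.defPoly_isHomogeneous
  have h2 : X 0 * pderiv 1 A.defPoly - X 1 * pderiv 0 A.defPoly = A.rotDefPoly := rfl
  have h3 := A.euler_rotDefPoly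
  have h4 := hD.rot_rotDefPoly
  rw [← map_natCast (C : ℝ →+* Poly)] at h1
  unfold radial
  linear_combination X 0 * h3 - X 1 * h4 - C (Fintype.card ι : ℝ) * (X 1 * h1 + X 0 * h2)

theorem pderiv_one_rotDefPoly :
    pderiv 1 A.rotDefPoly = -C (Fintype.card ι : ℝ) * pderiv 0 A.defPoly := by
  apply mul_left_cancel₀ radial_ne_zero
  have h1 := euler_identity A.defPoly_isHomogeneous
  have h2 : X 0 * pderiv 1 A.defPoly - X 1 * pderiv 0 A.defPoly = A.rotDefPoly := rfl
  have h3 := A.euler_rotDefPoly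
  have h4 := hD.rot_rotDefPoly
  rw [← map_natCast (C : ℝ →+* Poly)] at h1
  unfold radial
  linear_combination X 1 * h3 + X 0 * h4 + C (Fintype.card ι : ℝ) * (X 0 * h1 - X 1 * h2)

theorem rotPoly_pderiv_zero_rotDefPoly : rotPoly (pderiv 0 A.rotDefPoly)
    = C (Fintype.card ι - 1 : ℝ) * pderiv 1 A.rotDefPoly := by
  rw [rotPoly_pderiv_zero, hD.rotPoly_rotDefPoly, ← C_neg, pderiv_C_mul]
  have := hD.pderiv_one_rotDefPoly
  simp only [map_sub, map_pow, map_neg, C_1]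
  linear_combination -C (Fintype.card ι : ℝ) * this

theorem rotPoly_pderiv_one_rotDefPoly : rotPoly (pderiv 1 A.rotDefPoly)
    = -C (Fintype.card ι - 1 : ℝ) * pderiv 0 A.rotDefPoly := by
  rw [rotPoly_pderiv_one, hD.rotPoly_rotDefPoly, ← C_neg, pderiv_C_mul]
  have := hD.pderiv_zero_rotDefPoly
  simp only [map_sub, map_pow, map_neg, C_1]
  linear_combination C (Fintype.card ι : ℝ) * this

/-- The infinitesimal rotation turns the gradient of `N` by a right angle, up to the factor `h - 1`,
and so preserves its length. -/
theorem gradSq_mem_rotKer : A.gradSq ∈ rotKer := by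
  rw [mem_rotKer, gradSq, rotPoly_add, sq, sq, rotPoly_mul, rotPoly_mul,
    hD.rotPoly_pderiv_zero_rotDefPoly, hD.rotPoly_pderiv_one_rotDefPoly]
  ring

/-- Lagrange's identity `|x|² |v|² = (x · v)² + (x × v)²` for `v` the gradient of `N`, with `x · v =
h N` and `x × v = rot N = -h² Q`. -/
theorem radial_mul_gradSq : radial * A.gradSq = C (Fintype.card ι : ℝ) ^ 2 *
    (A.rotDefPoly ^ 2 + C (Fintype.card ι : ℝ) ^ 2 * A.defPoly ^ 2) := by
  have h3 := A.euler_rotDefPoly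
  have h4 := hD.rot_rotDefPoly
  have : radial * A.gradSq = (X 0 * pderiv 0 A.rotDefPoly + X 1 * pderiv 1 A.rotDefPoly) ^ 2
      + (X 0 * pderiv 1 A.rotDefPoly - X 1 * pderiv 0 A.rotDefPoly) ^ 2 := by
    unfold radial gradSq; ring
  rw [this, h3, h4]; ring

theorem rotPoly_potential (c : ℝ) : rotPoly (A.potential c) = C c * A.defPoly := by
  rw [potential, rotPoly_C_mul, hD.rotPoly_rotDefPoly, ← C_neg, ← mul_assoc, ← map_mul]
  congr 2
  have := hD.card_pos.ne'
  field_simp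

variable {c : ℝ} (hc : c ≠ 0)

omit hD in
include hc in
theorem cst_mul_defPoly_ne_zero : cst c * toF A.defPoly ≠ 0 :=
  mul_ne_zero (fun h => hc (cst_eq_zero.1 h)) A.toF_defPoly_ne_zero

omit hD in
theorem primDer_toF_of_mem_rotKer {p : Poly} (hp : p ∈ rotKer) : A.primDer c (toF p) = 0 := by
  rw [primDer_apply, rot_toF, mem_rotKer.1 hp, map_zero, mul_zero]

include hc in
theorem primDer_potential : A.primDer c (toF (A.potential c)) = 1 := by
  rw [primDer_apply, rot_toF, hD.rotPoly_potential, map_mul, toF_C,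
    inv_mul_cancel₀ (cst_mul_defPoly_ne_zero hc)]

include hc in
-- Up to scalar functions, `∇_D E₀` and `∇_D G₀` are the position vector and the gradient of `N`,
-- each turned by a right angle. The relation expresses the position vector through these two; it
-- amounts to the Euler and rotation equations of `N`.
theorem potential_smul_nabla_euler : toF (A.potential c) • nabla (A.primDer c) euler
    = cst (1 / Fintype.card ι) • euler
      + (cst (c / ((Fintype.card ι : ℝ) ^ 3 * (Fintype.card ι - 1))) * toF radial) •
        nabla (A.primDer c) A.gradDer := by
  have hQ := A.toF_defPoly_ne_zero
  have hc' : cst c ≠ 0 := fun h => hc (cst_eq_zero.1 h)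
  have hh : cst (Fintype.card ι) ≠ 0 := fun h => hD.card_pos.ne' (cst_eq_zero.1 h)
  have hh1 : cst (Fintype.card ι) - 1 ≠ 0 := fun h =>
    hD.card_sub_one_pos.ne' (cst_eq_zero.1 (by rw [map_sub, map_one, h]))
  have h3 := congrArg toF A.euler_rotDefPoly
  have h4 := congrArg toF hD.rot_rotDefPoly
  simp only [map_add, map_sub, map_mul, map_neg, map_pow, toF_C] at h3 h4
  apply derF_ext
  all_goals
    simp only [Derivation.add_apply, Derivation.smul_apply, nabla_coord, euler_coord,
      gradDer_coord_zero, gradDer_coord_one, primDer_apply, rot_coord_zero, rot_coord_one, rot_toF]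
    simp only [coord,
      hD.rotPoly_pderiv_zero_rotDefPoly, hD.rotPoly_pderiv_one_rotDefPoly, potential, radial,
      map_mul, map_add, map_sub, map_neg, map_div₀, map_pow, toF_C, map_one, smul_eq_mul]
    field_simp
  · linear_combination -toF (X 1) * h3 - toF (X 0) * h4
  · linear_combination toF (X 0) * h3 - toF (X 1) * h4

include hc in
theorem potential_smul_nabla_gradDer : toF (A.potential c) • nabla (A.primDer c) A.gradDer
    = cst ((Fintype.card ι - 1) / Fintype.card ι) • A.gradDer
      + (cst (c * (Fintype.card ι - 1) / (Fintype.card ι : ℝ) ^ 3) * toF A.gradSq) •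
        nabla (A.primDer c) euler := by
  have hQ := A.toF_defPoly_ne_zero
  have hc' : cst c ≠ 0 := fun h => hc (cst_eq_zero.1 h)
  have hh : cst (Fintype.card ι) ≠ 0 := fun h => hD.card_pos.ne' (cst_eq_zero.1 h)
  have h3 := congrArg toF A.euler_rotDefPoly
  have h4 := congrArg toF hD.rot_rotDefPoly
  simp only [map_add, map_sub, map_mul, map_neg, map_pow, toF_C] at h3 h4
  apply derF_ext
  all_goals
    simp only [Derivation.add_apply, Derivation.smul_apply, nabla_coord, euler_coord,
      gradDer_coord_zero, gradDer_coord_one, primDer_apply, rot_coord_zero, rot_coord_one, rot_toF]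
    simp only [coord,
      hD.rotPoly_pderiv_zero_rotDefPoly, hD.rotPoly_pderiv_one_rotDefPoly, potential, gradSq,
      map_mul, map_add, map_sub, map_neg, map_div₀, map_pow, toF_C, map_one, smul_eq_mul]
    field_simp
  · linear_combination (cst (Fintype.card ι) - 1) *
      (toF (pderiv 1 A.rotDefPoly) * h3 - toF (pderiv 0 A.rotDefPoly) * h4)
  · linear_combination -(cst (Fintype.card ι) - 1) *
      (toF (pderiv 0 A.rotDefPoly) * h3 + toF (pderiv 1 A.rotDefPoly) * h4)

omit hD in
theorem int_add_inv_ne_zero {n : ℝ} (hn : 1 < n) (k : ℤ) : (k : ℝ) + 1 / n ≠ 0 := by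
  intro h
  have h0 : 0 < 1 / n := by positivity
  have h1 : 1 / n < 1 := by rw [div_lt_one (by linarith)]; exact hn
  have h2 : (k : ℝ) < 0 := by linarith
  have h3 : (-1 : ℝ) < k := by linarith
  have h2' : k < 0 := by exact_mod_cast h2
  have h3' : -1 < k := by exact_mod_cast h3
  lia

theorem coeff_E_ne_zero (k : ℤ) : (k : ℝ) + 1 / Fintype.card ι ≠ 0 :=
  int_add_inv_ne_zero (by linarith [hD.card_sub_one_pos]) k

/-- As `(h-1)/h = 1 - 1/h`, this scalar is minus the one of `coeff_E_ne_zero` at `-k - 1`. -/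
theorem coeff_G_ne_zero (k : ℤ) :
    (k : ℝ) + ((Fintype.card ι : ℝ) - 1) / Fintype.card ι ≠ 0 := by
  intro h
  apply hD.coeff_E_ne_zero (-k - 1)
  have := hD.card_pos.ne'
  push_cast
  field_simp at h ⊢
  linarith

include hc in
theorem exists_primitiveSystem : ∃ E G, A.IsPrimitiveSystem c E G := by
  have key : ∀ (r : ℝ) (p : Poly), p ∈ rotKer → ∀ v,
      nabla (A.primDer c) ((cst r * toF p) • v) = (cst r * toF p) • nabla (A.primDer c) v := by
    intro r p hp v
    rw [nabla_smul, der_cst_mul, primDer_toF_of_mem_rotKer hp, mul_zero, zero_smul, zero_add]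
  have key2 : ∀ (k : ℤ) (r : ℝ) v, nabla (A.primDer c) (((k : Rat2) + cst r) • v)
      = ((k : Rat2) + cst r) • nabla (A.primDer c) v := by
    intro k r v
    have : (k : Rat2) + cst r = cst (k + r) := by simp
    rw [this, nabla_smul, Derivation.map_algebraMap, zero_smul, zero_add]
  have key3 : ∀ (r : ℝ), (∀ k : ℤ, (k : ℝ) + r ≠ 0) → ∀ k : ℤ, (k : Rat2) + cst r ≠ 0 := by
    intro r hr k h
    apply hr k
    apply cst_eq_zero.1
    rw [← h]; simp
  obtain ⟨E, G, h1, h2, h3, h4, h5, h6⟩ := exists_primitive_sequences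
    (nablaLin (A.primDer c)).toAddMonoidHom (toF (A.potential c)) _ _ _ _
    (fun v => by
      change nabla _ _ = v + _ • nabla _ v
      rw [nabla_smul, hD.primDer_potential hc, one_smul])
    (key _ _ radial_mem_rotKer) (key _ _ hD.gradSq_mem_rotKer)
    (fun k v => key2 k _ v) (fun k v => key2 k _ v)
    (key3 _ hD.coeff_E_ne_zero) (key3 _ hD.coeff_G_ne_zero)
    euler A.gradDer (hD.potential_smul_nabla_euler hc) (hD.potential_smul_nabla_gradDer hc)
  refine ⟨E, G, h1, h2, h3, h4, fun k => ?_, fun k => ?_⟩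
  · have := h5 k
    rw [this]
    congr 2
    simp
  · have := h6 k
    rw [this]
    congr 2
    simp

end IsDihedral

end LineArrangement

/-! ### Invariance -/

theorem smul_mem_invariantDer {W : Subgroup O2} {f : Rat2} (hf : ∀ g ∈ W, fieldAct g f = f)
    {θ : DerF} (hθ : θ ∈ invariantDer W) : f • θ ∈ invariantDer W := fun g hg x => by
  rw [Derivation.smul_apply, Derivation.smul_apply, smul_eq_mul, smul_eq_mul, map_mul, hf g hg,
    hθ g hg]

theorem X_eq_lin (i : Fin 2) : (X i : Poly) = lin (Pi.single i 1) := by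
  fin_cases i <;> simp [lin]

theorem nabla_mem_invariantDer {W : Subgroup O2} {θ η : DerF} (hθ : θ ∈ invariantDer W)
    (hη : η ∈ invariantDer W) : nabla θ η ∈ invariantDer W := fun g hg => by
  apply fieldAct_der_of_coord
  intro i
  rw [nabla_coord, hθ g hg, hη g hg, coord, X_eq_lin, fieldAct_algebraMap, polyAct_lin, nabla_lin]

theorem fieldAct_toF_of_mem {W : Subgroup O2} {p : Poly} (hp : p ∈ invariantRing W) :
    ∀ g ∈ W, fieldAct g (toF p) = toF p := fun g hg => by
  rw [fieldAct_algebraMap, hp g hg]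

theorem C_mul_mem_invariantRing {W : Subgroup O2} (c : ℝ) {p : Poly} (hp : p ∈ invariantRing W) :
    C c * p ∈ invariantRing W :=
  (invariantRing W).mul_mem ((invariantRing W).algebraMap_mem c) hp

section Coxeter

variable {W : Subgroup O2} {ι : Type*} [Fintype ι] {A : LineArrangement ι}
  (hW : IsCoxeterGroup W) (hA : IsCoxeterArrangement W A)

include hW hA

theorem primDer_mem_invariantDer (c : ℝ) : A.primDer c ∈ invariantDer W := by
  apply mem_invariantDer_of_reflects hW hA
  intro g hg H hr f
  rw [A.primDer_apply, A.primDer_apply, map_mul, map_inv₀, map_mul, fieldAct_cst,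
    hr.fieldAct_rot (A.normal_ne_zero H), fieldAct_algebraMap, hA.polyAct_defPoly hg hr, map_neg,
    mul_neg, mul_neg, inv_neg, neg_mul, neg_neg]

theorem rotDefPoly_mem_invariantRing : A.rotDefPoly ∈ invariantRing W := by
  apply mem_invariantRing_of_reflects hW hA
  intro g hg H hr
  have := rotPoly_C_mul (-1) A.defPoly
  simp only [map_neg, C_1, neg_mul, one_mul] at this
  rw [LineArrangement.rotDefPoly, hr.polyAct_rotPoly (A.normal_ne_zero H),
    hA.polyAct_defPoly hg hr, this, neg_neg]

theorem defPoly_sq_mem_invariantRing : A.defPoly ^ 2 ∈ invariantRing W := by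
  apply mem_invariantRing_of_reflects hW hA
  intro g hg H hr
  rw [map_pow, hA.polyAct_defPoly hg hr, neg_sq]

theorem potential_mem_invariantRing (c : ℝ) : A.potential c ∈ invariantRing W :=
  C_mul_mem_invariantRing _ (rotDefPoly_mem_invariantRing hW hA)

/-- Its product with the invariant `radial` is invariant by `radial_mul_gradSq`, and `radial`
cancels. -/
theorem gradSq_mem_invariantRing (hD : A.IsDihedral) : A.gradSq ∈ invariantRing W := by
  intro g hg
  apply mul_left_cancel₀ radial_ne_zero
  have hmem : radial * A.gradSq ∈ invariantRing W := by
    rw [hD.radial_mul_gradSq, ← map_pow]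
    exact C_mul_mem_invariantRing _ ((invariantRing W).add_mem
      ((invariantRing W).pow_mem (rotDefPoly_mem_invariantRing hW hA) 2)
      (C_mul_mem_invariantRing _ (defPoly_sq_mem_invariantRing hW hA)))
  have := hmem g hg
  rwa [map_mul, radial_mem_invariantRing g hg] at this

theorem gradDer_mem_invariantDer (hD : A.IsDihedral) : A.gradDer ∈ invariantDer W := by
  have h0 : toF radial ≠ 0 := fun h => radial_ne_zero (toF_eq_zero.1 h)
  have hQ := A.toF_defPoly_ne_zero
  have h3 := congrArg toF A.euler_rotDefPoly
  have h4 := congrArg toF hD.rot_rotDefPoly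
  simp only [map_add, map_sub, map_mul, map_neg, map_pow, toF_C] at h3 h4
  -- The gradient is decomposed into radial and rotational components, `h N` and `rot N = -h² Q`;
  -- all ingredients on the right are visibly invariant.
  have e : A.gradDer = (toF radial)⁻¹ • (toF (C (Fintype.card ι : ℝ) * A.rotDefPoly) • euler
      - toF (C (Fintype.card ι : ℝ) ^ 2 * A.defPoly ^ 2) • nabla (A.primDer 1) euler) := by
    apply derF_ext
    all_goals
      simp only [Derivation.sub_apply, Derivation.smul_apply, nabla_coord, euler_coord,
        A.gradDer_coord_zero, A.gradDer_coord_one, A.primDer_apply, rot_coord_zero, rot_coord_one,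
        smul_eq_mul, map_one, one_mul]
      field_simp
      simp only [radial, map_mul, map_pow, map_add, toF_C, coord]
    · linear_combination toF A.defPoly * (toF (X 0) * h3 - toF (X 1) * h4)
    · linear_combination toF A.defPoly * (toF (X 1) * h3 + toF (X 0) * h4)
  rw [e]
  apply smul_mem_invariantDer
  · intro g hg
    rw [map_inv₀, fieldAct_toF_of_mem radial_mem_invariantRing g hg]
  · apply sub_mem
    · exact smul_mem_invariantDer (fieldAct_toF_of_mem
        (C_mul_mem_invariantRing _ (rotDefPoly_mem_invariantRing hW hA)))
        (euler_mem_invariantDer W)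
    · rw [← map_pow C]
      exact smul_mem_invariantDer (fieldAct_toF_of_mem
        (C_mul_mem_invariantRing _ (defPoly_sq_mem_invariantRing hW hA)))
        (nabla_mem_invariantDer (primDer_mem_invariantDer hW hA 1) (euler_mem_invariantDer W))

end Coxeter

theorem LineArrangement.IsDihedral.of_coxeter {W : Subgroup O2} {ι : Type*} [Fintype ι]
    {A : LineArrangement ι} (hW : IsCoxeterGroup W) (hA : IsCoxeterArrangement W A)
    (h : 2 < Fintype.card ι) : A.IsDihedral :=
  ⟨h, hW.rotPoly_rotPoly_defPoly hA⟩

/-! ### Multiplicities of invariant derivations under the primitive derivation -/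

theorem ordGe_rot_coord {a : Poly} (ha : Prime a) (i : Fin 2) : OrdGe a 0 (rot (coord i)) := by
  rw [coord, rot_toF]; exact ordGe_toF ha _

namespace LineArrangement

variable {ι : Type*} [Fintype ι] {A : LineArrangement ι}

theorem ordGe_inv_defPoly (c : ℝ) (H : ι) :
    OrdGe (A.form H) (-1) (cst c * toF A.defPoly)⁻¹ := by
  rw [mul_inv, ← zpow_neg_one (toF A.defPoly), ← map_inv₀]
  exact (A.ordGe_defPoly_zpow H (-1)).cst_mul (A.form_prime H) _

theorem ordGe_inv_defPoly_of_not_dvd (c : ℝ) {a : Poly} (ha : Prime a)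
    (h : ∀ H, ¬ a ∣ A.form H) : OrdGe a 0 (cst c * toF A.defPoly)⁻¹ := by
  rw [mul_inv, ← map_inv₀]
  exact (ordGe_inv (A.not_dvd_defPoly ha h)).cst_mul ha _

variable {W : Subgroup O2} (hA : IsCoxeterArrangement W A)
include hA

/-- The primitive derivation lowers the multiplicity of an invariant derivation by two. -/
theorem nabla_primDer_mem_logDer (c : ℝ) {θ : DerF} (hinv : θ ∈ invariantDer W) {j : ℤ}
    (hθ : θ ∈ A.logDer fun _ => j) : nabla (A.primDer c) θ ∈ A.logDer fun _ => j - 2 := by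
  rw [mem_logDer_iff] at hθ ⊢
  refine ⟨fun a ha h i => ?_, fun H => ?_, fun H => ?_⟩
  · rw [nabla_coord, primDer_apply]
    exact (ordGe_inv_defPoly_of_not_dvd c ha h).mul_eq ha
      ((hθ.1 a ha h i).der_zero ha (ordGe_rot_coord ha)) (add_zero 0)
  all_goals
    have hα := A.form_prime H
    have hn := A.normal_ne_zero H
    obtain ⟨g, hg, -, -, hr⟩ := hA.exists_reflects H
  · have h1 := (hθ.2.1 H).der_zero hα (ordGe_rot_coord hα)
    rw [perpForm_eq_lin] at h1 ⊢
    -- The component `θ(β_H)` is even, so its rotation derivative is odd and vanishes on `H`; this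
    -- cancels the simple pole of `1 / Q`.
    have hodd : fieldAct g (rot (θ (toF (lin (perp (A.normal H))))))
        = -rot (θ (toF (lin (perp (A.normal H))))) := by
      rw [hr.fieldAct_rot hn, hinv g hg, hr.fieldAct_perp]
    have h2 := hr.ordGe_succ_of_odd hn hodd (by simp) h1
    rw [nabla_lin, primDer_apply]
    exact (ordGe_inv_defPoly c H).mul_eq hα h2 (by simp)
  · have h1 := OrdGe.der hα (ordGe_rot_coord hα) (by lia)
      (ordGe_der_toF hα (ordGe_rot_coord hα) _) (hθ.2.2 H)
    rw [form_eq_lin, nabla_lin, primDer_apply]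
    exact (ordGe_inv_defPoly c H).mul_eq hα h1 (by ring)

/-- Conversely, the multiplicity of an invariant derivation is determined by that of its image. -/
theorem mem_logDer_of_nabla_primDer {c : ℝ} (hc : c ≠ 0) {θ : DerF} (hinv : θ ∈ invariantDer W)
    {i j : ℤ} (hθ : θ ∈ A.logDer fun _ => i)
    (h : nabla (A.primDer c) θ ∈ A.logDer fun _ => j - 2) : θ ∈ A.logDer fun _ => j := by
  rw [mem_logDer_iff] at hθ h ⊢
  refine ⟨hθ.1, hθ.2.1, fun H => ?_⟩
  have hα := A.form_prime H
  have hn := A.normal_ne_zero H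
  obtain ⟨g, hg, -, -, hr⟩ := hA.exists_reflects H
  have hdQ := h.2.2 H
  rw [form_eq_lin, nabla_lin, primDer_apply] at hdQ
  have hd : OrdGe (A.form H) (j - 1) (rot (θ (toF (A.form H)))) := by
    have h1 := OrdGe.mul_eq hα ((A.ordGe_defPoly_zpow H 1).cst_mul hα c) hdQ
      (show 1 + (j - 2) = j - 1 by ring)
    rwa [zpow_one, mul_inv_cancel_left₀ (IsDihedral.cst_mul_defPoly_ne_zero hc)] at h1
  have hodd : fieldAct g (θ (toF (A.form H))) = -θ (toF (A.form H)) := by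
    rw [hinv g hg, form_eq_lin, hr.fieldAct_lin, map_neg]
  have hrα : rot (toF (A.form H)) = -toF (A.perpForm H) := by
    rw [form_eq_lin, rot_lin, ← perpForm_eq_lin]
  have hβ := A.form_not_dvd_perpForm H
  -- An even lower bound improves by one because `θ(α_H)` is odd. An odd one is nonzero and improves
  -- through the derivative, since `rot α_H = -β_H` does not vanish identically on `H`.
  have step : ∀ k, k < j → OrdGe (A.form H) k (θ (toF (A.form H))) →
      OrdGe (A.form H) (k + 1) (θ (toF (A.form H))) := by
    intro k hk ho
    rcases Int.even_or_odd k with he | he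
    · exact hr.ordGe_succ_of_odd hn hodd he ho
    · refine OrdGe.succ_of_der hα (ordGe_rot_coord hα) (fun h0 => ?_) ?_ ?_ ho (hd.mono hα (by lia))
      · subst h0; simp at he
      · rw [hrα, inv_neg]; exact (ordGe_inv hβ).neg
      · rw [hrα, neg_ne_zero]
        exact fun h0 => hβ (by rw [toF_eq_zero.1 h0]; exact dvd_zero _)
  have climb : ∀ n : ℕ, i + n ≤ j → OrdGe (A.form H) (i + n) (θ (toF (A.form H))) := by
    intro n
    induction n with
    | zero => intro _; simpa using hθ.2.2 H
    | succ n ih =>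
      intro hn
      push_cast at hn ⊢
      have := step (i + n) (by lia) (ih (by lia))
      rwa [add_assoc] at this
  rcases le_total i j with hij | hij
  · have := climb (j - i).toNat (by lia)
    rwa [show i + ((j - i).toNat : ℤ) = j by lia] at this
  · exact (hθ.2.2 H).mono hα hij

/-- `∇_D` is injective on invariant derivations. -/
theorem eq_zero_of_nabla_primDer_eq_zero (hcard : 2 < Fintype.card ι) {c : ℝ} (hc : c ≠ 0)
    {θ : DerF} (hinv : θ ∈ invariantDer W) {i : ℤ} (hθ : θ ∈ A.logDer fun _ => i)
    (h : nabla (A.primDer c) θ = 0) : θ = 0 := by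
  -- The zero derivation lies in every `D(A, n - 2)`, so `θ(α_H)` has infinite order along `H`. Two
  -- distinct lines then determine `θ`.
  have hz : ∀ H, θ (toF (A.form H)) = 0 := fun H => by
    apply eq_zero_of_forall_ordGe (A.form_prime H)
    intro n
    have h1 : θ ∈ A.logDer fun _ => (n : ℤ) :=
      mem_logDer_of_nabla_primDer hA hc hinv hθ (by rw [h]; exact zero_mem _)
    rw [mem_logDer_iff] at h1
    exact h1.2.2 H
  obtain ⟨H, K, hHK⟩ := Fintype.one_lt_card_iff.1 (by lia : 1 < Fintype.card ι)
  have hdet := A.distinct H K hHK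
  have hdet' : cst (A.normal H 0 * A.normal K 1 - A.normal H 1 * A.normal K 0) ≠ 0 :=
    fun h => hdet (cst_eq_zero.1 h)
  have h1 := hz H
  have h2 := hz K
  rw [form_eq_lin, der_lin] at h1 h2
  apply derF_ext
  · apply mul_left_cancel₀ hdet'
    simp only [map_sub, map_mul, Derivation.zero_apply, mul_zero]
    linear_combination cst (A.normal K 1) * h1 - cst (A.normal H 1) * h2
  · apply mul_left_cancel₀ hdet'
    simp only [map_sub, map_mul, Derivation.zero_apply, mul_zero]
    linear_combination cst (A.normal H 0) * h2 - cst (A.normal K 0) * h1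

end LineArrangement

/-! ### Homogeneous rational functions -/

theorem isHomogeneousRat_toF {p : Poly} {n : ℕ} (hp : p.IsHomogeneous n) :
    IsHomogeneousRat (toF p) n :=
  ⟨n, 0, p, 1, hp, isHomogeneous_one _ _, one_ne_zero, by simp, by simp⟩

namespace IsHomogeneousRat

variable {f g : Rat2} {d e : ℤ}

theorem mul (hf : IsHomogeneousRat f d) (hg : IsHomogeneousRat g e) :
    IsHomogeneousRat (f * g) (d + e) := by
  obtain ⟨a, b, p, q, hp, hq, hq0, rfl, rfl⟩ := hf
  obtain ⟨a', b', p', q', hp', hq', hq0', rfl, rfl⟩ := hg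
  refine ⟨a + a', b + b', p * p', q * q', hp.mul hp', hq.mul hq', mul_ne_zero hq0 hq0', ?_, ?_⟩
  · rw [map_mul, map_mul, div_mul_div_comm]
  · push_cast; ring

theorem add (hf : IsHomogeneousRat f d) (hg : IsHomogeneousRat g d) :
    IsHomogeneousRat (f + g) d := by
  obtain ⟨a, b, p, q, hp, hq, hq0, rfl, hab⟩ := hf
  obtain ⟨a', b', p', q', hp', hq', hq0', rfl, hab'⟩ := hg
  refine ⟨a + b', b + b', p * q' + q * p', q * q', ?_, hq.mul hq', mul_ne_zero hq0 hq0', ?_, ?_⟩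
  · refine (hp.mul hq').add ?_
    have : a + b' = b + a' := by lia
    rw [this]
    exact hq.mul hp'
  · rw [div_add_div _ _ (fun h => hq0 (toF_eq_zero.1 h)) fun h => hq0' (toF_eq_zero.1 h)]
    simp only [map_add, map_mul]
  · push_cast; linarith

theorem cst_mul (c : ℝ) (hf : IsHomogeneousRat f d) : IsHomogeneousRat (cst c * f) d := by
  have := (isHomogeneousRat_toF (isHomogeneous_C (Fin 2) c)).mul hf
  rwa [toF_C, Nat.cast_zero, zero_add] at this

theorem sub (hf : IsHomogeneousRat f d) (hg : IsHomogeneousRat g d) :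
    IsHomogeneousRat (f - g) d := by
  have := hf.add (hg.cst_mul (-1))
  rwa [map_neg, map_one, neg_one_mul, ← sub_eq_add_neg] at this

theorem inv_toF {p : Poly} {n : ℕ} (hp : p.IsHomogeneous n) (h0 : p ≠ 0) :
    IsHomogeneousRat (toF p)⁻¹ (-n) :=
  ⟨0, n, 1, p, isHomogeneous_one _ _, hp, h0, by simp, by simp⟩

theorem rot (hf : IsHomogeneousRat f d) : IsHomogeneousRat (rot f) d := by
  obtain ⟨a, b, p, q, hp, hq, hq0, rfl, rfl⟩ := hf
  have hq1 : toF q ≠ 0 := fun h => hq0 (toF_eq_zero.1 h)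
  refine ⟨a + b, b + b, rotPoly p * q - p * rotPoly q, q * q,
    ((rotPoly_isHomogeneous hp).mul hq).sub (hp.mul (rotPoly_isHomogeneous hq)),
    hq.mul hq, mul_ne_zero hq0 hq0, ?_, ?_⟩
  · rw [der_div _ _ _ hq1, rot_toF, rot_toF]
    simp only [map_sub, map_mul, sq]
  · push_cast; ring

/-- Euler's identity. -/
theorem euler_eq (hf : IsHomogeneousRat f d) : euler f = cst d * f := by
  obtain ⟨a, b, p, q, hp, hq, hq0, rfl, rfl⟩ := hf
  have hq1 : toF q ≠ 0 := fun h => hq0 (toF_eq_zero.1 h)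
  have key : ∀ {r : Poly} {n : ℕ}, r.IsHomogeneous n → euler (toF r) = (n : Rat2) * toF r := by
    intro r n hr
    have := congrArg toF (euler_identity hr)
    simp only [map_add, map_mul, map_natCast] at this
    rw [der_toF, euler_coord, euler_coord, coord, coord, ← this]
    ring
  rw [der_div _ _ _ hq1, key hp, key hq]
  push_cast
  field_simp

end IsHomogeneousRat

/-! ### The Jacobian of a derivation -/

/-- The Jacobian determinant of the coefficients of `η`. -/
def jac (η : DerF) : Rat2 :=
  ofCoeff ![1, 0] (η (coord 0)) * ofCoeff ![0, 1] (η (coord 1))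
    - ofCoeff ![0, 1] (η (coord 0)) * ofCoeff ![1, 0] (η (coord 1))

/-- The map `θ ↦ ∇_θ η` multiplies coefficient vectors by the Jacobian matrix of `η`. -/
theorem wedge_nabla (θ φ η : DerF) : wedge (nabla θ η) (nabla φ η) = jac η * wedge θ φ := by
  simp only [wedge, nabla_coord]
  rw [der_expand θ (η (coord 0)), der_expand θ (η (coord 1)), der_expand φ (η (coord 0)),
    der_expand φ (η (coord 1)), jac]
  ring

theorem nabla_poly_smul (p : Poly) (θ η : DerF) : nabla (p • θ) η = p • nabla θ η := by
  apply derF_ext <;> simp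

theorem nabla_add_left (θ φ η : DerF) : nabla (θ + φ) η = nabla θ η + nabla φ η := by
  apply derF_ext <;> simp

/-- The derivative in the direction of the vector `n`. -/
def dirDer (n : Fin 2 → ℝ) : DerF := ofCoeff fun i => cst (n i)

@[simp] theorem dirDer_coord (n : Fin 2 → ℝ) (i : Fin 2) : dirDer n (coord i) = cst (n i) :=
  ofCoeff_coord _ _

theorem ordGe_dirDer_coord {a : Poly} (ha : Prime a) (n : Fin 2 → ℝ) (i : Fin 2) :
    OrdGe a 0 (dirDer n (coord i)) := by
  rw [dirDer_coord]; exact ordGe_cst ha _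

namespace LineArrangement

variable {ι : Type*} [Fintype ι] {A : LineArrangement ι}

theorem nabla_mem_logDer {j : ℤ} {η : DerF} (hη : η ∈ A.logDer fun _ => j) {m : ι → ℤ}
    (hm : ∀ H, m H = 0 ∨ m H = 1) {θ : DerF} (hθ : θ ∈ A.logDer m) :
    nabla θ η ∈ A.logDer fun H => j + m H - 1 := by
  rw [mem_logDer_iff] at hη hθ ⊢
  have hco : ∀ H i, OrdGe (A.form H) 0 (θ (coord i)) := fun H i => by
    have hα := A.form_prime H
    refine ordGe_der_coord hα (A.normal_ne_zero H) ?_ ?_ i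
    · exact (hθ.2.2 H).mono hα (by rcases hm H with h | h <;> lia)
    · rw [← perpForm_eq_lin]; exact hθ.2.1 H
  refine ⟨fun a ha h i => ?_, fun H => ?_, fun H => ?_⟩
  · rw [nabla_coord]
    exact (hη.1 a ha h i).der_zero ha (hθ.1 a ha h)
  all_goals
    have hα := A.form_prime H
  · have := (hη.2.1 H).der_zero hα (hco H)
    rwa [perpForm_eq_lin, ← nabla_lin, ← perpForm_eq_lin] at this
  · have := OrdGe.der hα (hco H) (by rcases hm H with h | h <;> lia) (hθ.2.2 H) (hη.2.2 H)
    rw [form_eq_lin, ← nabla_lin, ← form_eq_lin] at this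
    rwa [show j + m H - 1 = j - 1 + m H by ring]

/-- A component of `θ` is its determinant with a constant field `dirDer n`. By `wedge_nabla`,
multiplying it by `jac η` gives the determinant of `∇_θ η` with `∇_{dirDer n} η`, whose order can be
estimated; the order of `jac η` is known exactly. -/
theorem mem_logDer_of_nabla {j : ℤ} {η : DerF} (hη : η ∈ A.logDer fun _ => j) {c : ℝ}
    (hc : c ≠ 0) (hj : jac η = cst c * toF A.defPoly ^ (j - 1)) {m : ι → ℤ}
    (hm : ∀ H, m H = 0 ∨ m H = 1) {θ : DerF} (hθ : nabla θ η ∈ A.logDer fun H => j + m H - 1) :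
    θ ∈ A.logDer m := by
  have hc' : cst c ≠ 0 := fun h => hc (cst_eq_zero.1 h)
  have hQ := A.toF_defPoly_ne_zero
  rw [mem_logDer_iff] at hη hθ ⊢
  have solve : ∀ {a : Poly} (_ : Prime a) {f g : Rat2} {k l : ℤ},
      OrdGe a k (toF A.defPoly ^ (-(j - 1))) → OrdGe a l g → jac η * f = g →
      OrdGe a (k + l) f := by
    intro a ha f g k l hk hl h
    have := (hk.cst_mul ha c⁻¹).mul ha hl
    convert this using 1
    rw [← h, hj, zpow_neg, map_inv₀]
    field_simp
  refine ⟨fun a ha h i => ?_, fun H => ?_, fun H => ?_⟩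
  · have hu := ordGe_zpow_of_not_dvd ha (A.not_dvd_defPoly ha h) (-(j - 1))
    have hreg : ∀ n, OrdGe a 0 (wedge (nabla θ η) (nabla (dirDer n) η)) := by
      intro n
      have hd : ∀ i, OrdGe a 0 (nabla (dirDer n) η (coord i)) := fun i => by
        rw [nabla_coord]
        exact (hη.1 a ha h i).der_zero ha (ordGe_dirDer_coord ha n)
      exact ((hθ.1 a ha h 0).mul_eq ha (hd 1) (add_zero 0)).sub ha
        ((hθ.1 a ha h 1).mul_eq ha (hd 0) (add_zero 0))
    fin_cases i
    · refine solve ha hu (hreg ![0, 1]) ?_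
      rw [wedge_nabla]; simp [wedge]
    · refine solve ha hu (hreg ![-1, 0]) ?_
      rw [wedge_nabla]; simp [wedge]
  all_goals
    have hα := A.form_prime H
    have hn := A.normal_ne_zero H
    have hu := A.ordGe_defPoly_zpow H (-(j - 1))
    have hL := sqLen_ne_zero hn
    set n := A.normal H with hndef
    have hζα := hθ.2.2 H
    have hζβ := hθ.2.1 H
    have hηα := hη.2.2 H
    have hηβ := hη.2.1 H
    simp only [perpForm_eq_lin, form_eq_lin, ← hndef] at hα hu hζα hζβ hηα hηβ ⊢
  -- The field normal to `H` isolates the `β_H`-component.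
  · have hνα : OrdGe (lin n) (j - 1) (nabla (dirDer n) η (toF (lin n))) := by
      rw [nabla_lin]
      exact (OrdGe.der hα (ordGe_dirDer_coord hα n) (by lia)
        (ordGe_der_toF hα (ordGe_dirDer_coord hα n) _) hηα).mono hα (by lia)
    have hνβ : OrdGe (lin n) 0 (nabla (dirDer n) η (toF (lin (perp n)))) := by
      rw [nabla_lin]
      exact hηβ.der_zero hα (ordGe_dirDer_coord hα n)
    apply OrdGe.of_cst_mul hα hL
    have h1 := sqLen_mul_wedge (nabla (dirDer n) η) (nabla θ η) n
    have h2 := sqLen_mul_wedge (dirDer n) θ n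
    have h3 : dirDer n (toF (lin n)) = cst (sqLen n) := by
      rw [der_lin]; simp [sqLen]; ring
    have h4 : dirDer n (toF (lin (perp n))) = 0 := by
      rw [der_lin]; simp [perp]; ring
    rw [h3, h4, zero_mul, sub_zero] at h2
    rw [wedge_nabla, mul_left_comm, h2] at h1
    have := solve hα hu ((hνα.mul_eq hα hζβ (add_zero _)).sub hα
      ((hνβ.mul_eq hα hζα (zero_add _)).mono hα
        (by rcases hm H with h | h <;> rw [h] <;> lia))) h1
    rwa [neg_add_cancel] at this
  -- The field tangent to `H` isolates the `α_H`-component; as it kills `α_H`, no order of `η(α_H)`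
  -- is lost.
  · have hτα : OrdGe (lin n) j (nabla (dirDer (perp n)) η (toF (lin n))) := by
      rw [nabla_lin]
      have h0 : dirDer (perp n) (toF (lin n)) = 0 := by
        rw [der_lin]; simp [perp]; ring
      exact (OrdGe.der hα (ordGe_dirDer_coord hα (perp n)) le_rfl
        (by rw [h0]; exact ordGe_zero hα 1) hηα).mono hα (by lia)
    have hτβ : OrdGe (lin n) 0 (nabla (dirDer (perp n)) η (toF (lin (perp n)))) := by
      rw [nabla_lin]
      exact hηβ.der_zero hα (ordGe_dirDer_coord hα _)
    apply OrdGe.of_cst_mul hα hL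
    have h1 := sqLen_mul_wedge (nabla θ η) (nabla (dirDer (perp n)) η) n
    have h2 := sqLen_mul_wedge θ (dirDer (perp n)) n
    have h3 : dirDer (perp n) (toF (lin n)) = 0 := by
      rw [der_lin]; simp [perp]; ring
    have h4 : dirDer (perp n) (toF (lin (perp n))) = cst (sqLen n) := by
      rw [der_lin]; simp [perp, sqLen]; ring
    rw [h3, h4, mul_zero, sub_zero, mul_comm (θ _)] at h2
    rw [wedge_nabla, mul_left_comm, h2] at h1
    have := solve hα hu ((hζα.mul_eq hα hτβ (add_zero _)).sub hα
      ((hζβ.mul_eq hα hτα (zero_add _)).mono hα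
        (by rcases hm H with h | h <;> rw [h] <;> lia))) h1
    rwa [show -(j - 1) + (j + m H - 1) = m H by ring] at this

/-- A derivation in `D(A, j)` whose Jacobian is a nonzero multiple of `Q ^ (j - 1)` is universal. -/
theorem exists_shift_equiv {j : ℤ} {η : DerF} (hη : η ∈ A.logDer fun _ => j) {c : ℝ}
    (hc : c ≠ 0) (hj : jac η = cst c * toF A.defPoly ^ (j - 1)) {m : ι → ℤ}
    (hm : ∀ H, m H = 0 ∨ m H = 1) :
    ∃ Φ : A.logDer m ≃ₗ[Poly] A.logDer fun H => j + m H - 1,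
      ∀ θ : A.logDer m, (Φ θ : DerF) = nabla θ η := by
  have hjac : jac η ≠ 0 := by
    rw [hj]
    exact mul_ne_zero (fun h => hc (cst_eq_zero.1 h)) (zpow_ne_zero _ A.toF_defPoly_ne_zero)
  let φ : A.logDer m →ₗ[Poly] A.logDer fun H => j + m H - 1 :=
    { toFun := fun θ => ⟨nabla θ η, nabla_mem_logDer hη hm θ.2⟩
      map_add' := fun θ θ' => Subtype.ext (nabla_add_left _ _ _)
      map_smul' := fun p θ => Subtype.ext (nabla_poly_smul _ _ _) }
  have hinj : ∀ θ θ' : DerF, nabla θ η = nabla θ' η → θ = θ' := by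
    intro θ θ' h
    have hw : ∀ n, wedge θ (dirDer n) = wedge θ' (dirDer n) := fun n => by
      apply mul_left_cancel₀ hjac
      rw [← wedge_nabla, ← wedge_nabla, h]
    apply derF_ext
    · simpa [wedge] using hw ![0, 1]
    · simpa [wedge] using hw ![-1, 0]
  have hbij : Function.Bijective φ := by
    constructor
    · intro θ θ' h
      exact Subtype.ext (hinj _ _ (congrArg Subtype.val h))
    · rintro ⟨ζ, hζ⟩
      -- The preimage over the function field, by Cramer's rule.
      let θ : DerF := ofCoeff
        ![(ζ (coord 0) * ofCoeff ![0, 1] (η (coord 1))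
            - ofCoeff ![0, 1] (η (coord 0)) * ζ (coord 1)) / jac η,
          (ofCoeff ![1, 0] (η (coord 0)) * ζ (coord 1)
            - ζ (coord 0) * ofCoeff ![1, 0] (η (coord 1))) / jac η]
      have hθ : nabla θ η = ζ := by
        apply derF_ext
        · rw [nabla_coord, der_expand]
          simp only [θ, ofCoeff_coord, Matrix.cons_val_zero, Matrix.cons_val_one]
          field_simp
          rw [jac]; ring
        · rw [nabla_coord, der_expand]
          simp only [θ, ofCoeff_coord, Matrix.cons_val_zero, Matrix.cons_val_one]
          field_simp
          rw [jac]; ring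
      exact ⟨⟨θ, mem_logDer_of_nabla hη hc hj hm (by rw [hθ]; exact hζ)⟩, Subtype.ext hθ⟩
  exact ⟨LinearEquiv.ofBijective φ hbij, fun θ => rfl⟩

end LineArrangement

/-! ### Determinants, degrees and Jacobians of a primitive system -/

theorem int_induction {p : ℤ → Prop} (zero : p 0) (up : ∀ k, p k → p (k + 1))
    (down : ∀ k, p (k + 1) → p k) (k : ℤ) : p k := by
  induction k using Int.induction_on with
  | zero => exact zero
  | succ i ih => exact up _ ih
  | pred i ih => exact down _ (by rwa [sub_add_cancel])

theorem toF_smul (p : Poly) (θ : DerF) : toF p • θ = p • θ := by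
  apply derF_ext <;> simp [Algebra.smul_def]

theorem isHomogeneousDer_euler : IsHomogeneousDer euler 1 := fun i => by
  rw [euler_coord]; exact_mod_cast isHomogeneousRat_toF (isHomogeneous_X ℝ i)

theorem IsHomogeneousDer.nabla_euler {η : DerF} {d : ℤ} (h : IsHomogeneousDer η d) :
    nabla euler η = cst d • η := by
  apply derF_ext
  · rw [nabla_coord, (h 0).euler_eq]; rfl
  · rw [nabla_coord, (h 1).euler_eq]; rfl

theorem wedge_smul_left (f : Rat2) (θ φ : DerF) : wedge (f • θ) φ = f * wedge θ φ := by
  simp [wedge]; ring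

theorem wedge_smul_right (f : Rat2) (θ φ : DerF) : wedge θ (f • φ) = f * wedge θ φ := by
  simp [wedge]; ring

namespace LineArrangement

variable {ι : Type*} [Fintype ι] {A : LineArrangement ι}

theorem wedge_euler_primDer (c : ℝ) :
    wedge euler (A.primDer c) = (cst c * toF A.defPoly)⁻¹ * toF radial := by
  rw [primDer, wedge_smul_right]
  simp only [wedge, euler_coord, rot_coord_zero, rot_coord_one]
  simp only [radial, coord, map_add, map_pow]
  ring

namespace IsPrimitiveSystem

variable {c : ℝ} {E G : ℤ → DerF}

section Dihedral

variable (hS : A.IsPrimitiveSystem c E G) (hD : A.IsDihedral)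
include hS hD

/-- The coefficients are polynomials, so `E (k + 1)` stays in every `S`-module containing `E k` and
`G k`. -/
theorem E_succ (k : ℤ) : E (k + 1) = (C (k + 1 + 1 / Fintype.card ι : ℝ)⁻¹ : Poly) •
    (A.potential c • E k
      - (C (c / ((Fintype.card ι : ℝ) ^ 3 * (Fintype.card ι - 1))) * radial) • G k) := by
  have h := hS.rel_E k
  have h0 := hD.coeff_E_ne_zero (k + 1)
  push_cast at h0
  simp only [← toF_smul, map_mul, toF_C]
  rw [h, add_sub_cancel_right, smul_smul, ← map_mul, inv_mul_cancel₀ h0, map_one, one_smul]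

theorem G_succ (k : ℤ) : G (k + 1) =
    (C (k + 1 + (Fintype.card ι - 1) / Fintype.card ι : ℝ)⁻¹ : Poly) • (A.potential c • G k
      - (C (c * (Fintype.card ι - 1) / (Fintype.card ι : ℝ) ^ 3) * A.gradSq) • E k) := by
  have h := hS.rel_G k
  have h0 := hD.coeff_G_ne_zero (k + 1)
  push_cast at h0
  simp only [← toF_smul, map_mul, toF_C]
  rw [h, add_sub_cancel_right, smul_smul, ← map_mul, inv_mul_cancel₀ h0, map_one, one_smul]

/-- The relations express the scaled pair of index `k + 1` through that of index `k` by a matrix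
with diagonal `p`, `p` and off-diagonal `-a`, `-b`. Its determinant `p² - ab` is `-(c² / h²) Q²` by
`radial_mul_gradSq`. -/
theorem wedge_succ (k : ℤ) : cst (k + 1 + 1 / Fintype.card ι) *
      cst (k + 1 + (Fintype.card ι - 1) / Fintype.card ι) * wedge (E (k + 1)) (G (k + 1))
    = cst (-(c ^ 2 / (Fintype.card ι : ℝ) ^ 2)) * toF A.defPoly ^ 2 * wedge (E k) (G k) := by
  have e := fun i => congrArg (fun D : DerF => D (coord i)) (hS.rel_E k)
  have f := fun i => congrArg (fun D : DerF => D (coord i)) (hS.rel_G k)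
  simp only [Derivation.add_apply, Derivation.smul_apply, smul_eq_mul] at e f
  have hr := congrArg toF hD.radial_mul_gradSq
  simp only [map_mul, map_pow, map_add, toF_C] at hr
  have hh : cst (Fintype.card ι) ≠ 0 := fun h => hD.card_pos.ne' (cst_eq_zero.1 h)
  have hh1 : cst (Fintype.card ι) - 1 ≠ 0 := fun h =>
    hD.card_sub_one_pos.ne' (cst_eq_zero.1 (by rw [map_sub, map_one, h]))
  have key : toF (A.potential c) ^ 2
      - (cst (c / ((Fintype.card ι : ℝ) ^ 3 * (Fintype.card ι - 1))) * toF radial) *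
        (cst (c * (Fintype.card ι - 1) / (Fintype.card ι : ℝ) ^ 3) * toF A.gradSq)
      = cst (-(c ^ 2 / (Fintype.card ι : ℝ) ^ 2)) * toF A.defPoly ^ 2 := by
    simp only [potential, map_mul, map_div₀, map_pow, map_sub, map_one, map_neg, toF_C]
    field_simp
    linear_combination -cst c ^ 2 * hr
  rw [← key]
  unfold wedge
  set u := cst (k + 1 + 1 / Fintype.card ι)
  set w := cst (k + 1 + (Fintype.card ι - 1) / Fintype.card ι)
  set a := cst (c / ((Fintype.card ι : ℝ) ^ 3 * (Fintype.card ι - 1))) * toF radial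
  set b := cst (c * (Fintype.card ι - 1) / (Fintype.card ι : ℝ) ^ 3) * toF A.gradSq
  set p := toF (A.potential c)
  linear_combination -(p * G k (coord 1) - b * E k (coord 1)) * e 0
    + (p * G k (coord 0) - b * E k (coord 0)) * e 1
    - u * E (k + 1) (coord 0) * f 1 + u * E (k + 1) (coord 1) * f 0

theorem exists_wedge_eq (hc : c ≠ 0) (k : ℤ) : ∃ r : ℝ, r ≠ 0 ∧
    wedge (E k) (G k) = cst r * toF A.defPoly ^ (2 * k + 1) := by
  have hQ := A.toF_defPoly_ne_zero
  have hh := hD.card_pos.ne'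
  induction k using int_induction with
  | zero =>
    refine ⟨-(Fintype.card ι : ℝ) ^ 2, by simp [hh], ?_⟩
    have h4 := congrArg toF hD.rot_rotDefPoly
    simp only [map_sub, map_mul, map_neg, map_pow, toF_C] at h4
    rw [hS.E_zero, hS.G_zero, wedge]
    simp only [euler_coord, gradDer_coord_zero, gradDer_coord_one]
    simp only [coord, mul_zero, zero_add, zpow_one, map_neg, map_pow]
    exact h4
  | up k ih =>
    obtain ⟨r, hr, ih⟩ := ih
    have h := hS.wedge_succ hD k
    have h1 := hD.coeff_E_ne_zero (k + 1)
    have h2 := hD.coeff_G_ne_zero (k + 1)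
    push_cast at h1 h2
    set u : ℝ := k + 1 + 1 / Fintype.card ι
    set w : ℝ := k + 1 + (Fintype.card ι - 1) / Fintype.card ι
    set s : ℝ := -(c ^ 2 / (Fintype.card ι : ℝ) ^ 2) with hs
    have hs0 : s ≠ 0 := by rw [hs]; simp [hc, hh]
    refine ⟨s * r / (u * w), by simp [hs0, hr, h1, h2], ?_⟩
    have hu : cst u ≠ 0 := fun h => h1 (cst_eq_zero.1 h)
    have hw : cst w ≠ 0 := fun h => h2 (cst_eq_zero.1 h)
    rw [ih] at h
    rw [show 2 * (k + 1) + 1 = 2 * k + 1 + 2 by ring, zpow_add₀ hQ]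
    simp only [map_div₀, map_mul]
    have : toF A.defPoly ^ (2 : ℤ) = toF A.defPoly ^ 2 := zpow_ofNat _ 2
    rw [this]
    field_simp
    linear_combination h
  | down k ih =>
    obtain ⟨r, hr, ih⟩ := ih
    have h := hS.wedge_succ hD k
    have h1 := hD.coeff_E_ne_zero (k + 1)
    have h2 := hD.coeff_G_ne_zero (k + 1)
    push_cast at h1 h2
    set u : ℝ := k + 1 + 1 / Fintype.card ι
    set w : ℝ := k + 1 + (Fintype.card ι - 1) / Fintype.card ι
    set s : ℝ := -(c ^ 2 / (Fintype.card ι : ℝ) ^ 2) with hs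
    have hs0 : s ≠ 0 := by rw [hs]; simp [hc, hh]
    have hs1 : cst s ≠ 0 := fun h => hs0 (cst_eq_zero.1 h)
    refine ⟨u * w * r / s, by simp [hs0, hr, h1, h2], ?_⟩
    rw [ih, show 2 * (k + 1) + 1 = 2 * k + 1 + 2 by ring, zpow_add₀ hQ] at h
    have : toF A.defPoly ^ (2 : ℤ) = toF A.defPoly ^ 2 := zpow_ofNat _ 2
    rw [this] at h
    apply mul_left_cancel₀ (mul_ne_zero hs1 (pow_ne_zero 2 hQ))
    simp only [map_div₀, map_mul]
    rw [← h]
    field_simp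

/-- The recurrences give the degrees upwards. Downwards, `∇_D` lowers degrees by `h`, because `rot`
preserves them and `D` carries the factor `1 / Q`. -/
theorem isHomogeneousDer (k : ℤ) :
    IsHomogeneousDer (E k) (k * Fintype.card ι + 1) ∧
      IsHomogeneousDer (G k) (k * Fintype.card ι + Fintype.card ι - 1) := by
  have hN := A.rotDefPoly_isHomogeneous
  have hh := hD.two_lt_card
  have hgr : ∀ i, (pderiv i A.rotDefPoly).IsHomogeneous (Fintype.card ι - 1) := fun i => hN.pderiv
  have hpot : IsHomogeneousRat (toF (A.potential c)) (Fintype.card ι) := by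
    have := (isHomogeneous_C (Fin 2) (-(c / (Fintype.card ι : ℝ) ^ 2))).mul hN
    rw [zero_add] at this
    exact isHomogeneousRat_toF this
  have hrad := isHomogeneousRat_toF radial_isHomogeneous
  have hgsq : IsHomogeneousRat (toF A.gradSq) (2 * Fintype.card ι - 2) := by
    have := isHomogeneousRat_toF (((hgr 0).pow 2).add ((hgr 1).pow 2))
    rwa [show (((Fintype.card ι - 1) * 2 : ℕ) : ℤ) = 2 * Fintype.card ι - 2 by lia] at this
  have hcast : ((Fintype.card ι - 1 : ℕ) : ℤ) = (Fintype.card ι : ℤ) - 1 := by lia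
  have hprim : ∀ (θ : DerF) (d : ℤ), IsHomogeneousDer θ d →
      IsHomogeneousDer (nabla (A.primDer c) θ) (d - Fintype.card ι) := by
    intro θ d hθ i
    have h1 : IsHomogeneousRat (cst c * toF A.defPoly)⁻¹ (-(Fintype.card ι : ℤ)) := by
      rw [mul_inv, ← map_inv₀]
      exact (IsHomogeneousRat.inv_toF A.defPoly_isHomogeneous A.defPoly_ne_zero).cst_mul _
    rw [nabla_coord, primDer_apply]
    have := h1.mul (hθ i).rot
    rwa [show -(Fintype.card ι : ℤ) + d = d - Fintype.card ι by ring] at this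
  induction k using int_induction with
  | zero =>
    constructor
    · rw [hS.E_zero, zero_mul, zero_add]; exact isHomogeneousDer_euler
    · rw [hS.G_zero, zero_mul, zero_add, ← hcast]
      rw [IsHomogeneousDer, Fin.forall_fin_two]
      exact ⟨by rw [gradDer_coord_zero]; exact isHomogeneousRat_toF (hgr 0),
        by rw [gradDer_coord_one]; exact isHomogeneousRat_toF (hgr 1)⟩
  | up k ih =>
    constructor
    · intro i
      rw [hS.E_succ hD k]
      simp only [← toF_smul, Derivation.smul_apply, Derivation.sub_apply, smul_eq_mul, toF_C,
        map_mul]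
      apply IsHomogeneousRat.cst_mul
      apply IsHomogeneousRat.sub
      · have := hpot.mul (ih.1 i)
        convert this using 1; ring
      · have := (hrad.cst_mul
          (c / ((Fintype.card ι : ℝ) ^ 3 * (Fintype.card ι - 1)))).mul (ih.2 i)
        simp only [map_div₀, map_mul, map_pow, map_sub] at this ⊢
        convert this using 1; push_cast; ring
    · intro i
      rw [hS.G_succ hD k]
      simp only [← toF_smul, Derivation.smul_apply, Derivation.sub_apply, smul_eq_mul, toF_C,
        map_mul]
      apply IsHomogeneousRat.cst_mul
      apply IsHomogeneousRat.sub
      · have := hpot.mul (ih.2 i)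
        convert this using 1; ring
      · have := (hgsq.cst_mul
          (c * (Fintype.card ι - 1) / (Fintype.card ι : ℝ) ^ 3)).mul (ih.1 i)
        simp only [map_div₀, map_mul, map_pow, map_sub] at this ⊢
        convert this using 1; ring
  | down k ih =>
    constructor
    · have := hprim _ _ ih.1
      rw [hS.nabla_E] at this
      convert this using 1; ring
    · have := hprim _ _ ih.2
      rw [hS.nabla_G] at this
      convert this using 1; ring

/-- With the index shifted to `k + 1`, `wedge_nabla` is applied to `euler` and `D`: the former
multiplies `E (k + 1)` by its degree, the latter takes it to `E k`. The determinant of `E (k + 1)`,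
`E k` follows from `rel_E`, and its factor `radial` cancels against that of `wedge_euler_primDer`.
-/
theorem exists_jac_eq (hc : c ≠ 0) (k : ℤ) : ∃ r : ℝ, r ≠ 0 ∧
    jac (E k) = cst r * toF A.defPoly ^ (2 * k + 1 - 1) := by
  have hQ := A.toF_defPoly_ne_zero
  have hh := hD.card_pos.ne'
  have hh1 := hD.card_sub_one_pos.ne'
  have hrad : toF radial ≠ 0 := fun h => radial_ne_zero (toF_eq_zero.1 h)
  obtain ⟨k, rfl⟩ : ∃ l, k = l + 1 := ⟨k - 1, by ring⟩
  obtain ⟨r, hr, hw⟩ := hS.exists_wedge_eq hD hc k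
  have hu0 := hD.coeff_E_ne_zero (k + 1)
  push_cast at hu0
  -- The degree is `h` times the nonzero scalar of `coeff_E_ne_zero`.
  have hd0 : (((k + 1) * Fintype.card ι + 1 : ℤ) : ℝ) ≠ 0 := by
    push_cast
    intro h
    apply hu0
    field_simp
    linear_combination h
  have h1 := wedge_nabla euler (A.primDer c) (E (k + 1))
  rw [hS.nabla_E, (hS.isHomogeneousDer hD (k + 1)).1.nabla_euler, wedge_smul_left,
    wedge_euler_primDer] at h1
  have h2 : cst (k + 1 + 1 / Fintype.card ι) * wedge (E (k + 1)) (E k)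
      = cst (c / ((Fintype.card ι : ℝ) ^ 3 * (Fintype.card ι - 1))) * toF radial *
        (cst r * toF A.defPoly ^ (2 * k + 1)) := by
    rw [← wedge_smul_left, eq_sub_of_add_eq (hS.rel_E k).symm, ← hw]
    simp only [wedge, Derivation.sub_apply, Derivation.smul_apply, smul_eq_mul]
    ring
  set d : ℝ := (((k + 1) * Fintype.card ι + 1 : ℤ) : ℝ)
  set u : ℝ := k + 1 + 1 / Fintype.card ι
  set l : ℝ := c / ((Fintype.card ι : ℝ) ^ 3 * (Fintype.card ι - 1)) with hl
  have hl0 : l ≠ 0 := by rw [hl]; simp [hc, hh, hh1]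
  refine ⟨d * (l * r) * c / u, by simp [hd0, hl0, hr, hc, hu0], ?_⟩
  have hc' : cst c ≠ 0 := fun h => hc (cst_eq_zero.1 h)
  have hu' : cst u ≠ 0 := fun h => hu0 (cst_eq_zero.1 h)
  rw [show 2 * (k + 1) + 1 - 1 = 2 * k + 1 + 1 by ring, zpow_add₀ hQ, zpow_one]
  apply mul_left_cancel₀ (mul_ne_zero (mul_ne_zero hrad hu') (inv_ne_zero (mul_ne_zero hc' hQ)))
  simp only [map_div₀, map_mul]
  have e : toF radial * cst u * (cst c * toF A.defPoly)⁻¹ * jac (E (k + 1))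
      = cst d * (cst u * wedge (E (k + 1)) (E k)) := by
    linear_combination -cst u * h1
  rw [e, h2]
  field_simp

end Dihedral

end IsPrimitiveSystem

end LineArrangement

/-! ### The space of invariant logarithmic derivations and its automorphism -/

theorem mem_invLogDer_iff {W : Subgroup O2} {ι : Type*} [Fintype ι] {A : LineArrangement ι}
    {θ : DerF} : θ ∈ invLogDer W A ↔ (∃ j : ℤ, θ ∈ A.logDer fun _ => j) ∧ θ ∈ invariantDer W := by
  have hmono : Monotone fun n : ℕ => A.logDer fun _ => -(n : ℤ) := fun m n h =>
    A.logDer_mono fun _ => by lia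
  rw [invLogDer, Submodule.mem_inf, Submodule.restrictScalars_mem,
    Submodule.mem_iSup_of_directed _ hmono.directed_le]
  refine and_congr_left fun _ => ⟨fun ⟨n, hn⟩ => ⟨_, hn⟩, fun ⟨j, hj⟩ => ⟨(-j).toNat, ?_⟩⟩
  exact A.logDer_mono (fun _ => by lia) hj

theorem poly_smul_mem_invariantDer {W : Subgroup O2} {p : Poly} (hp : p ∈ invariantRing W)
    {θ : DerF} (hθ : θ ∈ invariantDer W) : p • θ ∈ invariantDer W := by
  rw [← toF_smul]
  exact smul_mem_invariantDer (fieldAct_toF_of_mem hp) hθ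

theorem poly_smul_mem_invLogDer {W : Subgroup O2} {ι : Type*} [Fintype ι] {A : LineArrangement ι}
    {p : Poly} (hp : p ∈ invariantRing W) {θ : DerF} (hθ : θ ∈ invLogDer W A) :
    p • θ ∈ invLogDer W A := by
  rw [mem_invLogDer_iff] at hθ ⊢
  obtain ⟨⟨j, hj⟩, h⟩ := hθ
  exact ⟨⟨j, Submodule.smul_mem _ p hj⟩, poly_smul_mem_invariantDer hp h⟩

/-- The coefficients of an invariant derivation in an invariant basis are invariant. -/
theorem mem_invariantRing_of_eq_add {W : Subgroup O2} {θ φ ψ : DerF} (hθ : θ ∈ invariantDer W)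
    (hφ : φ ∈ invariantDer W) (hψ : ψ ∈ invariantDer W) (hw : wedge θ φ ≠ 0) {p q : Poly}
    (h : ψ = p • θ + q • φ) : p ∈ invariantRing W ∧ q ∈ invariantRing W := by
  have key : ∀ g ∈ W, polyAct g p = p ∧ polyAct g q = q := by
    intro g hg
    have e : ∀ i, toF (polyAct g p) * θ (coord i) + toF (polyAct g q) * φ (coord i)
        = toF p * θ (coord i) + toF q * φ (coord i) := by
      intro i
      obtain ⟨f, hf⟩ := (fieldAct g).surjective (coord i)
      have h1 := hψ g hg f
      rw [h] at h1
      simp only [← toF_smul, Derivation.add_apply, Derivation.smul_apply, smul_eq_mul, map_add,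
        map_mul, hθ g hg, hφ g hg, hf, fieldAct_algebraMap] at h1
      exact h1
    constructor
    · apply toF_injective
      apply mul_right_cancel₀ hw
      unfold wedge
      linear_combination φ (coord 1) * e 0 - φ (coord 0) * e 1
    · apply toF_injective
      apply mul_right_cancel₀ hw
      unfold wedge
      linear_combination θ (coord 0) * e 1 - θ (coord 1) * e 0
  exact ⟨fun g hg => (key g hg).1, fun g hg => (key g hg).2⟩

namespace LineArrangement.IsPrimitiveSystem

variable {ι : Type*} [Fintype ι] {A : LineArrangement ι} {c : ℝ} {E G : ℤ → DerF}
  (hS : A.IsPrimitiveSystem c E G) {W : Subgroup O2} (hW : IsCoxeterGroup W)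
  (hA : IsCoxeterArrangement W A) (hD : A.IsDihedral) (hc : c ≠ 0)

include hS hW hA hD

theorem mem_invariantDer (k : ℤ) : E k ∈ invariantDer W ∧ G k ∈ invariantDer W := by
  induction k using int_induction with
  | zero =>
    rw [hS.E_zero, hS.G_zero]
    exact ⟨euler_mem_invariantDer W, gradDer_mem_invariantDer hW hA hD⟩
  | up k ih =>
    have hC : ∀ r : ℝ, (C r : Poly) ∈ invariantRing W := (invariantRing W).algebraMap_mem
    have hpot := potential_mem_invariantRing hW hA c
    have hrad : radial ∈ invariantRing W := radial_mem_invariantRing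
    have hgr := gradSq_mem_invariantRing hW hA hD
    rw [hS.E_succ hD, hS.G_succ hD]
    exact ⟨poly_smul_mem_invariantDer (hC _) (sub_mem (poly_smul_mem_invariantDer hpot ih.1)
        (poly_smul_mem_invariantDer (C_mul_mem_invariantRing _ hrad) ih.2)),
      poly_smul_mem_invariantDer (hC _) (sub_mem (poly_smul_mem_invariantDer hpot ih.2)
        (poly_smul_mem_invariantDer (C_mul_mem_invariantRing _ hgr) ih.1))⟩
  | down k ih =>
    rw [← hS.nabla_E, ← hS.nabla_G]
    exact ⟨nabla_mem_invariantDer (primDer_mem_invariantDer hW hA c) ih.1,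
      nabla_mem_invariantDer (primDer_mem_invariantDer hW hA c) ih.2⟩

include hc

/-- Upwards, the recurrences keep the pair of index `k + 1` in `D(A, 2k+1)`; this a priori bound
rises by two because `∇_D` maps the pair to that of index `k`. Downwards, `∇_D` lowers the
multiplicity by two. -/
theorem mem_logDer (k : ℤ) :
    (E k ∈ A.logDer fun _ => 2 * k + 1) ∧ G k ∈ A.logDer fun _ => 2 * k + 1 := by
  have hinv := hS.mem_invariantDer hW hA hD
  induction k using int_induction with
  | zero =>
    rw [hS.E_zero, hS.G_zero]
    constructor
    all_goals
      rw [mem_logDer_iff]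
    · refine ⟨fun a ha _ i => by rw [euler_coord]; exact ordGe_toF ha _, fun H => ?_, fun H => ?_⟩
      all_goals
        have hα := A.form_prime H
        have he : ∀ n, euler (toF (lin n)) = toF (lin n) := fun n => by
          rw [der_lin, euler_coord, euler_coord, toF_lin]
      · rw [perpForm_eq_lin, he]; exact ordGe_toF hα _
      · rw [form_eq_lin, he]; exact ordGe_self hα
    · have hreg : ∀ a, Prime a → ∀ i, OrdGe a 0 (A.gradDer (coord i)) := fun a ha => by
        rw [Fin.forall_fin_two, gradDer_coord_zero, gradDer_coord_one]
        exact ⟨ordGe_toF ha _, ordGe_toF ha _⟩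
      refine ⟨fun a ha _ i => hreg a ha i, fun H => ?_, fun H => ?_⟩
      · rw [perpForm_eq_lin]; exact ordGe_der_lin (A.form_prime H) (hreg _ (A.form_prime H)) _
      · have hα := A.form_prime H
        have hn := A.normal_ne_zero H
        obtain ⟨g, hg, -, -, hr⟩ := hA.exists_reflects H
        -- The derivative of `N` normal to a mirror is odd, hence vanishes on it.
        refine hr.ordGe_succ_of_odd hn ?_ (j := 0) (by simp) (ordGe_der_lin hα (hreg _ hα) _)
        rw [gradDer_mem_invariantDer hW hA hD g hg, form_eq_lin, hr.fieldAct_lin, map_neg]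
  | up k ih =>
    have hE : E (k + 1) ∈ A.logDer fun _ => 2 * k + 1 := by
      rw [hS.E_succ hD]
      exact Submodule.smul_mem _ _ (sub_mem (Submodule.smul_mem _ _ ih.1)
        (Submodule.smul_mem _ _ ih.2))
    have hG : G (k + 1) ∈ A.logDer fun _ => 2 * k + 1 := by
      rw [hS.G_succ hD]
      exact Submodule.smul_mem _ _ (sub_mem (Submodule.smul_mem _ _ ih.2)
        (Submodule.smul_mem _ _ ih.1))
    have e : 2 * (k + 1) + 1 - 2 = 2 * k + 1 := by ring
    exact ⟨mem_logDer_of_nabla_primDer hA hc (hinv _).1 hE (by rw [hS.nabla_E, e]; exact ih.1),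
      mem_logDer_of_nabla_primDer hA hc (hinv _).2 hG (by rw [hS.nabla_G, e]; exact ih.2)⟩
  | down k ih =>
    have e : 2 * (k + 1) + 1 - 2 = 2 * k + 1 := by ring
    have hE := nabla_primDer_mem_logDer hA c (hinv _).1 ih.1
    have hG := nabla_primDer_mem_logDer hA c (hinv _).2 ih.2
    rw [hS.nabla_E, e] at hE
    rw [hS.nabla_G, e] at hG
    exact ⟨hE, hG⟩

theorem mem_invLogDer (k : ℤ) : E k ∈ invLogDer W A ∧ G k ∈ invLogDer W A := by
  have h1 := hS.mem_logDer hW hA hD hc k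
  have h2 := hS.mem_invariantDer hW hA hD k
  exact ⟨mem_invLogDer_iff.2 ⟨⟨_, h1.1⟩, h2.1⟩, mem_invLogDer_iff.2 ⟨⟨_, h1.2⟩, h2.2⟩⟩

/-- `∇_D` is surjective on the invariant logarithmic derivations. -/
theorem exists_nabla_eq {P : Fin 2 → Poly} (hP : IsBasicInvariants W P)
    (hP0 : rotPoly (P 0) = 0) (hP1 : rotPoly (P 1) = C c * A.defPoly) {θ : DerF}
    (hθ : θ ∈ invLogDer W A) : ∃ ζ ∈ invLogDer W A, nabla (A.primDer c) ζ = θ := by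
  -- The elements of `T` are constants for `D`, so `∇_D` is `T`-linear.
  let T : Subalgebra ℝ Poly := rotKer ⊓ invariantRing W
  let U : Submodule ℝ DerF :=
    Submodule.span ℝ {θ | ∃ t ∈ T, ∃ k, θ = t • E k ∨ θ = t • G k}
  have hE : ∀ t ∈ T, ∀ k, t • E k ∈ U := fun t ht k =>
    Submodule.subset_span ⟨t, ht, k, Or.inl rfl⟩
  have hG : ∀ t ∈ T, ∀ k, t • G k ∈ U := fun t ht k =>
    Submodule.subset_span ⟨t, ht, k, Or.inr rfl⟩
  have hTC : ∀ (r : ℝ) {t : Poly}, t ∈ T → C r * t ∈ T := fun r t ht =>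
    T.mul_mem (T.algebraMap_mem r) ht
  have hTrad : radial ∈ T := ⟨radial_mem_rotKer, radial_mem_invariantRing⟩
  have hTgr : A.gradSq ∈ T := ⟨hD.gradSq_mem_rotKer, gradSq_mem_invariantRing hW hA hD⟩
  -- The multipliers of `U` form an algebra, so it is enough to place `P 0` and `P 1` in it.
  let stab : Subalgebra ℝ Poly :=
    { carrier := {p | ∀ u ∈ U, p • u ∈ U}
      mul_mem' := fun {p q} hp hq u hu => by rw [mul_smul]; exact hp _ (hq _ hu)
      add_mem' := fun {p q} hp hq u hu => by rw [add_smul]; exact U.add_mem (hp _ hu) (hq _ hu)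
      algebraMap_mem' := fun r u hu => by
        rw [algebraMap_smul]; exact U.smul_mem r hu }
  have hgen : ∀ p : Poly, (∀ t ∈ T, ∀ k, p • t • E k ∈ U) → (∀ t ∈ T, ∀ k, p • t • G k ∈ U) →
      p ∈ stab := by
    intro p h1 h2 u hu
    induction hu using Submodule.span_induction with
    | mem x hx =>
      obtain ⟨t, ht, k, rfl | rfl⟩ := hx
      · exact h1 t ht k
      · exact h2 t ht k
    | zero => rw [smul_zero]; exact U.zero_mem
    | add x y _ _ hx hy => rw [smul_add]; exact U.add_mem hx hy
    | smul r x _ hx => rw [smul_comm]; exact U.smul_mem r hx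
  have hTstab : ∀ t ∈ T, t ∈ stab := fun t ht => hgen t
    (fun s hs k => by rw [← mul_smul]; exact hE _ (T.mul_mem ht hs) k)
    (fun s hs k => by rw [← mul_smul]; exact hG _ (T.mul_mem ht hs) k)
  have hpot : A.potential c ∈ stab := by
    apply hgen
    · intro t ht k
      have h := hS.rel_E k
      rw [← toF_C, ← toF_C, ← map_mul, toF_smul, toF_smul, toF_smul] at h
      rw [smul_comm, h, smul_add]
      exact U.add_mem (hTstab t ht _ (hE _ (T.algebraMap_mem _) _))
        (hTstab t ht _ (hG _ (hTC _ hTrad) _))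
    · intro t ht k
      have h := hS.rel_G k
      rw [← toF_C, ← toF_C, ← map_mul, toF_smul, toF_smul, toF_smul] at h
      rw [smul_comm, h, smul_add]
      exact U.add_mem (hTstab t ht _ (hG _ (T.algebraMap_mem _) _))
        (hTstab t ht _ (hE _ (hTC _ hTgr) _))
  have hPinv : ∀ i, P i ∈ invariantRing W := fun i => by
    rw [← hP.generate]; exact Algebra.subset_adjoin ⟨i, rfl⟩
  have hR : ∀ p ∈ invariantRing W, p ∈ stab := by
    rw [← hP.generate]
    refine Algebra.adjoin_le ?_
    rintro _ ⟨i, rfl⟩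
    fin_cases i
    · exact hTstab _ ⟨hP0, hPinv 0⟩
    -- Both `P 1` and the potential have rotation derivative `c Q`.
    · have hdiff : P 1 + C (-1) * A.potential c ∈ T := by
        refine ⟨?_, (invariantRing W).add_mem (hPinv 1)
          (C_mul_mem_invariantRing _ (potential_mem_invariantRing hW hA c))⟩
        change rotPoly _ = 0
        rw [rotPoly_add, rotPoly_C_mul, hP1, hD.rotPoly_potential]
        simp
      have := stab.add_mem (hTstab _ hdiff) hpot
      rwa [map_neg, C_1, neg_one_mul, neg_add_cancel_right] at this
  have hθU : θ ∈ U := by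
    obtain ⟨⟨j, hj⟩, hinv⟩ := mem_invLogDer_iff.1 hθ
    -- For such `k` the invariant basis `E k`, `G k` of `D(A, 2k+1)` expresses `θ`, with invariant
    -- coefficients.
    obtain ⟨k, hk⟩ : ∃ k : ℤ, 2 * k + 1 ≤ j := ⟨(j - 1) / 2, by lia⟩
    have hθk : θ ∈ A.logDer fun _ => 2 * k + 1 := A.logDer_mono (fun _ => hk) hj
    obtain ⟨r, hr, hw⟩ := hS.exists_wedge_eq hD hc k
    have hmem := hS.mem_logDer hW hA hD hc k
    have hi := hS.mem_invariantDer hW hA hD k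
    obtain ⟨p, q, hpq⟩ := A.exists_eq_add_of_wedge hmem.1 hmem.2 hr hw hθk
    have hw0 : wedge (E k) (G k) ≠ 0 := by
      rw [hw]
      exact mul_ne_zero (fun h => hr (cst_eq_zero.1 h)) (zpow_ne_zero _ A.toF_defPoly_ne_zero)
    obtain ⟨hp, hq⟩ := mem_invariantRing_of_eq_add hi.1 hi.2 hinv hw0 hpq
    have h1 : E k ∈ U := by simpa using hE 1 T.one_mem k
    have h2 : G k ∈ U := by simpa using hG 1 T.one_mem k
    rw [hpq]
    exact U.add_mem (hR p hp _ h1) (hR q hq _ h2)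
  have hnab : ∀ t ∈ T, ∀ η, nabla (A.primDer c) (t • η) = t • nabla (A.primDer c) η := by
    intro t ht η
    rw [← toF_smul, ← toF_smul, nabla_smul, IsDihedral.primDer_toF_of_mem_rotKer ht.1, zero_smul,
      zero_add]
  have hM := hS.mem_invLogDer hW hA hD hc
  clear hθ
  induction hθU using Submodule.span_induction with
  | mem x hx =>
    obtain ⟨t, ht, k, rfl | rfl⟩ := hx
    · exact ⟨t • E (k + 1), poly_smul_mem_invLogDer ht.2 (hM _).1, by rw [hnab t ht, hS.nabla_E]⟩
    · exact ⟨t • G (k + 1), poly_smul_mem_invLogDer ht.2 (hM _).2, by rw [hnab t ht, hS.nabla_G]⟩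
  | zero => exact ⟨0, zero_mem _, (nablaLin _).map_zero⟩
  | add x y _ _ hx hy =>
    obtain ⟨ζ, h, rfl⟩ := hx
    obtain ⟨ζ', h', rfl⟩ := hy
    exact ⟨ζ + ζ', add_mem h h', nabla_add _ _ _⟩
  | smul r x _ hx =>
    obtain ⟨ζ, h, rfl⟩ := hx
    exact ⟨r • ζ, Submodule.smul_mem _ r h, (nablaLin _).map_smul r ζ⟩

/-- `∇_D` as an automorphism of the space of invariant logarithmic derivations. -/
theorem exists_nablaEquiv {P : Fin 2 → Poly} (hP : IsBasicInvariants W P)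
    (hP0 : rotPoly (P 0) = 0) (hP1 : rotPoly (P 1) = C c * A.defPoly) :
    ∃ e : invLogDer W A ≃ₗ[ℝ] invLogDer W A, ∀ η, (e η : DerF) = nabla (A.primDer c) η := by
  have hmem : ∀ η ∈ invLogDer W A, nablaLin (A.primDer c) η ∈ invLogDer W A := by
    intro η hη
    rw [mem_invLogDer_iff] at hη ⊢
    obtain ⟨⟨j, hj⟩, hinv⟩ := hη
    exact ⟨⟨j - 2, nabla_primDer_mem_logDer hA c hinv hj⟩,
      nabla_mem_invariantDer (primDer_mem_invariantDer hW hA c) hinv⟩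
  refine ⟨LinearEquiv.ofBijective ((nablaLin (A.primDer c)).restrict hmem) ⟨?_, ?_⟩, fun η => rfl⟩
  · rw [injective_iff_map_eq_zero]
    rintro ⟨η, hη⟩ h
    have h0 : nabla (A.primDer c) η = 0 := congrArg Subtype.val h
    obtain ⟨⟨j, hj⟩, hinv⟩ := mem_invLogDer_iff.1 hη
    exact Subtype.ext (eq_zero_of_nabla_primDer_eq_zero hA hD.two_lt_card hc hinv hj h0)
  · rintro ⟨θ, hθ⟩
    obtain ⟨ζ, hζ, h⟩ := hS.exists_nabla_eq hW hA hD hc hP hP0 hP1 hθ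
    exact ⟨⟨ζ, hζ⟩, Subtype.ext h⟩

/-- The iterated primitives of the Euler derivation are Euler derivations. -/
theorem isEulerDerivation (k : ℤ) : A.IsEulerDerivation (fun _ => 2 * k + 1) (E k) := by
  have hcard := hD.two_lt_card
  -- For a constant multiplicity one further line already suffices.
  have hbal : ∀ n : ℤ, Balanced fun _ : ι => n := by
    classical
    intro n K
    obtain ⟨L, hL⟩ := Fintype.exists_ne_of_one_lt_card (by lia : 1 < Fintype.card ι) K
    exact Finset.single_le_sum (f := fun _ : ι => |n|) (fun _ _ => abs_nonneg n)
      (Finset.mem_erase.2 ⟨hL, Finset.mem_univ L⟩)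
  have hmem := hS.mem_logDer hW hA hD hc k
  have hhom := hS.isHomogeneousDer hD k
  obtain ⟨r, hr, hw⟩ := hS.exists_wedge_eq hD hc k
  obtain ⟨s, hs, hj⟩ := hS.exists_jac_eq hD hc k
  have hbasis : A.IsHomogeneousBasis (fun _ => 2 * k + 1) (E k) (G k) (k * Fintype.card ι + 1)
      (k * Fintype.card ι + Fintype.card ι - 1) :=
    ⟨A.exists_basis_of_wedge hmem.1 hmem.2 hr hw, hhom.1, hhom.2⟩
  exact
    { two_lt_card := hcard
      balanced := hbal _
      balanced_sub_one := fun _ => hbal _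
      delta := by
        refine ⟨_, _, ⟨_, _, hbasis⟩, ?_⟩
        rw [abs_sub_comm, abs_of_nonneg (by lia)]; ring
      lower := ⟨_, _, _, hbasis, by lia⟩
      shift := fun m hm => exists_shift_equiv hmem.1 hs hj hm }

end LineArrangement.IsPrimitiveSystem

end PlaneArr

end

theorem corollary2p3 (W : Subgroup PlaneArr.O2) (hW : PlaneArr.IsCoxeterGroup W)
    {ι : Type*} [Fintype ι] (A : PlaneArr.LineArrangement ι)
    (hA : PlaneArr.IsCoxeterArrangement W A)
    (P : Fin 2 → PlaneArr.Poly) (hP : PlaneArr.IsBasicInvariants W P) :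
    ∃ e : PlaneArr.invLogDer W A ≃ₗ[ℝ] PlaneArr.invLogDer W A,
      (∀ η, (e η : PlaneArr.DerF) = PlaneArr.nabla (PlaneArr.primitive P) η) ∧
      ∀ k : ℤ, A.IsEulerDerivation (fun _ => 2 * k + 1)
        ((e ^ (-k)) (PlaneArr.eulerInv W A) : PlaneArr.DerF) := by
  obtain ⟨hcard, ⟨t, ht, hrad⟩, c, hc, hrot⟩ := hP.exists_rotPoly_eq hW hA
  have hD := PlaneArr.LineArrangement.IsDihedral.of_coxeter hW hA hcard
  have hprim : PlaneArr.primitive P = A.primDer c :=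
    PlaneArr.primitive_eq_smul_rot ht hrad hc hrot
  have hrot0 : PlaneArr.rotPoly (P 0) = 0 := by
    have h := PlaneArr.mem_rotKer.1 PlaneArr.radial_mem_rotKer
    rw [hrad, PlaneArr.rotPoly_C_mul] at h
    exact (mul_eq_zero.1 h).resolve_left fun h => ht (MvPolynomial.C_eq_zero.1 h)
  obtain ⟨E, G, hS⟩ := hD.exists_primitiveSystem hc
  obtain ⟨e, he⟩ := hS.exists_nablaEquiv hW hA hD hc hP hrot0 hrot
  refine ⟨e, fun η => by rw [he, hprim], fun k => ?_⟩
  -- Both sequences start at `euler` and drop by one index under `e`; going up uses the injectivity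
  -- of `e`.
  have hpow : ∀ k : ℤ, ((e ^ (-k)) (PlaneArr.eulerInv W A) : PlaneArr.DerF) = E k := by
    have hsucc : ∀ k : ℤ, e ((e ^ (-(k + 1))) (PlaneArr.eulerInv W A))
        = (e ^ (-k)) (PlaneArr.eulerInv W A) := fun k => by
      rw [← LinearEquiv.mul_apply, ← zpow_one_add]
      congr 2; ring
    intro k
    induction k using PlaneArr.int_induction with
    | zero => rw [hS.E_zero]; rfl
    | up k ih =>
      have hM := (hS.mem_invLogDer hW hA hD hc (k + 1)).1
      have h : e ⟨E (k + 1), hM⟩ = e ((e ^ (-(k + 1))) (PlaneArr.eulerInv W A)) := by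
        rw [hsucc]
        apply Subtype.ext
        rw [he, ih, hS.nabla_E]
      rw [← e.injective h]
    | down k ih =>
      rw [← hsucc, he, ih, hS.nabla_E]
  rw [hpow]
  exact hS.isEulerDerivation hW hA hD hc k
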